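/- Let $U\subseteq\mathbb R^3$ be open and connected, with coordinates $(x^0,x^1,x^2)$, let $M=U\times\mathbb R$ with coordinates $(x^0,x^1,x^2,x^3)$, and let $m>0$. All fields are smooth. On $M$ let there be given, all independent of $x^3$: a metric $g$ of signature $(+,-,-,-)$ with $g_{\alpha 3}=g_{3\alpha}=0$ for $\alpha=0,1,2$ and $g_{33}=-1$; a real covector potential $A$ with $A_3=0$; Pauli matrices $\sigma_{\alpha a\dot b}$, that is, Hermitian $2\times2$ matrices with $\sigma_{\alpha a\dot b}\sigma_\beta{}^{c\dot b}+\sigma_{\beta a\dot b}\sigma_\alpha{}^{c\dot b}=2g_{\alpha\beta}\delta_a{}^c$, with $\sigma_{3a\dot b}=\mathrm{diag}(1,-1)$. Spinor indices are raised by $\epsilon^{ab}=\epsilon^{\dot a\dot b}=\begin{pmatrix}0&1\\-1&0\end{pmatrix}$, as in $\sigma_\alpha{}^{a\dot b}=\epsilon^{ac}\epsilon^{\dot b\dot d}\sigma_{\alpha c\dot d}$ and $\eta^{\dot a}=\epsilon^{\dot a\dot b}\eta_{\dot b}$, and tensor indices by $g$. **The model.** The dynamical variables are a coframe $\vartheta=(\vartheta^0,\vartheta^1,\vartheta^2,\vartheta^3)$,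 i.e. real covector fields with $g=\vartheta^0\otimes\vartheta^0-\vartheta^1\otimes\vartheta^1-\vartheta^2\otimes\vartheta^2-\vartheta^3\otimes\vartheta^3$, and a positive density $\rho$. On the 5-manifold with additional coordinate $x^4$ put $$\boldsymbol\vartheta^0=\begin{pmatrix}\vartheta^0\\0\end{pmatrix},\quad \boldsymbol\vartheta^3=\begin{pmatrix}\vartheta^3\\0\end{pmatrix},\quad \boldsymbol\vartheta^1+i\boldsymbol\vartheta^2=\begin{pmatrix}\vartheta^1+i\vartheta^2\\0\end{pmatrix}e^{-2imx^4},\quad \boldsymbol\vartheta^4=\begin{pmatrix}0\\1\end{pmatrix},\quad \mathbf g=\begin{pmatrix}g_{\alpha\beta}-\frac1{m^2}A_\alpha A_\beta&\frac1mA_\alpha\\ \frac1mA_\beta&-1\end{pmatrix},$$ $$\mathbf T^{\mathrm{ax}}=\tfrac13\big(\boldsymbol\vartheta^0\wedge d\boldsymbol\vartheta^0-\boldsymbol\vartheta^1\wedge d\boldsymbol\vartheta^1-\boldsymbol\vartheta^2\wedge d\boldsymbol\vartheta^2-\boldsymbol\vartheta^3\wedge d\boldsymbol\vartheta^3-\boldsymbol\vartheta^4\wedge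 d\boldsymbol\vartheta^4\big),\qquad L(\vartheta,\rho)=\|\mathbf T^{\mathrm{ax}}\|^2\rho,$$ where $\|\mathbf T\|^2=\frac1{3!}\mathbf T_{\alpha\beta\gamma}\mathbf T_{\kappa\lambda\mu}\mathbf g^{\alpha\kappa}\mathbf g^{\beta\lambda}\mathbf g^{\gamma\mu}$; $L$ does not depend on $x^4$. The pair $(\vartheta,\rho)$ solves the field equations for $L$ if $\int L\,dx^0dx^1dx^2dx^3$ is stationary at $(\vartheta,\rho)$ under all smooth, compactly supported one-parameter variations through coframes and positive densities on $M$. A pair $(\vartheta,\rho)$ that does not depend on $x^3$ and has $\vartheta^3=dx^3$ solves the reduced field equations for $L$ if $\int L\,dx^0dx^1dx^2$ is stationary at it under all smooth variations through pairs of the same kind that are compactly supported in $U$. **The Dirac Lagrangians.** For an $x^3$-independent spinor field $\xi$ on $M$ put (summing over $\alpha=0,1,2$) $$L^\pm_{\mathrm{Dir}}(\xi)=\Big[\tfrac i2\big(\bar\xi^{\dot b}\sigma^\alpha{}_{a\dot b}\nabla_\alpha\xi^a-\xi^a\sigma^\alpha{}_{a\dot b}\nabla_\alpha\bar\xi^{\dot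 b}\big)+A_\alpha\xi^a\sigma^\alpha{}_{a\dot b}\bar\xi^{\dot b}\mp m\,\xi^a\sigma_{3a\dot b}\bar\xi^{\dot b}\Big]\sqrt{|\det g|},$$ where $\nabla_\alpha\xi^a=\partial_\alpha\xi^a+\frac14\sigma_\beta{}^{a\dot c}\big(\partial_\alpha\sigma^\beta{}_{b\dot c}+\Gamma^\beta{}_{\alpha\gamma}\sigma^\gamma{}_{b\dot c}\big)\xi^b$ and $\Gamma$ are the Christoffel symbols of $g$. The field equation for $L^\pm_{\mathrm{Dir}}$ says that $\int L^\pm_{\mathrm{Dir}}\,dx^0dx^1dx^2$ is stationary at $\xi$ under all smooth $x^3$-independent variations of $\xi$ compactly supported in $U$. **Theorem.** Let $(\vartheta,\rho)$ be a coframe and a positive density that do not depend on $x^3$, with $\vartheta^3=dx^3$. Let $\xi$ be a corresponding spinor field, i.e. $\xi$ does not depend on $x^3$, and with $\eta_{\dot b}=\xi^a\sigma_{3a\dot b}$ and $s=\xi^a\bar\eta_a$ one has $\operatorname{Im}s=0$, $s>0$, $\rho=|s|\sqrt{|\det g|}$ and $$(\vartheta^0+\vartheta^3)_\alpha=|s|^{-1}\xi^a\sigma_{\alpha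 a\dot b}\bar\xi^{\dot b},\quad(\vartheta^0-\vartheta^3)_\alpha=|s|^{-1}\bar\eta^a\sigma_{\alpha a\dot b}\eta^{\dot b},\quad(\vartheta^1+i\vartheta^2)_\alpha=-|s|^{-1}\xi^a\sigma_{\alpha a\dot b}\eta^{\dot b}.$$ Then $(\vartheta,\rho)$ solves the field equations for $L$ if and only if $\xi$ solves the field equation for $L^+_{\mathrm{Dir}}$ or the field equation for $L^-_{\mathrm{Dir}}$. The same equivalence holds with the reduced field equations for $L$ in place of the field equations for $L$. -/

import Mathlib

open scoped ContDiff Matrix BigOperators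

noncomputable section

namespace Cosserat

/-! ### Local coordinates, differential forms as antisymmetric tensors -/

/-- Partial derivative with respect to the coordinate `x^α`. -/
def pd {n : ℕ} {F : Type*} [NormedAddCommGroup F] [NormedSpace ℝ F]
    (α : Fin n) (f : (Fin n → ℝ) → F) (x : Fin n → ℝ) : F :=
  fderiv ℝ f x (Pi.single α 1)

/-- Components of a covector field in coordinates: `w x α` is `w_α(x)`. -/
abbrev CovField (n : ℕ) := (Fin n → ℝ) → Fin n → ℝ

/-- Exterior derivative of a 1-form, `(dw)_{αβ} = ∂_α w_β - ∂_β w_α`. -/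
def dform {n : ℕ} (w : CovField n) (x : Fin n → ℝ) (α β : Fin n) : ℝ :=
  pd α (fun z => w z β) x - pd β (fun z => w z α) x

/-- Wedge product of a covector with an antisymmetric tensor of rank 2. -/
def wedge {n : ℕ} (a : Fin n → ℝ) (b : Fin n → Fin n → ℝ) (α β γ : Fin n) : ℝ :=
  a α * b β γ + a β * b γ α + a γ * b α β

/-- Dot product `P · Q = (1/3!) P_{αβγ} Q_{κλμ} g^{ακ} g^{βλ} g^{γμ}` of antisymmetric
tensors of rank 3, for a metric with (lower index) matrix `G`. -/
def dot3 {n : ℕ} (G : Matrix (Fin n) (Fin n) ℝ) (P Q : Fin n → Fin n → Fin n → ℝ) : ℝ :=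
  (1 / (Nat.factorial 3 : ℝ)) * ∑ α, ∑ β, ∑ γ, ∑ κ, ∑ l, ∑ μ,
    P α β γ * Q κ l μ * G⁻¹ α κ * G⁻¹ β l * G⁻¹ γ μ

/-- The column `(v, a)`: append a last entry to a column. -/
def col {n : ℕ} (v : Fin n → ℝ) (a : ℝ) : Fin (n + 1) → ℝ :=
  Fin.snoc (α := fun _ => ℝ) v a

/-- Drop the last coordinate. -/
def base {n : ℕ} (y : Fin (n + 1) → ℝ) : Fin n → ℝ := fun α => y α.castSucc

/-! ### Metric, coframe and density on a coordinate patch of the 4-manifold -/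

/-- The signs `+,-,-,-`. -/
def sgn : Fin 4 → ℝ := ![1, -1, -1, -1]

/-- Metric components in coordinates: `g x α β` is `g_{αβ}(x)`. -/
abbrev MetricField := (Fin 4 → ℝ) → Matrix (Fin 4) (Fin 4) ℝ

/-- `ϑ j` is the covector field `ϑ^j`. -/
abbrev Coframe := Fin 4 → CovField 4

/-- `g` is a smooth metric on `M` of signature `(+,-,-,-)`. -/
structure IsLorentzMetric (M : Set (Fin 4 → ℝ)) (g : MetricField) : Prop where
  smooth : ∀ α β, ContDiffOn ℝ ∞ (fun x => g x α β) M
  signature : ∀ x ∈ M, ∃ P : Matrix (Fin 4) (Fin 4) ℝ,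
    IsUnit P.det ∧ g x = Pᵀ * Matrix.diagonal sgn * P

/-- The metric constraint
`g = ϑ^0 ⊗ ϑ^0 - ϑ^1 ⊗ ϑ^1 - ϑ^2 ⊗ ϑ^2 - ϑ^3 ⊗ ϑ^3` on `M`. -/
def IsCoframe (M : Set (Fin 4 → ℝ)) (g : MetricField) (ϑ : Coframe) : Prop :=
  ∀ x ∈ M, ∀ α β, g x α β = ∑ j, sgn j * ϑ j x α * ϑ j x β

/-- A dynamical state of the model: a smooth coframe and a smooth positive density. -/
structure IsState (M : Set (Fin 4 → ℝ)) (g : MetricField) (ϑ : Coframe)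
    (ρ : (Fin 4 → ℝ) → ℝ) : Prop where
  smooth_coframe : ∀ j α, ContDiffOn ℝ ∞ (fun x => ϑ j x α) M
  smooth_density : ContDiffOn ℝ ∞ ρ M
  coframe : IsCoframe M g ϑ
  pos : ∀ x ∈ M, 0 < ρ x

/-! ### Kaluza–Klein extension and the Lagrangian density -/

/-- `(ϑ^1 + i ϑ^2)_α e^{-2 i m x^4}`. -/
def rotated (m : ℝ) (ϑ : Coframe) (y : Fin 5 → ℝ) (α : Fin 4) : ℂ :=
  ((ϑ 1 (base y) α : ℂ) + Complex.I * (ϑ 2 (base y) α : ℂ)) *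
    Complex.exp (-2 * Complex.I * (m : ℂ) * (y (Fin.last 4) : ℂ))

/-- The extended coframe on the 5-manifold with coordinates `(x^0,x^1,x^2,x^3,x^4)`. -/
def extCoframe (m : ℝ) (ϑ : Coframe) : Fin 5 → CovField 5 := fun j y =>
  ![col (ϑ 0 (base y)) 0,
    col (fun α => (rotated m ϑ y α).re) 0,
    col (fun α => (rotated m ϑ y α).im) 0,
    col (ϑ 3 (base y)) 0,
    col 0 1] j

/-- The extended metric
`(g_{αβ} - A_α A_β / m², A_α / m ; A_β / m, -1)` at a point of the base. -/
def extMetric (m : ℝ) (g : MetricField) (A : CovField 4) (x : Fin 4 → ℝ) :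
    Matrix (Fin 5) (Fin 5) ℝ :=
  Matrix.of (Fin.snoc (α := fun _ => Fin 5 → ℝ)
    (fun α => col (fun β => g x α β - 1 / m ^ 2 * A x α * A x β) (1 / m * A x α))
    (col (fun β => 1 / m * A x β) (-1)))

/-- Axial torsion `(1/3)(ϑ^0∧dϑ^0 - ϑ^1∧dϑ^1 - ϑ^2∧dϑ^2 - ϑ^3∧dϑ^3 - ϑ^4∧dϑ^4)` of the
extended coframe. -/
def axialTorsion (m : ℝ) (ϑ : Coframe) (y : Fin 5 → ℝ) (α β γ : Fin 5) : ℝ :=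
  (1 / 3) * ∑ j : Fin 5, (![1, -1, -1, -1, -1] : Fin 5 → ℝ) j *
    wedge (extCoframe m ϑ j y) (dform (extCoframe m ϑ j) y) α β γ

/-- The Lagrangian density `L(ϑ,ρ) = ‖T^ax‖² ρ`. Its value does not depend on `x^4`, and it is
read here at `x^4 = 0`, as a density on the original spacetime. -/
def lagrangian (m : ℝ) (g : MetricField) (A : CovField 4) (ϑ : Coframe)
    (ρ : (Fin 4 → ℝ) → ℝ) (x : Fin 4 → ℝ) : ℝ :=
  dot3 (extMetric m g A x) (axialTorsion m ϑ (col x 0)) (axialTorsion m ϑ (col x 0)) * ρ x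

/-- A smooth one-parameter family of states on `M`, which is `(ϑ, ρ)` at parameter `0`, and for
every value of the parameter agrees with `(ϑ, ρ)` on `M` outside `S`. -/
structure IsVariation (M S : Set (Fin 4 → ℝ)) (g : MetricField) (ϑ : Coframe)
    (ρ : (Fin 4 → ℝ) → ℝ) (Θ : ℝ → Coframe) (P : ℝ → (Fin 4 → ℝ) → ℝ) : Prop where
  smooth_coframe : ∀ j α, ContDiffOn ℝ ∞
    (fun p : ℝ × (Fin 4 → ℝ) => Θ p.1 j p.2 α) (Set.univ ×ˢ M)
  smooth_density : ContDiffOn ℝ ∞ (fun p : ℝ × (Fin 4 → ℝ) => P p.1 p.2) (Set.univ ×ˢ M)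
  state : ∀ t, IsState M g (Θ t) (P t)
  start : ∀ x ∈ M, (∀ j, Θ 0 j x = ϑ j x) ∧ P 0 x = ρ x
  support : ∀ t, ∀ x ∈ M \ S, (∀ j, Θ t j x = ϑ j x) ∧ P t x = ρ x

/-- `(ϑ, ρ)` solves the field equations (Euler–Lagrange equations) for `L(ϑ,ρ)` on the open set
`M` of spacetime: the action `∫ L dx^0 dx^1 dx^2 dx^3` is stationary under all compactly supported
variations of coframe (subject to the metric constraint) and density. The action is taken over
the compact set outside which nothing is varied. -/
def IsSolution (M : Set (Fin 4 → ℝ)) (m : ℝ) (g : MetricField) (A : CovField 4)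
    (ϑ : Coframe) (ρ : (Fin 4 → ℝ) → ℝ) : Prop :=
  ∀ K : Set (Fin 4 → ℝ), IsCompact K → K ⊆ M →
    ∀ Θ P, IsVariation M K g ϑ ρ Θ P →
      HasDerivAt (fun t => ∫ x in K, lagrangian m g A (Θ t) (P t) x) 0 0

/-! ### No dependence on `x^3` -/

/-- The part of spacetime over the domain `U` of the coordinates `(x^0,x^1,x^2)`. -/
def cyl (U : Set (Fin 3 → ℝ)) : Set (Fin 4 → ℝ) := {x | base x ∈ U}

/-- On `M`, the function `f` does not depend on `x^3`. -/
def IndepX3 {β : Type*} (M : Set (Fin 4 → ℝ)) (f : (Fin 4 → ℝ) → β) : Prop :=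
  ∀ x ∈ M, ∀ y ∈ M, base x = base y → f x = f y

/-- States with `ϑ^3 = (0,0,0,1)` which do not depend on `x^3`. -/
structure IsSpecialState (U : Set (Fin 3 → ℝ)) (g : MetricField) (ϑ : Coframe)
    (ρ : (Fin 4 → ℝ) → ℝ) : Prop extends IsState (cyl U) g ϑ ρ where
  indep_coframe : ∀ j, IndepX3 (cyl U) (ϑ j)
  indep_density : IndepX3 (cyl U) ρ
  third : ∀ x ∈ cyl U, ϑ 3 x = Pi.single 3 1

/-- `(ϑ, ρ)` solves the field equations for `L(ϑ,ρ)` within the special case: `ϑ^3 = (0,0,0,1)`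
is kept fixed and the dynamical variables are functions of `(x^0,x^1,x^2)` only, so that the action
is `∫ L dx^0 dx^1 dx^2`. -/
def IsSpecialSolution (U : Set (Fin 3 → ℝ)) (m : ℝ) (g : MetricField) (A : CovField 4)
    (ϑ : Coframe) (ρ : (Fin 4 → ℝ) → ℝ) : Prop :=
  ∀ K : Set (Fin 3 → ℝ), IsCompact K → K ⊆ U →
    ∀ Θ P, IsVariation (cyl U) (cyl K) g ϑ ρ Θ P →
      (∀ t, IsSpecialState U g (Θ t) (P t)) →
      HasDerivAt (fun t => ∫ u in K, lagrangian m g A (Θ t) (P t) (col u 0)) 0 0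

/-! ### Spinors -/

/-- Covariant Pauli matrices: `σ α x a b` is `σ_{α a ḃ}(x)`. -/
abbrev PauliField := Fin 4 → (Fin 4 → ℝ) → Matrix (Fin 2) (Fin 2) ℂ

/-- Two-component spinor fields. -/
abbrev SpinorField := (Fin 4 → ℝ) → Fin 2 → ℂ

/-- The metric spinor. -/
def eps : Matrix (Fin 2) (Fin 2) ℂ := !![0, 1; -1, 0]

/-- Raising both spinor indices: `S^{a ḃ} = ε^{ac} ε^{ḃ ḋ} S_{c ḋ}`. -/
def spinUp (S : Matrix (Fin 2) (Fin 2) ℂ) : Matrix (Fin 2) (Fin 2) ℂ :=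
  Matrix.of fun a b => ∑ c, ∑ d, eps a c * eps b d * S c d

/-- Pauli matrices for the metric `g` on `M`: smooth Hermitian matrices with
`σ_{α a ḃ} σ_β^{c ḃ} + σ_{β a ḃ} σ_α^{c ḃ} = 2 g_{αβ} δ_a^c`. -/
structure IsPauli (M : Set (Fin 4 → ℝ)) (g : MetricField) (σ : PauliField) : Prop where
  smooth : ∀ α a b, ContDiffOn ℝ ∞ (fun x => σ α x a b) M
  hermitian : ∀ α, ∀ x ∈ M, (σ α x).IsHermitian
  clifford : ∀ x ∈ M, ∀ α β, ∀ a c,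
    (∑ b, (σ α x a b * spinUp (σ β x) c b + σ β x a b * spinUp (σ α x) c b))
      = 2 * (g x α β : ℂ) * (if a = c then 1 else 0)

/-- `σ^α = g^{αβ} σ_β`. -/
def sigmaUp (g : MetricField) (σ : PauliField) : PauliField := fun α x =>
  ∑ β, (((g x)⁻¹ α β : ℝ) : ℂ) • σ β x

/-- Christoffel symbols: `christoffel g x β α γ` is `Γ^β_{αγ}`. -/
def christoffel (g : MetricField) (x : Fin 4 → ℝ) (β α γ : Fin 4) : ℝ :=
  (1 / 2) * ∑ δ, (g x)⁻¹ β δ *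
    (pd α (fun z => g z γ δ) x + pd γ (fun z => g z α δ) x - pd δ (fun z => g z α γ) x)

/-- Covariant derivative of a spinor field,
`∇_α ξ^a = ∂_α ξ^a + (1/4) σ_β^{a ċ} (∂_α σ^β_{b ċ} + Γ^β_{αγ} σ^γ_{b ċ}) ξ^b`. -/
def spinNabla (g : MetricField) (σ : PauliField) (α : Fin 4) (ξ : SpinorField)
    (x : Fin 4 → ℝ) (a : Fin 2) : ℂ :=
  pd α (fun z => ξ z a) x +
    (1 / 4) * ∑ β, ∑ c, ∑ b, spinUp (σ β x) a c *
      (pd α (fun z => sigmaUp g σ β z b c) x +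
        ∑ γ, (christoffel g x β α γ : ℂ) * sigmaUp g σ γ x b c) * ξ x b

/-- The Lagrangian densities `L_Dir^+` (`ε = 1`) and `L_Dir^-` (`ε = -1`):
`[(i/2)(ξ̄^ḃ σ^α_{aḃ} ∇_α ξ^a - ξ^a σ^α_{aḃ} ∇_α ξ̄^ḃ) + A_α ξ^a σ^α_{aḃ} ξ̄^ḃ
  - ε m ξ^a σ_{3aḃ} ξ̄^ḃ] √|det g|`, with `α` summed over `0,1,2`.
The bracket is real because the Pauli matrices are Hermitian. -/
def diracLagrangian (ε m : ℝ) (g : MetricField) (A : CovField 4) (σ : PauliField)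
    (ξ : SpinorField) (x : Fin 4 → ℝ) : ℝ :=
  (∑ α : Fin 3, ∑ a, ∑ b,
      ((Complex.I / 2) *
          (star (ξ x b) * sigmaUp g σ α.castSucc x a b * spinNabla g σ α.castSucc ξ x a
            - ξ x a * sigmaUp g σ α.castSucc x a b * star (spinNabla g σ α.castSucc ξ x b))
        + (A x α.castSucc : ℂ) * (ξ x a * sigmaUp g σ α.castSucc x a b * star (ξ x b)))
    - (ε : ℂ) * (m : ℂ) * ∑ a, ∑ b, ξ x a * σ 3 x a b * star (ξ x b)).re
  * Real.sqrt |(g x).det|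

/-- A smooth one-parameter family of spinor fields on `cyl U` which do not depend on `x^3`, which
is `ξ` at parameter `0`, and for every value of the parameter agrees with `ξ` outside `cyl K`. -/
structure IsSpinorVariation (U K : Set (Fin 3 → ℝ)) (ξ : SpinorField)
    (Ξ : ℝ → SpinorField) : Prop where
  smooth : ∀ a, ContDiffOn ℝ ∞
    (fun p : ℝ × (Fin 4 → ℝ) => Ξ p.1 p.2 a) (Set.univ ×ˢ cyl U)
  indep : ∀ t, IndepX3 (cyl U) (Ξ t)
  start : ∀ x ∈ cyl U, Ξ 0 x = ξ x
  support : ∀ t, ∀ x ∈ cyl U \ cyl K, Ξ t x = ξ x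

/-- `ξ` solves the field equation for `L_Dir^+` (`ε = 1`) or `L_Dir^-` (`ε = -1`): the action
`∫ L_Dir^± dx^0 dx^1 dx^2` is stationary under all compactly supported variations of `ξ`. -/
def IsDiracSolution (U : Set (Fin 3 → ℝ)) (ε m : ℝ) (g : MetricField) (A : CovField 4)
    (σ : PauliField) (ξ : SpinorField) : Prop :=
  ∀ K : Set (Fin 3 → ℝ), IsCompact K → K ⊆ U →
    ∀ Ξ, IsSpinorVariation U K ξ Ξ →
      HasDerivAt (fun t => ∫ u in K, diracLagrangian ε m g A σ (Ξ t) (col u 0)) 0 0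

/-! ### Correspondence between bispinors and states -/

/-- The scalar `s = ξ^a η̄_a`. -/
def scalar (ξ η : SpinorField) (x : Fin 4 → ℝ) : ℂ := ∑ a, ξ x a * star (η x a)

/-- `η^ȧ = ε^{ȧ ḃ} η_ḃ`. -/
def etaUp (η : SpinorField) (x : Fin 4 → ℝ) (a : Fin 2) : ℂ := ∑ b, eps a b * η x b

/-- The coframe and density expressed via the bispinor field `ξ^a, η_ḃ`, together with the
constraint `Im s = 0`, `s > 0`. -/
structure Corresponds (M : Set (Fin 4 → ℝ)) (g : MetricField) (σ : PauliField)
    (ξ η : SpinorField) (ϑ : Coframe) (ρ : (Fin 4 → ℝ) → ℝ) : Prop where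
  im_scalar : ∀ x ∈ M, (scalar ξ η x).im = 0
  re_scalar : ∀ x ∈ M, 0 < (scalar ξ η x).re
  density : ∀ x ∈ M, ρ x = ‖scalar ξ η x‖ * Real.sqrt |(g x).det|
  plus : ∀ x ∈ M, ∀ α, ((ϑ 0 x α + ϑ 3 x α : ℝ) : ℂ) =
    ((‖scalar ξ η x‖⁻¹ : ℝ) : ℂ) * ∑ a, ∑ b, ξ x a * σ α x a b * star (ξ x b)
  minus : ∀ x ∈ M, ∀ α, ((ϑ 0 x α - ϑ 3 x α : ℝ) : ℂ) =
    ((‖scalar ξ η x‖⁻¹ : ℝ) : ℂ) *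
      ∑ a, ∑ b, star (etaUp η x a) * σ α x a b * etaUp η x b
  cross : ∀ x ∈ M, ∀ α, (ϑ 1 x α : ℂ) + Complex.I * (ϑ 2 x α : ℂ) =
    -((‖scalar ξ η x‖⁻¹ : ℝ) : ℂ) * ∑ a, ∑ b, ξ x a * σ α x a b * etaUp η x b

/-- `η_ḃ = ξ^a σ_{3 a ḃ}`. -/
def specialEta (σ : PauliField) (ξ : SpinorField) : SpinorField := fun x b =>
  ∑ a, ξ x a * σ 3 x a b

/-- The prescribed background in the special case with no dependence on `x^3`: a Lorentzian metric
with block structure, an electromagnetic covector potential with `A_3 = 0` and Pauli matrices with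
`σ_3 = diag(1,-1)`, none of which depends on `x^3`. -/
structure IsSpecialBackground (U : Set (Fin 3 → ℝ)) (g : MetricField) (A : CovField 4)
    (σ : PauliField) : Prop where
  metric : IsLorentzMetric (cyl U) g
  metric_indep : IndepX3 (cyl U) g
  metric_off : ∀ x ∈ cyl U, ∀ α : Fin 3, g x α.castSucc 3 = 0 ∧ g x 3 α.castSucc = 0
  metric_last : ∀ x ∈ cyl U, g x 3 3 = -1
  potential_smooth : ∀ α, ContDiffOn ℝ ∞ (fun x => A x α) (cyl U)
  potential_indep : IndepX3 (cyl U) A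
  potential_third : ∀ x ∈ cyl U, A x 3 = 0
  pauli : IsPauli (cyl U) g σ
  pauli_indep : ∀ α, IndepX3 (cyl U) (σ α)
  pauli_third : ∀ x ∈ cyl U, σ 3 x = !![1, 0; 0, -1]

end Cosserat

end

open scoped ContDiff Matrix BigOperators
open MeasureTheory Filter Topology

noncomputable section

namespace Cosserat

/-! ### Partial derivatives -/

section PartialDerivatives

variable {n : ℕ} {α : Fin n} {f h : (Fin n → ℝ) → ℝ} {x : Fin n → ℝ}

/-! Everything is governed by one scalar, the twist T: the (0,1,2) frame component of ϑ^0∧dϑ^0 −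
ϑ^1∧dϑ^1 − ϑ^2∧dϑ^2 − ϑ^3∧dϑ^3 + 4A∧ϑ^1∧ϑ^2. Both Lagrangians are simple functions of T and ρ, and
both sets of field equations turn out to be the system `EulerLagrange`.

The extended metric has the orthonormal frame (e_j, A(e_j)/m), (0,1). In it the phase e^{-2imx^4}
has two effects: it produces the potential terms, since dx^4 takes the value A(e_k)/m on the k-th
frame vector, and it gives the torsion the constant component 4m/3 in the directions (1,2,4). Hence
(`lagrangian_eq`) L = (ρ/9)(T² + S_0² + S_1² − S_2² − 16m²), where the S_i are the components
involving the index 3. If nothing depends on x^3 and ϑ^3 = dx^3, the S_i vanish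
(`sideTwist_eq_zero`). They enter quadratically, so the first variation does not see them, even
along variations that break the symmetry: δL = (1/9)(δρ (T² − 16m²) + 2ρT δT). Moreover δT involves
only the three Lorentz generators that preserve ϑ^3; the other three come with the factors S_i
(`IsFamilyAt.hasDerivAt_twist`). This is why the full and the reduced field equations agree.

Varying ρ gives T² = 16m², and connectedness of U fixes the sign: T = 4κm with κ = ±1. This nonzero
constant leaves the integral, and what remains is stationarity of ∫ρ δT, that is, three divergence
equations, one for each generator. Together these form `EulerLagrange` with the sign κ, and
conversely they make the action stationary.

On the spinor side, the coordinates of the Pauli matrices in the flat basis form a coframe ϕ with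
ϕ^3 = dx^3. A spinor ξ with N = |ξ^0|² − |ξ^1|² > 0 determines a Lorentz matrix Λ(ξ) fixing the last
axis, and the correspondence says ϑ = Λ(ξ)ϕ and ρ = N√|det g|. The twist of Λ(ξ)ϕ and the spin
connection in the frame ϕ are both explicit, and comparing them gives L_Dir^ε = ρ(T/4 − εm)
(`IsSpecialBackground.diracLagrangian_eq`). The four real directions at ξ are a scaling, a rotation
and two boosts. Scaling gives T = 4εm, after which the others give the same three divergence
equations. So the Dirac equation with sign ε is `EulerLagrange` with κ = ε. In short, L = (16/9)
L_Dir^+ L_Dir^- / ρ when the S_i vanish. -/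

theorem two_le_smooth : (2 : ℕ∞ω) ≤ ∞ := WithTop.coe_le_coe.2 (le_top : (2 : ℕ∞) ≤ ⊤)

theorem pd_congr {F : Type*} [NormedAddCommGroup F] [NormedSpace ℝ F]
    {f h : (Fin n → ℝ) → F} (e : f =ᶠ[𝓝 x] h) : pd α f x = pd α h x := by
  simp only [pd, e.fderiv_eq]

theorem pd_const (c : ℝ) : pd α (fun _ => c) x = 0 := by simp [pd]

theorem pd_mul (hf : DifferentiableAt ℝ f x) (hh : DifferentiableAt ℝ h x) :
    pd α (fun y => f y * h y) x = pd α f x * h x + f x * pd α h x := by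
  simp only [pd]
  rw [fderiv_fun_mul hf hh]
  simp
  ring

theorem pd_sum {ι : Type*} (s : Finset ι) {f : ι → (Fin n → ℝ) → ℝ}
    (hf : ∀ i ∈ s, DifferentiableAt ℝ (f i) x) :
    pd α (fun y => ∑ i ∈ s, f i y) x = ∑ i ∈ s, pd α (f i) x := by
  simp only [pd]
  rw [fderiv_fun_sum hf]
  simp

theorem pd_const_mul (c : ℝ) (hf : DifferentiableAt ℝ f x) :
    pd α (fun y => c * f y) x = c * pd α f x := by
  rw [pd_mul (differentiableAt_const c) hf, pd_const]; ring

theorem contDiffOn_pd {M : Set (Fin n → ℝ)} (hM : IsOpen M) (hf : ContDiffOn ℝ ∞ f M) :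
    ContDiffOn ℝ ∞ (pd α f) M :=
  (hf.fderiv_of_isOpen hM (by simp)).clm_apply contDiffOn_const

end PartialDerivatives

/-! ### Functions of a parameter and a point -/

section Slices

variable {n : ℕ} {f : ℝ × (Fin n → ℝ) → ℝ} {t : ℝ} {x : Fin n → ℝ}

theorem hasFDerivAt_pair_right (t : ℝ) (x : Fin n → ℝ) :
    HasFDerivAt (fun y : Fin n → ℝ => (t, y)) (ContinuousLinearMap.inr ℝ ℝ (Fin n → ℝ)) x :=
  hasFDerivAt_prodMk_right t x

theorem pd_slice (α : Fin n) (hf : DifferentiableAt ℝ f (t, x)) :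
    pd α (fun y => f (t, y)) x = fderiv ℝ f (t, x) (0, Pi.single α 1) := by
  have h := hf.hasFDerivAt.comp x (hasFDerivAt_pair_right t x)
  have h2 : HasFDerivAt (fun y => f (t, y)) _ x := h
  rw [pd, h2.fderiv]
  simp

theorem hasDerivAt_slice (hf : DifferentiableAt ℝ f (t, x)) :
    HasDerivAt (fun s => f (s, x)) (fderiv ℝ f (t, x) (1, 0)) t := by
  have h := hf.hasFDerivAt.comp_hasDerivAt t ((hasDerivAt_id t).prodMk (hasDerivAt_const t x))
  exact h

theorem contDiffOn_pd_slice (α : Fin n) {O : Set (ℝ × (Fin n → ℝ))} (hO : IsOpen O)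
    (hf : ContDiffOn ℝ ∞ f O) :
    ContDiffOn ℝ ∞ (fun p : ℝ × (Fin n → ℝ) => pd α (fun y => f (p.1, y)) p.2) O := by
  have h : ContDiffOn ℝ ∞ (fun p => fderiv ℝ f p (0, Pi.single α 1)) O :=
    (hf.fderiv_of_isOpen hO (by simp)).clm_apply contDiffOn_const
  refine h.congr fun p hp => ?_
  exact pd_slice α ((hf.contDiffAt (hO.mem_nhds hp)).differentiableAt (by simp))

theorem contDiffAt_slice {k : ℕ∞} (hf : ContDiffAt ℝ k f (t, x)) :
    ContDiffAt ℝ k (fun y => f (t, y)) x :=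
  ContDiffAt.comp x (g := f) (f := fun y => (t, y)) hf (contDiffAt_const.prodMk contDiffAt_id)

/-- Velocity at parameter `0` of a one-parameter family of functions. -/
def velocity (f : ℝ × (Fin n → ℝ) → ℝ) (x : Fin n → ℝ) : ℝ := deriv (fun s => f (s, x)) 0

theorem velocity_eq (hf : DifferentiableAt ℝ f (0, x)) :
    velocity f x = fderiv ℝ f (0, x) (1, 0) := (hasDerivAt_slice hf).deriv

theorem hasDerivAt_velocity (hf : DifferentiableAt ℝ f (0, x)) :
    HasDerivAt (fun s => f (s, x)) (velocity f x) 0 := by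
  rw [velocity_eq hf]; exact hasDerivAt_slice hf

theorem eventually_slice {P : ℝ × (Fin n → ℝ) → Prop} (h : ∀ᶠ p in 𝓝 (t, x), P p) :
    ∀ᶠ y in 𝓝 x, P (t, y) :=
  (Continuous.tendsto (by fun_prop : Continuous fun y : Fin n → ℝ => (t, y)) x).eventually h

theorem eventually_differentiableAt (hf : ContDiffAt ℝ ∞ f (t, x)) :
    ∀ᶠ p in 𝓝 (t, x), DifferentiableAt ℝ f p := by
  have h2 : ContDiffAt ℝ 2 f (t, x) := hf.of_le two_le_smooth
  filter_upwards [h2.eventually (by simp)] with p hp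
  exact hp.differentiableAt (by simp)

theorem velocity_eventuallyEq (hf : ContDiffAt ℝ ∞ f (0, x)) :
    velocity f =ᶠ[𝓝 x] fun y => fderiv ℝ f (0, y) (1, 0) := by
  filter_upwards [eventually_slice (eventually_differentiableAt hf)] with y hy
  exact velocity_eq hy

theorem contDiffAt_velocity (hf : ContDiffAt ℝ ∞ f (0, x)) : ContDiffAt ℝ ∞ (velocity f) x := by
  refine ContDiffAt.congr_of_eventuallyEq ?_ (velocity_eventuallyEq hf)
  have : ContDiffAt ℝ ∞ (fun p => fderiv ℝ f p (1, 0)) (0, x) :=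
    (hf.fderiv_right (by simp)).clm_apply contDiffAt_const
  exact contDiffAt_slice this

/-- The velocity of a partial derivative is the partial derivative of the velocity. -/
theorem hasDerivAt_pd_slice (α : Fin n) (hf : ContDiffAt ℝ ∞ f (0, x)) :
    HasDerivAt (fun s => pd α (fun y => f (s, y)) x) (pd α (velocity f) x) 0 := by
  have hd : DifferentiableAt ℝ (fderiv ℝ f) (0, x) :=
    (hf.fderiv_right (m := 1) (by rw [one_add_one_eq_two]; exact two_le_smooth)).differentiableAt (by simp)
  have h1 : HasDerivAt (fun s => fderiv ℝ f (s, x) (0, Pi.single α 1))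
      (fderiv ℝ (fderiv ℝ f) (0, x) (1, 0) (0, Pi.single α 1)) 0 := by
    have h := hd.hasFDerivAt.comp_hasDerivAt (0 : ℝ)
      ((hasDerivAt_id (0 : ℝ)).prodMk (hasDerivAt_const (0 : ℝ) x))
    exact h.clm_apply (hasDerivAt_const _ _) |>.congr_deriv (by simp)
  have h2 : pd α (velocity f) x
      = fderiv ℝ (fderiv ℝ f) (0, x) (0, Pi.single α 1) (1, 0) := by
    rw [pd_congr (velocity_eventuallyEq hf)]
    have h := (hd.hasFDerivAt.comp x (hasFDerivAt_pair_right 0 x)).clm_apply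
      (hasFDerivAt_const ((1 : ℝ), (0 : Fin n → ℝ)) x)
    have h' : HasFDerivAt (fun y => fderiv ℝ f (0, y) (1, 0)) _ x := h
    rw [pd, h'.fderiv]
    simp
  have hs := (hf.of_le two_le_smooth).isSymmSndFDerivAt
    (by simp)
  rw [h2, hs]
  refine h1.congr_of_eventuallyEq ?_
  have hev : ∀ᶠ s in 𝓝 (0 : ℝ), DifferentiableAt ℝ f (s, x) :=
    (Continuous.tendsto (by fun_prop : Continuous fun s : ℝ => (s, x)) 0).eventually
      (eventually_differentiableAt hf)
  filter_upwards [hev] with s hs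
  exact pd_slice α hs

end Slices

/-! ### Differentiation under the integral sign -/

/-- Smoothness is needed only on an open set around {0} × K: the tube lemma puts a product of a
small interval with K inside it, and on that compact product the t-derivative is bounded by a
constant, which serves as the dominating function. This generality is used for spinor families,
which may lose positive norm at large t. -/
theorem hasDerivAt_setIntegral {n : ℕ} {O : Set (ℝ × (Fin n → ℝ))} (hO : IsOpen O)
    {F : ℝ × (Fin n → ℝ) → ℝ} (hF : ContDiffOn ℝ ∞ F O) {K : Set (Fin n → ℝ)} (hK : IsCompact K)
    (hKO : ∀ x ∈ K, ((0 : ℝ), x) ∈ O) {F' : (Fin n → ℝ) → ℝ}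
    (hF' : ∀ x ∈ K, HasDerivAt (fun t => F (t, x)) (F' x) 0) :
    HasDerivAt (fun t => ∫ x in K, F (t, x)) (∫ x in K, F' x) 0 := by
  obtain ⟨u, v, hu, hv, h0u, hKv, huv⟩ := generalized_tube_lemma
    (isCompact_singleton (x := (0 : ℝ))) hK hO (by rintro ⟨t, x⟩ ⟨ht, hx⟩; cases ht; exact hKO x hx)
  obtain ⟨δ, hδ, hδu⟩ := Metric.isOpen_iff.1 hu 0 (h0u rfl)
  have hsub : Metric.closedBall (0 : ℝ) (δ / 2) ×ˢ K ⊆ O := fun p hp =>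
    huv ⟨hδu (Metric.closedBall_subset_ball (by linarith) hp.1), hKv hp.2⟩
  have hdiff : ∀ p ∈ O, DifferentiableAt ℝ F p := fun p hp =>
    (hF.contDiffAt (hO.mem_nhds hp)).differentiableAt (by simp)
  have hcont : ContinuousOn (fun p => fderiv ℝ F p (1, 0)) O :=
    ((hF.fderiv_of_isOpen hO (m := ∞) (by simp)).clm_apply contDiffOn_const).continuousOn
  have hcont' : ContinuousOn (fun p => fderiv ℝ F p (1, 0)) (Metric.closedBall (0 : ℝ) (δ / 2) ×ˢ K) :=
    hcont.mono hsub
  obtain ⟨C, hC⟩ := ((isCompact_closedBall (0 : ℝ) (δ / 2)).prod hK).exists_bound_of_continuousOn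
    hcont'
  have hpair : ∀ t : ℝ, ContinuousOn (fun x : Fin n → ℝ => (t, x)) K := fun t => by fun_prop
  have hball : Metric.closedBall (0 : ℝ) (δ / 2) ∈ 𝓝 (0 : ℝ) :=
    Metric.closedBall_mem_nhds _ (by linarith)
  have hmeas : ∀ t ∈ Metric.closedBall (0 : ℝ) (δ / 2), ContinuousOn (fun x => F (t, x)) K :=
    fun t ht => (hF.continuousOn.mono hsub).comp (hpair t) fun x hx => ⟨ht, hx⟩
  have h0 : (0 : ℝ) ∈ Metric.closedBall (0 : ℝ) (δ / 2) := mem_of_mem_nhds hball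
  have key : HasDerivAt (fun t => ∫ x in K, F (t, x))
      (∫ x in K, fderiv ℝ F (0, x) (1, 0)) 0 := by
    refine (hasDerivAt_integral_of_dominated_loc_of_deriv_le (μ := volume.restrict K)
      (F := fun t x => F (t, x)) (F' := fun t x => fderiv ℝ F (t, x) (1, 0)) (bound := fun _ => C)
      hball ?_ ?_ ?_ ?_ ?_ ?_).2
    · filter_upwards [hball] with t ht
      exact (hmeas t ht).aestronglyMeasurable hK.measurableSet
    · exact (hmeas 0 h0).integrableOn_compact hK
    · exact (hcont'.comp (hpair 0) fun x hx => ⟨h0, hx⟩).aestronglyMeasurable hK.measurableSet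
    · exact (ae_restrict_iff' hK.measurableSet).2 (ae_of_all _ fun x hx t ht => hC (t, x) ⟨ht, hx⟩)
    · exact integrableOn_const (hK.measure_lt_top.ne)
    · exact (ae_restrict_iff' hK.measurableSet).2 (ae_of_all _ fun x hx t ht =>
        hasDerivAt_slice (hdiff _ (hsub ⟨ht, hx⟩)))
  convert key using 1
  refine setIntegral_congr_fun hK.measurableSet fun x hx => ?_
  exact (hF' x hx).unique (hasDerivAt_slice (hdiff _ (hKO x hx)))

/-! ### Integration by parts and the fundamental lemma -/

section Divergence

variable {n : ℕ} {M K : Set (Fin n → ℝ)}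

/-- Cutting w off outside K gives a function smooth on all of space: it agrees with w on M, and it
vanishes near every point outside the closed set K. -/
theorem setIntegral_pd_eq_zero (hM : IsOpen M) (hK : IsCompact K) (hKM : K ⊆ M) (α : Fin n)
    {w : (Fin n → ℝ) → ℝ} (hw : ContDiffOn ℝ ∞ w M) (h0 : ∀ x ∈ M \ K, w x = 0) :
    ∫ x in K, pd α w x = 0 := by
  classical
  set W : (Fin n → ℝ) → ℝ := K.indicator w with hW
  have hWM : ∀ x ∈ M, W x = w x := fun x hx => by
    by_cases hxK : x ∈ K
    · simp [hW, hxK]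
    · simp [hW, hxK, h0 x ⟨hx, hxK⟩]
  have hWc : ∀ x ∉ K, W x = 0 := fun x hx => by simp [hW, hx]
  have hnear : ∀ x ∉ K, W =ᶠ[𝓝 x] fun _ => 0 := fun x hx => by
    filter_upwards [hK.isClosed.isOpen_compl.mem_nhds hx] with y hy using hWc y hy
  have hWs : ContDiff ℝ ∞ W := contDiff_iff_contDiffAt.2 fun x => by
    by_cases hxK : x ∈ K
    · refine (hw.contDiffAt (hM.mem_nhds (hKM hxK))).congr_of_eventuallyEq ?_
      filter_upwards [hM.mem_nhds (hKM hxK)] with y hy using hWM y hy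
    · exact contDiffAt_const.congr_of_eventuallyEq (hnear x hxK)
  have hcs : HasCompactSupport W := HasCompactSupport.intro hK hWc
  have hpd : ∀ x ∈ K, pd α w x = pd α W x := fun x hx => pd_congr <| by
    filter_upwards [hM.mem_nhds (hKM hx)] with y hy using (hWM y hy).symm
  rw [setIntegral_congr_fun hK.measurableSet hpd, setIntegral_eq_integral_of_forall_compl_eq_zero
    (fun x hx => by rw [pd_congr (hnear x hx), pd_const])]
  have hc : Continuous (fun x => fderiv ℝ W x (Pi.single α 1)) :=
    (hWs.continuous_fderiv (by simp)).clm_apply continuous_const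
  have hcs' : HasCompactSupport (fun x => fderiv ℝ W x (Pi.single α 1)) :=
    hcs.fderiv_apply ℝ _
  -- Integration by parts against the constant function 1.
  have := integral_mul_fderiv_eq_neg_fderiv_mul_of_integrable (μ := volume)
    (f := fun _ : Fin n → ℝ => (1 : ℝ)) (g := W) (v := Pi.single α 1) (by simp)
    (by simpa using hc.integrable_of_hasCompactSupport hcs')
    (by simpa using hWs.continuous.integrable_of_hasCompactSupport hcs)
    (fun x _ => differentiableAt_const _) (fun x _ => hWs.differentiable (by simp) x)
  simpa [pd] using this

variable {V : Fin n → (Fin n → ℝ) → ℝ} {c b : (Fin n → ℝ) → ℝ}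

/-- The integrand is the divergence of bV, and bV vanishes outside K. -/
theorem setIntegral_divergence (hM : IsOpen M) (hK : IsCompact K) (hKM : K ⊆ M)
    (hV : ∀ α, ContDiffOn ℝ ∞ (V α) M) (hb : ContDiffOn ℝ ∞ b M) (h0 : ∀ x ∈ M \ K, b x = 0) :
    ∫ x in K, (∑ α, V α x * pd α b x + (∑ α, pd α (V α) x) * b x) = 0 := by
  have hd : ∀ x ∈ K, (∑ α, V α x * pd α b x + (∑ α, pd α (V α) x) * b x)
      = ∑ α, pd α (fun y => V α y * b y) x := fun x hx => by
    rw [Finset.sum_mul, ← Finset.sum_add_distrib]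
    refine Finset.sum_congr rfl fun α _ => ?_
    have hx' := hM.mem_nhds (hKM hx)
    rw [pd_mul ((hV α).contDiffAt hx' |>.differentiableAt (by simp))
      (hb.contDiffAt hx' |>.differentiableAt (by simp))]
    ring
  rw [setIntegral_congr_fun hK.measurableSet hd, integral_finsetSum]
  · refine Finset.sum_eq_zero fun α _ => setIntegral_pd_eq_zero hM hK hKM α ((hV α).mul hb) ?_
    intro x hx
    simp [h0 x hx]
  · intro α _
    have hc : ContinuousOn (pd α fun y => V α y * b y) K :=
      (contDiffOn_pd hM ((hV α).mul hb)).continuousOn.mono hKM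
    exact hc.integrableOn_compact hK

/-- A weak divergence equation holds in the classical sense. -/
theorem divergence_eq_of_weak (hM : IsOpen M) (hV : ∀ α, ContDiffOn ℝ ∞ (V α) M)
    (hc : ContDiffOn ℝ ∞ c M)
    (h : ∀ b : (Fin n → ℝ) → ℝ, ContDiff ℝ ∞ b → HasCompactSupport b → tsupport b ⊆ M →
      ∫ x in tsupport b, (∑ α, V α x * pd α b x + c x * b x) = 0) :
    ∀ x ∈ M, ∑ α, pd α (V α) x = c x := by
  have hdiv : ContDiffOn ℝ ∞ (fun x => ∑ α, pd α (V α) x) M :=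
    ContDiffOn.sum fun α _ => contDiffOn_pd hM (hV α)
  have hf := hc.sub hdiv
  -- A continuous function vanishing almost everywhere on an open set vanishes on it; the
  -- almost-everywhere statement is the fundamental lemma of the calculus of variations.
  suffices hae : ∀ᵐ x ∂(volume : Measure (Fin n → ℝ)), x ∈ M → c x - ∑ α, pd α (V α) x = 0 by
    have heq := Measure.eqOn_open_of_ae_eq (μ := volume) (g := fun _ => (0 : ℝ))
      ((ae_restrict_iff' hM.measurableSet).2 hae) hM hf.continuousOn continuousOn_const
    intro x hx
    have := heq hx
    simp only at this
    linarith
  · refine hM.ae_eq_zero_of_integral_contDiff_smul_eq_zero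
      (hf.continuousOn.locallyIntegrableOn hM.measurableSet) ?_
    intro b hb hcs hsub
    have hK : IsCompact (tsupport b) := hcs
    have h1 := h b hb hcs hsub
    have h2 := setIntegral_divergence hM hK hsub hV hb.contDiffOn
      (fun x hx => image_eq_zero_of_notMem_tsupport hx.2)
    rw [← setIntegral_eq_integral_of_forall_compl_eq_zero (s := tsupport b)
      (fun x hx => by simp [image_eq_zero_of_notMem_tsupport hx])]
    have i0 : ∀ α, ContinuousOn (fun x => V α x * pd α b x) (tsupport b) := fun α =>
      ((hV α).mul (contDiffOn_pd hM hb.contDiffOn)).continuousOn.mono hsub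
    have i1 : ContinuousOn (fun x => ∑ α, V α x * pd α b x + c x * b x) (tsupport b) :=
      (continuousOn_finsetSum _ fun α _ => i0 α).add
        ((hc.mul hb.contDiffOn).continuousOn.mono hsub)
    have i2 : ContinuousOn (fun x => ∑ α, V α x * pd α b x + (∑ α, pd α (V α) x) * b x)
        (tsupport b) :=
      (continuousOn_finsetSum _ fun α _ => i0 α).add
        ((hdiv.mul hb.contDiffOn).continuousOn.mono hsub)
    have := integral_sub (i1.integrableOn_compact (μ := volume) hK) (i2.integrableOn_compact hK)
    rw [h1, h2, sub_zero] at this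
    refine Eq.trans ?_ this
    refine integral_congr_ae (ae_of_all _ fun x => ?_)
    simp only [smul_eq_mul]
    ring

/-- A function whose weighted averages against test functions vanish is zero. -/
theorem eq_zero_of_weak (hM : IsOpen M) (hc : ContDiffOn ℝ ∞ c M)
    (h : ∀ b : (Fin n → ℝ) → ℝ, ContDiff ℝ ∞ b → HasCompactSupport b → tsupport b ⊆ M →
      ∫ x in tsupport b, c x * b x = 0) :
    ∀ x ∈ M, c x = 0 := by
  intro x hx
  have := divergence_eq_of_weak (V := fun _ _ => (0 : ℝ)) hM (fun _ => contDiffOn_const) hc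
    (fun b hb hcs hsub => by simpa using h b hb hcs hsub) x hx
  simpa only [pd_const, Finset.sum_const_zero] using this.symm

end Divergence

/-! ### Smoothness of the inverse matrix -/

section MatrixInverse

variable {E : Type*} [NormedAddCommGroup E] [NormedSpace ℝ E] {k : ℕ}
  {S : Set E} {A : E → Matrix (Fin k) (Fin k) ℝ}

theorem contDiffOn_det (hA : ∀ i j, ContDiffOn ℝ ∞ (fun x => A x i j) S) :
    ContDiffOn ℝ ∞ (fun x => (A x).det) S := by
  simp only [Matrix.det_apply']
  exact ContDiffOn.sum fun p _ => contDiffOn_const.mul (contDiffOn_prod fun i _ => hA _ _)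

/-- By Cramer's rule an entry of the inverse is a quotient of two determinants. -/
theorem contDiffOn_inv (hA : ∀ i j, ContDiffOn ℝ ∞ (fun x => A x i j) S)
    (hdet : ∀ x ∈ S, (A x).det ≠ 0) (i j : Fin k) :
    ContDiffOn ℝ ∞ (fun x => (A x)⁻¹ i j) S := by
  have h : ∀ x, (A x)⁻¹ i j = ((A x).det)⁻¹ * ((A x).updateRow j (Pi.single i 1)).det := fun x => by
    rw [Matrix.inv_def, Matrix.smul_apply, Matrix.adjugate_apply, Ring.inverse_eq_inv', smul_eq_mul]
  simp only [h]
  refine ((contDiffOn_det hA).inv hdet).mul (contDiffOn_det fun a b => ?_)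
  by_cases hja : a = j
  · subst hja
    simp only [Matrix.updateRow_self]
    exact contDiffOn_const
  · simp only [Matrix.updateRow_ne hja]
    exact hA a b

end MatrixInverse

/-! ### Dual frames -/

section DualFrames

variable {n : ℕ} {G : Matrix (Fin n) (Fin n) ℝ} {s : Fin n → ℝ} {T e : Fin n → Fin n → ℝ}

theorem metric_eq_matrix (hG : ∀ α β, G α β = ∑ j, s j * T j α * T j β) :
    G = (Matrix.of T)ᵀ * Matrix.diagonal s * Matrix.of T := by
  ext α β
  rw [hG, Matrix.mul_apply]
  refine Finset.sum_congr rfl fun j _ => ?_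
  rw [Matrix.mul_diagonal]
  simp only [Matrix.transpose_apply, Matrix.of_apply]
  ring

theorem dual_matrix (hd : ∀ j k, ∑ α, T j α * e k α = if j = k then 1 else 0) :
    Matrix.of T * (Matrix.of e)ᵀ = 1 := by
  ext j k
  rw [Matrix.mul_apply, Matrix.one_apply, ← hd]
  rfl

theorem dual_complete (hd : ∀ j k, ∑ α, T j α * e k α = if j = k then 1 else 0) (α β : Fin n) :
    ∑ j, e j α * T j β = if α = β then 1 else 0 := by
  have h := congrArg (fun A : Matrix (Fin n) (Fin n) ℝ => A α β) (mul_eq_one_comm.1 (dual_matrix hd))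
  rw [Matrix.mul_apply, Matrix.one_apply] at h
  exact h

/-- In matrix form G = TᵀDT with D² = 1, so EᵀDE is a right inverse of G when TEᵀ = 1. -/
theorem inv_eq_of_dual (hs : ∀ j, s j * s j = 1)
    (hG : ∀ α β, G α β = ∑ j, s j * T j α * T j β)
    (hd : ∀ j k, ∑ α, T j α * e k α = if j = k then 1 else 0) (α β : Fin n) :
    G⁻¹ α β = ∑ j, s j * e j α * e j β := by
  have hTE := dual_matrix hd
  have hET := mul_eq_one_comm.1 hTE
  have hss : Matrix.diagonal s * Matrix.diagonal s = 1 := by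
    rw [Matrix.diagonal_mul_diagonal, ← Matrix.diagonal_one]
    exact congrArg _ (funext hs)
  have key : G * ((Matrix.of e)ᵀ * Matrix.diagonal s * Matrix.of e) = 1 := by
    rw [metric_eq_matrix hG]
    calc _ = (Matrix.of T)ᵀ * (Matrix.diagonal s * (Matrix.of T * (Matrix.of e)ᵀ) *
          Matrix.diagonal s) * Matrix.of e := by simp only [Matrix.mul_assoc]
      _ = ((Matrix.of e)ᵀ * Matrix.of T)ᵀ := by
        rw [hTE, Matrix.mul_one, hss, Matrix.mul_one, Matrix.transpose_mul,
          Matrix.transpose_transpose]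
      _ = 1 := by rw [hET, Matrix.transpose_one]
  rw [Matrix.inv_eq_right_inv key, Matrix.mul_apply]
  refine Finset.sum_congr rfl fun j _ => ?_
  rw [Matrix.mul_diagonal]
  simp only [Matrix.transpose_apply, Matrix.of_apply]
  ring

/-- The relation G⁻¹TᵀD · T = 1 makes G⁻¹TᵀD a left inverse of the square matrix T, hence also a
right inverse. -/
theorem dual_of_inv (hdet : G.det ≠ 0)
    (hG : ∀ α β, G α β = ∑ j, s j * T j α * T j β) (j k : Fin n) :
    ∑ α, T j α * (s k * ∑ β, G⁻¹ α β * T k β) = if j = k then 1 else 0 := by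
  have hGm := metric_eq_matrix hG
  have h1 : (G⁻¹ * (Matrix.of T)ᵀ * Matrix.diagonal s) * Matrix.of T = 1 := by
    rw [Matrix.mul_assoc, Matrix.mul_assoc, ← Matrix.mul_assoc _ _ (Matrix.of T), ← hGm]
    exact Matrix.nonsing_inv_mul _ (isUnit_iff_ne_zero.2 hdet)
  have h2 := congrArg (fun A : Matrix (Fin n) (Fin n) ℝ => A j k) (mul_eq_one_comm.1 h1)
  rw [Matrix.one_apply] at h2
  rw [← h2, Matrix.mul_apply]
  refine Finset.sum_congr rfl fun α _ => ?_
  rw [Matrix.mul_diagonal, Matrix.mul_apply]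
  simp only [Matrix.transpose_apply, Matrix.of_apply]
  ring

/-- Contraction of a sum of products of vectors with an inverse metric. -/
theorem contract_inv (hi : ∀ α β, G⁻¹ α β = ∑ j, s j * e j α * e j β) {ι : Type*} [Fintype ι]
    (c : ι → ℝ) (u v : ι → Fin n → ℝ) :
    ∑ α, ∑ κ, G⁻¹ α κ * ∑ i, c i * (u i α * v i κ) =
      ∑ i, ∑ j, s j * c i * ((∑ α, e j α * u i α) * ∑ κ, e j κ * v i κ) := by
  have h1 : ∀ α κ, G⁻¹ α κ * ∑ i, c i * (u i α * v i κ) =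
      ∑ i, ∑ j, s j * c i * ((e j α * u i α) * (e j κ * v i κ)) := fun α κ => by
    rw [hi, Finset.sum_mul_sum, Finset.sum_comm]
    exact Finset.sum_congr rfl fun i _ => Finset.sum_congr rfl fun j _ => by ring
  have h2 : ∀ i j, s j * c i * ((∑ α, e j α * u i α) * ∑ κ, e j κ * v i κ) =
      ∑ α, ∑ κ, s j * c i * ((e j α * u i α) * (e j κ * v i κ)) := fun i j => by
    rw [Finset.sum_mul_sum]
    simp only [Finset.mul_sum]
  simp only [h1, h2]
  rw [Finset.sum_congr rfl fun α _ => Finset.sum_comm, Finset.sum_comm]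
  refine Finset.sum_congr rfl fun i _ => ?_
  rw [Finset.sum_congr rfl fun α _ => Finset.sum_comm, Finset.sum_comm]

/-- Frame components of a rank-3 array. -/
def frame3 (e : Fin n → Fin n → ℝ) (P : Fin n → Fin n → Fin n → ℝ) (j k l : Fin n) : ℝ :=
  ∑ α, e j α * ∑ β, e k β * ∑ γ, e l γ * P α β γ

/-- The inverse metric is diagonal in the frame, so the three contractions are carried out one at a
time, the innermost first, each by `contract_inv`. -/
theorem dot3_self (hi : ∀ α β, G⁻¹ α β = ∑ j, s j * e j α * e j β)
    (P : Fin n → Fin n → Fin n → ℝ) :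
    dot3 G P P = (1 / 6) * ∑ l, ∑ k, ∑ j, s j * s k * s l * frame3 e P j k l ^ 2 := by
  -- The sum over a one-point type gives the innermost contraction the shape that `contract_inv`
  -- expects.
  have h1 : dot3 G P P = (1 / 6) * ∑ α, ∑ κ, G⁻¹ α κ * ∑ β, ∑ l, G⁻¹ β l *
      ∑ γ, ∑ μ, G⁻¹ γ μ * ∑ _i : Unit, 1 * (P α β γ * P κ l μ) := by
    rw [dot3, show ((Nat.factorial 3 : ℕ) : ℝ) = 6 by norm_num [Nat.factorial]]
    congr 1
    refine Finset.sum_congr rfl fun α _ => ?_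
    simp only [Finset.mul_sum]
    rw [Finset.sum_congr rfl fun β _ => Finset.sum_comm, Finset.sum_comm]
    refine Finset.sum_congr rfl fun κ _ => Finset.sum_congr rfl fun β _ => ?_
    rw [Finset.sum_comm]
    refine Finset.sum_congr rfl fun l _ => Finset.sum_congr rfl fun γ _ =>
      Finset.sum_congr rfl fun μ _ => ?_
    simp only [Finset.univ_unique, Finset.sum_const, Finset.card_singleton, one_smul]
    ring
  have h2 : ∀ α κ β l, ∑ γ, ∑ μ, G⁻¹ γ μ * ∑ _i : Unit, 1 * (P α β γ * P κ l μ)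
      = ∑ r, s r * ((∑ γ, e r γ * P α β γ) * ∑ μ, e r μ * P κ l μ) := fun α κ β l => by
    rw [contract_inv hi]
    simp
  have h3 : ∀ α κ, ∑ β, ∑ l, G⁻¹ β l *
      ∑ r, s r * ((∑ γ, e r γ * P α β γ) * ∑ μ, e r μ * P κ l μ)
      = ∑ i : Fin n × Fin n, s i.2 * s i.1 * ((∑ β, e i.2 β * ∑ γ, e i.1 γ * P α β γ) *
        ∑ l, e i.2 l * ∑ μ, e i.1 μ * P κ l μ) := fun α κ => by
    rw [contract_inv hi s (fun r β => ∑ γ, e r γ * P α β γ) (fun r l => ∑ μ, e r μ * P κ l μ),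
      Fintype.sum_prod_type]
  rw [h1]
  simp only [h2, h3]
  rw [contract_inv hi (fun i : Fin n × Fin n => s i.2 * s i.1)
    (fun i α => ∑ β, e i.2 β * ∑ γ, e i.1 γ * P α β γ)
    (fun i κ => ∑ l, e i.2 l * ∑ μ, e i.1 μ * P κ l μ), Fintype.sum_prod_type]
  congr 1
  refine Finset.sum_congr rfl fun l _ => Finset.sum_congr rfl fun k _ =>
    Finset.sum_congr rfl fun j _ => ?_
  rw [frame3]
  ring

/-- Frame components of a rank-2 array. -/
def frame2 (e : Fin n → Fin n → ℝ) (b : Fin n → Fin n → ℝ) (k l : Fin n) : ℝ :=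
  ∑ β, ∑ γ, b β γ * e k β * e l γ

theorem frame2_antisymm {b : Fin n → Fin n → ℝ} (hb : ∀ β γ, b β γ = -b γ β) (k l : Fin n) :
    frame2 e b k l = -frame2 e b l k := by
  simp only [frame2, ← Finset.sum_neg_distrib]
  rw [Finset.sum_comm]
  refine Finset.sum_congr rfl fun γ _ => Finset.sum_congr rfl fun β _ => ?_
  rw [hb]; ring

theorem frame3_wedge (a : Fin n → ℝ) (b : Fin n → Fin n → ℝ) (j k l : Fin n) :
    frame3 e (wedge a b) j k l =
      (∑ α, a α * e j α) * frame2 e b k l + (∑ α, a α * e k α) * frame2 e b l j +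
      (∑ α, a α * e l α) * frame2 e b j k := by
  have h1 : (∑ α, a α * e j α) * frame2 e b k l =
      ∑ α, ∑ β, ∑ γ, a α * e j α * (b β γ * e k β * e l γ) := by
    rw [Finset.sum_mul]
    simp only [frame2, Finset.mul_sum]
  have h2 : (∑ α, a α * e k α) * frame2 e b l j =
      ∑ α, ∑ β, ∑ γ, a β * e k β * (b γ α * e l γ * e j α) := by
    rw [Finset.sum_mul]
    simp only [frame2, Finset.mul_sum]
    rw [Finset.sum_congr rfl fun β _ => Finset.sum_comm, Finset.sum_comm]
  have h3 : (∑ α, a α * e l α) * frame2 e b j k =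
      ∑ α, ∑ β, ∑ γ, a γ * e l γ * (b α β * e j α * e k β) := by
    rw [Finset.sum_mul]
    simp only [frame2, Finset.mul_sum]
    rw [Finset.sum_comm, Finset.sum_congr rfl fun β _ => Finset.sum_comm]
  rw [h1, h2, h3, frame3]
  simp only [Finset.mul_sum, ← Finset.sum_add_distrib, wedge]
  refine Finset.sum_congr rfl fun α _ => Finset.sum_congr rfl fun β _ =>
    Finset.sum_congr rfl fun γ _ => ?_
  ring

theorem frame3_sum {ι : Type*} [Fintype ι] (c : ι → ℝ) (P : ι → Fin n → Fin n → Fin n → ℝ)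
    (j k l : Fin n) :
    frame3 e (fun α β γ => ∑ i, c i * P i α β γ) j k l = ∑ i, c i * frame3 e (P i) j k l := by
  simp only [frame3, Finset.mul_sum]
  rw [Finset.sum_congr rfl fun α _ => Finset.sum_congr rfl fun β _ => Finset.sum_comm,
    Finset.sum_congr rfl fun α _ => Finset.sum_comm, Finset.sum_comm]
  refine Finset.sum_congr rfl fun i _ => Finset.sum_congr rfl fun α _ =>
    Finset.sum_congr rfl fun β _ => Finset.sum_congr rfl fun γ _ => ?_
  ring

end DualFrames

/-! ### The dual frame of a coframe and structure coefficients -/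

theorem sgn_mul_self (j : Fin 4) : sgn j * sgn j = 1 := by
  fin_cases j <;> simp [sgn]

/-- The vector `e_j^α` dual to the coframe, obtained by raising an index. -/
def dualFrame (g : MetricField) (ϑ : Coframe) (x : Fin 4 → ℝ) (j α : Fin 4) : ℝ :=
  sgn j * ∑ β, (g x)⁻¹ α β * ϑ j x β

/-- Structure coefficients `dϑ^i(e_k, e_l)`. -/
def structCoeff (g : MetricField) (ϑ : Coframe) (x : Fin 4 → ℝ) (i k l : Fin 4) : ℝ :=
  frame2 (dualFrame g ϑ x) (dform (ϑ i) x) k l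

/-- Frame components of the potential. -/
def framePot (g : MetricField) (A : CovField 4) (ϑ : Coframe) (x : Fin 4 → ℝ) (k : Fin 4) : ℝ :=
  ∑ α, A x α * dualFrame g ϑ x k α

theorem dform_antisymm {n : ℕ} (w : CovField n) (x : Fin n → ℝ) (α β : Fin n) :
    dform w x α β = -dform w x β α := by simp [dform]

theorem structCoeff_antisymm (g : MetricField) (ϑ : Coframe) (x : Fin 4 → ℝ) (i k l : Fin 4) :
    structCoeff g ϑ x i k l = -structCoeff g ϑ x i l k :=
  frame2_antisymm (dform_antisymm _ _) k l

/-- The coframe and metric are compatible at a point. -/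
structure FrameAt (g : MetricField) (ϑ : Coframe) (x : Fin 4 → ℝ) : Prop where
  det_ne : (g x).det ≠ 0
  metric : ∀ α β, g x α β = ∑ j, sgn j * ϑ j x α * ϑ j x β

namespace FrameAt

variable {g : MetricField} {ϑ : Coframe} {x : Fin 4 → ℝ}

theorem dual (h : FrameAt g ϑ x) (j k : Fin 4) :
    ∑ α, ϑ j x α * dualFrame g ϑ x k α = if j = k then 1 else 0 :=
  dual_of_inv (T := fun j => ϑ j x) h.det_ne h.metric j k

theorem complete (h : FrameAt g ϑ x) (α β : Fin 4) :
    ∑ j, dualFrame g ϑ x j α * ϑ j x β = if α = β then 1 else 0 :=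
  dual_complete h.dual α β

theorem inv_metric (h : FrameAt g ϑ x) (α β : Fin 4) :
    (g x)⁻¹ α β = ∑ j, sgn j * dualFrame g ϑ x j α * dualFrame g ϑ x j β :=
  inv_eq_of_dual (T := fun j => ϑ j x) sgn_mul_self h.metric h.dual α β

end FrameAt

/-! ### The extended coframe -/

theorem col_castSucc {n : ℕ} (v : Fin n → ℝ) (a : ℝ) (α : Fin n) : col v a α.castSucc = v α := by
  simp [col]

theorem col_last {n : ℕ} (v : Fin n → ℝ) (a : ℝ) : col v a (Fin.last n) = a := by
  simp [col]

theorem base_col {n : ℕ} (v : Fin n → ℝ) (a : ℝ) : base (col v a) = v := by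
  funext α; simp [base, col]

theorem col_base_last {n : ℕ} (y : Fin (n + 1) → ℝ) : col (base y) (y (Fin.last n)) = y := by
  funext α
  refine Fin.lastCases ?_ (fun i => ?_) α
  · rw [col_last]
  · rw [col_castSucc]; rfl

/-- Dropping the last coordinate, as a continuous linear map. -/
def baseL (n : ℕ) : (Fin (n + 1) → ℝ) →L[ℝ] (Fin n → ℝ) :=
  ContinuousLinearMap.pi fun α => ContinuousLinearMap.proj α.castSucc

theorem baseL_apply {n : ℕ} (y : Fin (n + 1) → ℝ) : baseL n y = base y := rfl

theorem contDiff_base {n : ℕ} : ContDiff ℝ ∞ (base (n := n)) := (baseL n).contDiff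

theorem base_single_castSucc {n : ℕ} (α : Fin n) :
    base (Pi.single α.castSucc (1 : ℝ)) = Pi.single α 1 := by
  funext β
  simp [base, Pi.single_apply]

theorem base_single_last {n : ℕ} : base (Pi.single (Fin.last n) (1 : ℝ)) = 0 := by
  funext β
  simp [base]

section BaseDerivatives

variable {n : ℕ} {f : (Fin n → ℝ) → ℝ} {y : Fin (n + 1) → ℝ}

theorem hasFDerivAt_comp_base (hf : DifferentiableAt ℝ f (base y)) :
    HasFDerivAt (fun z => f (base z)) ((fderiv ℝ f (base y)).comp (baseL n)) y :=
  HasFDerivAt.comp y (g := f) (f := base) hf.hasFDerivAt (baseL n).hasFDerivAt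

theorem pd_base_castSucc (hf : DifferentiableAt ℝ f (base y)) (α : Fin n) :
    pd α.castSucc (fun z => f (base z)) y = pd α f (base y) := by
  rw [pd, (hasFDerivAt_comp_base hf).fderiv, pd, ContinuousLinearMap.comp_apply, baseL_apply,
    base_single_castSucc]

theorem pd_base_last (hf : DifferentiableAt ℝ f (base y)) :
    pd (Fin.last n) (fun z => f (base z)) y = 0 := by
  rw [pd, (hasFDerivAt_comp_base hf).fderiv, ContinuousLinearMap.comp_apply, baseL_apply,
    base_single_last, map_zero]

theorem hasFDerivAt_phase {φ : ℝ → ℝ} {φ' : ℝ} (m : ℝ)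
    (hφ : HasDerivAt φ φ' (2 * m * y (Fin.last n))) :
    HasFDerivAt (fun z : Fin (n + 1) → ℝ => φ (2 * m * z (Fin.last n)))
      (φ' • (2 * m) • ContinuousLinearMap.proj (R := ℝ) (φ := fun _ => ℝ) (Fin.last n)) y := by
  have h := (ContinuousLinearMap.proj (R := ℝ) (φ := fun _ : Fin (n + 1) => ℝ)
    (Fin.last n)).hasFDerivAt (x := y)
  exact hφ.comp_hasFDerivAt y (h.const_mul (2 * m))

end BaseDerivatives

section ExtendedCoframe

variable (m : ℝ) (ϑ : Coframe) (x : Fin 4 → ℝ)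

theorem rotated_re (y : Fin 5 → ℝ) (α : Fin 4) : (rotated m ϑ y α).re =
    ϑ 1 (base y) α * Real.cos (2 * m * y (Fin.last 4)) +
      ϑ 2 (base y) α * Real.sin (2 * m * y (Fin.last 4)) := by
  have : -2 * Complex.I * (m : ℂ) * (y (Fin.last 4) : ℂ) =
    ((-(2 * m * y (Fin.last 4)) : ℝ) : ℂ) * Complex.I := by push_cast; ring
  rw [rotated, this, Complex.mul_re, Complex.exp_ofReal_mul_I_re, Complex.exp_ofReal_mul_I_im,
    Real.cos_neg, Real.sin_neg]
  simp

theorem rotated_im (y : Fin 5 → ℝ) (α : Fin 4) : (rotated m ϑ y α).im =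
    ϑ 2 (base y) α * Real.cos (2 * m * y (Fin.last 4)) -
      ϑ 1 (base y) α * Real.sin (2 * m * y (Fin.last 4)) := by
  have : -2 * Complex.I * (m : ℂ) * (y (Fin.last 4) : ℂ) =
    ((-(2 * m * y (Fin.last 4)) : ℝ) : ℂ) * Complex.I := by push_cast; ring
  rw [rotated, this, Complex.mul_im, Complex.exp_ofReal_mul_I_re, Complex.exp_ofReal_mul_I_im,
    Real.cos_neg, Real.sin_neg]
  simp
  ring

/-- The derivative of the extended coframe along `x^4` at `x^4 = 0`. -/
def phaseRate (i : Fin 4) : Fin 4 → ℝ :=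
  ![0, fun β => 2 * m * ϑ 2 x β, fun β => -(2 * m * ϑ 1 x β), 0] i

theorem extCoframe_castSucc_zero (i β : Fin 4) :
    extCoframe m ϑ i.castSucc (col x 0) β.castSucc = ϑ i x β := by
  fin_cases i
  · simp [extCoframe, base_col, col_castSucc]
  · simp [extCoframe, col_castSucc, rotated_re, base_col, col_last, -Fin.reduceLast]
  · simp [extCoframe, col_castSucc, rotated_im, base_col, col_last, -Fin.reduceLast]
  · simp [extCoframe, base_col, col_castSucc]

theorem extCoframe_castSucc_last (i : Fin 4) (y : Fin 5 → ℝ) :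
    extCoframe m ϑ i.castSucc y (Fin.last 4) = 0 := by
  fin_cases i <;> simp [extCoframe, col_last, -Fin.reduceLast]

theorem extCoframe_last (y : Fin 5 → ℝ) : extCoframe m ϑ (Fin.last 4) y = col 0 1 := rfl

variable {ϑ x}

theorem pd_extCoframe (hϑ : ∀ j α, DifferentiableAt ℝ (fun y => ϑ j y α) x) (i β : Fin 4) :
    (∀ α : Fin 4, pd α.castSucc (fun z => extCoframe m ϑ i.castSucc z β.castSucc) (col x 0)
      = pd α (fun z => ϑ i z β) x) ∧
    pd (Fin.last 4) (fun z => extCoframe m ϑ i.castSucc z β.castSucc) (col x 0)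
      = phaseRate m ϑ x i β := by
  have hd : ∀ j, DifferentiableAt ℝ (fun y => ϑ j y β) (base (col x 0)) := fun j => by
    rw [base_col]; exact hϑ j β
  -- At x^4 = 0 the cosine has derivative 0 and the sine has derivative 2m, so each of ϑ^1, ϑ^2
  -- acquires an x^4-derivative proportional to the other one.
  have hc := hasFDerivAt_phase (n := 4) (y := col x 0) m (Real.hasDerivAt_cos _)
  have hs := hasFDerivAt_phase (n := 4) (y := col x 0) m (Real.hasDerivAt_sin _)
  have h0 : ∀ j, (∀ α : Fin 4, pd α.castSucc (fun z => ϑ j (base z) β) (col x 0)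
      = pd α (fun z => ϑ j z β) x) ∧ pd (Fin.last 4) (fun z => ϑ j (base z) β) (col x 0) = 0 :=
    fun j => ⟨fun α => by rw [pd_base_castSucc (f := fun y => ϑ j y β) (hd j), base_col],
      pd_base_last (f := fun y => ϑ j y β) (hd j)⟩
  have h1 : ∀ α : Fin 5, pd α (fun z => ϑ 1 (base z) β * Real.cos (2 * m * z (Fin.last 4)) +
      ϑ 2 (base z) β * Real.sin (2 * m * z (Fin.last 4))) (col x 0)
      = pd α (fun z => ϑ 1 (base z) β) (col x 0) +
        ϑ 2 x β * (2 * m * (Pi.single α 1 : Fin 5 → ℝ) (Fin.last 4)) := fun α => by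
    have := ((hasFDerivAt_comp_base (hd 1)).fun_mul hc).fun_add ((hasFDerivAt_comp_base (hd 2)).fun_mul hs)
    rw [pd, HasFDerivAt.fderiv this, pd, (hasFDerivAt_comp_base (hd 1)).fderiv]
    simp [col_last, base_col, -Fin.reduceLast]
  have h2 : ∀ α : Fin 5, pd α (fun z => ϑ 2 (base z) β * Real.cos (2 * m * z (Fin.last 4)) -
      ϑ 1 (base z) β * Real.sin (2 * m * z (Fin.last 4))) (col x 0)
      = pd α (fun z => ϑ 2 (base z) β) (col x 0) -
        ϑ 1 x β * (2 * m * (Pi.single α 1 : Fin 5 → ℝ) (Fin.last 4)) := fun α => by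
    have := ((hasFDerivAt_comp_base (hd 2)).fun_mul hc).fun_sub ((hasFDerivAt_comp_base (hd 1)).fun_mul hs)
    rw [pd, HasFDerivAt.fderiv this, pd, (hasFDerivAt_comp_base (hd 2)).fderiv]
    simp [col_last, base_col, -Fin.reduceLast]
  have e0 : (fun z => extCoframe m ϑ (Fin.castSucc 0) z β.castSucc) = fun z => ϑ 0 (base z) β := by
    funext z; simp [extCoframe, col_castSucc]
  have e1 : (fun z => extCoframe m ϑ (Fin.castSucc 1) z β.castSucc) = fun z =>
      ϑ 1 (base z) β * Real.cos (2 * m * z (Fin.last 4)) +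
      ϑ 2 (base z) β * Real.sin (2 * m * z (Fin.last 4)) := by
    funext z; simp [extCoframe, col_castSucc, rotated_re, -Fin.reduceLast]
  have e2 : (fun z => extCoframe m ϑ (Fin.castSucc 2) z β.castSucc) = fun z =>
      ϑ 2 (base z) β * Real.cos (2 * m * z (Fin.last 4)) -
      ϑ 1 (base z) β * Real.sin (2 * m * z (Fin.last 4)) := by
    funext z; simp [extCoframe, col_castSucc, rotated_im, -Fin.reduceLast]
  have e3 : (fun z => extCoframe m ϑ (Fin.castSucc 3) z β.castSucc) = fun z => ϑ 3 (base z) β := by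
    funext z; simp [extCoframe, col_castSucc]
  fin_cases i
  · show (∀ α : Fin 4, pd α.castSucc (fun z => extCoframe m ϑ (Fin.castSucc 0) z β.castSucc) _ = _) ∧
      pd _ (fun z => extCoframe m ϑ (Fin.castSucc 0) z β.castSucc) _ = _
    rw [e0]; simpa [phaseRate] using h0 0
  · show (∀ α : Fin 4, pd α.castSucc (fun z => extCoframe m ϑ (Fin.castSucc 1) z β.castSucc) _ = _) ∧
      pd _ (fun z => extCoframe m ϑ (Fin.castSucc 1) z β.castSucc) _ = _
    rw [e1]; simp [phaseRate, h1, h0, -Fin.reduceLast]; ring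
  · show (∀ α : Fin 4, pd α.castSucc (fun z => extCoframe m ϑ (Fin.castSucc 2) z β.castSucc) _ = _) ∧
      pd _ (fun z => extCoframe m ϑ (Fin.castSucc 2) z β.castSucc) _ = _
    rw [e2]; simp [phaseRate, h2, h0, -Fin.reduceLast]; ring
  · show (∀ α : Fin 4, pd α.castSucc (fun z => extCoframe m ϑ (Fin.castSucc 3) z β.castSucc) _ = _) ∧
      pd _ (fun z => extCoframe m ϑ (Fin.castSucc 3) z β.castSucc) _ = _
    rw [e3]; simpa [phaseRate] using h0 3

theorem dform_extCoframe (hϑ : ∀ j α, DifferentiableAt ℝ (fun y => ϑ j y α) x) (i : Fin 4) :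
    (∀ α β : Fin 4, dform (extCoframe m ϑ i.castSucc) (col x 0) α.castSucc β.castSucc
      = dform (ϑ i) x α β) ∧
    (∀ β : Fin 4, dform (extCoframe m ϑ i.castSucc) (col x 0) (Fin.last 4) β.castSucc
      = phaseRate m ϑ x i β) ∧
    (∀ α : Fin 4, dform (extCoframe m ϑ i.castSucc) (col x 0) α.castSucc (Fin.last 4)
      = -phaseRate m ϑ x i α) ∧
    dform (extCoframe m ϑ i.castSucc) (col x 0) (Fin.last 4) (Fin.last 4) = 0 := by
  refine ⟨fun α β => ?_, fun β => ?_, fun α => ?_, ?_⟩ <;>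
  simp only [dform, pd_extCoframe m hϑ, extCoframe_castSucc_last, pd_const, sub_zero, zero_sub,
    sub_self]

theorem dform_extCoframe_last (α β : Fin 5) :
    dform (extCoframe m ϑ (Fin.last 4)) (col x 0) α β = 0 := by
  simp [dform, extCoframe_last, pd_const, -Fin.reduceLast]

end ExtendedCoframe

/-! ### The orthonormal frame of the extended metric, and the axial torsion in it -/

section ExtendedFrame

/-- The signs `+,-,-,-,-`. -/
def extSgn : Fin 5 → ℝ := ![1, -1, -1, -1, -1]

theorem extSgn_castSucc (i : Fin 4) : extSgn i.castSucc = sgn i := by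
  fin_cases i <;> rfl

theorem extSgn_last : extSgn (Fin.last 4) = -1 := rfl

theorem extSgn_mul_self (j : Fin 5) : extSgn j * extSgn j = 1 := by
  fin_cases j <;> simp [extSgn]

variable (m : ℝ) (g : MetricField) (A : CovField 4) (ϑ : Coframe) (x : Fin 4 → ℝ)

/-- The frame `(e_j, A(e_j) / m)`, `(0, 1)` of the 5-manifold. -/
def extFrame (j : Fin 5) : Fin 5 → ℝ :=
  Fin.lastCases (motive := fun _ => Fin 5 → ℝ) (col 0 1)
    (fun j => col (dualFrame g ϑ x j) (framePot g A ϑ x j / m)) j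

/-- The coframe `(ϑ^j, 0)`, `(-A / m, 1)` of the 5-manifold. -/
def extDual (j : Fin 5) : Fin 5 → ℝ :=
  Fin.lastCases (motive := fun _ => Fin 5 → ℝ) (col (fun α => -(A x α / m)) 1)
    (fun j => col (ϑ j x) 0) j

theorem extFrame_castSucc (j : Fin 4) : extFrame m g A ϑ x j.castSucc =
    col (dualFrame g ϑ x j) (framePot g A ϑ x j / m) := by simp [extFrame]

theorem extFrame_last : extFrame m g A ϑ x (Fin.last 4) = col 0 1 := by
  simp [extFrame, -Fin.reduceLast]

theorem extDual_castSucc (j : Fin 4) : extDual m A ϑ x j.castSucc = col (ϑ j x) 0 := by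
  simp [extDual]

theorem extDual_last : extDual m A ϑ x (Fin.last 4) = col (fun α => -(A x α / m)) 1 := by
  simp [extDual, -Fin.reduceLast]

variable {m g A ϑ x}

/-- Completing the square: the extended metric is g minus the square of the covector (−A/m, 1). -/
theorem extMetric_eq (h : FrameAt g ϑ x) (α β : Fin 5) : extMetric m g A x α β =
    ∑ j, extSgn j * extDual m A ϑ x j α * extDual m A ϑ x j β := by
  rw [Fin.sum_univ_castSucc]
  simp only [extSgn_castSucc, extSgn_last, extDual_castSucc, extDual_last]
  refine Fin.lastCases ?_ (fun α => ?_) α <;> refine Fin.lastCases ?_ (fun β => ?_) β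
  · simp [extMetric, col_last, -Fin.reduceLast]
  · simp [extMetric, col_last, col_castSucc, -Fin.reduceLast]
    ring
  · simp [extMetric, col_last, col_castSucc, -Fin.reduceLast]
    ring
  · simp only [extMetric, col_castSucc, Matrix.of_apply, Fin.snoc_castSucc, h.metric α β]
    ring

theorem extFrame_dual (h : FrameAt g ϑ x) (j k : Fin 5) :
    ∑ α, extDual m A ϑ x j α * extFrame m g A ϑ x k α = if j = k then 1 else 0 := by
  rw [Fin.sum_univ_castSucc]
  refine Fin.lastCases ?_ (fun j => ?_) j <;> refine Fin.lastCases ?_ (fun k => ?_) k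
  · simp [extDual_last, extFrame_last, col_last, col_castSucc, -Fin.reduceLast]
  · simp only [extDual_last, extFrame_castSucc, col_last, col_castSucc]
    rw [if_neg (Fin.castSucc_lt_last k).ne', framePot, Finset.sum_div, one_mul,
      ← Finset.sum_add_distrib]
    exact Finset.sum_eq_zero fun α _ => by ring
  · rw [if_neg (Fin.castSucc_lt_last j).ne]
    simp [extDual_castSucc, extFrame_last, col_last, col_castSucc, -Fin.reduceLast]
  · simp [extDual_castSucc, extFrame_castSucc, col_last, col_castSucc, -Fin.reduceLast, h.dual]

/-- At x^4 = 0 the phase is 1, so the first four extended covectors coincide with the first four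
members of the orthonormal coframe. The fifth ones differ, (0,1) against (−A/m,1). -/
theorem extCoframe_frame (h : FrameAt g ϑ x) (i : Fin 4) (j : Fin 5) :
    ∑ α, extCoframe m ϑ i.castSucc (col x 0) α * extFrame m g A ϑ x j α =
      if i.castSucc = j then 1 else 0 := by
  rw [← extFrame_dual (m := m) (A := A) h, extDual_castSucc]
  refine Finset.sum_congr rfl fun α _ => ?_
  congr 1
  refine Fin.lastCases ?_ (fun α => ?_) α
  · rw [extCoframe_castSucc_last, col_last]
  · rw [extCoframe_castSucc_zero, col_castSucc]

/-- `(ϑ^1 ∧ ϑ^2)` as an array, used for the phase contribution. -/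
def phaseSign (i k : Fin 4) : ℝ :=
  ![0, fun k => if k = 2 then 1 else 0, fun k => if k = 1 then -1 else 0, 0] i k

theorem phaseRate_frame (h : FrameAt g ϑ x) (i k : Fin 4) :
    ∑ β, phaseRate m ϑ x i β * dualFrame g ϑ x k β = 2 * m * phaseSign i k := by
  have h1 := h.dual 1 k
  have h2 := h.dual 2 k
  fin_cases i
  · simp [phaseRate, phaseSign]
  · simp only [phaseRate, phaseSign]
    simp only [Fin.mk_one, Matrix.cons_val_one, Matrix.cons_val_zero, mul_assoc (2 * m),
      ← Finset.mul_sum, h2, @eq_comm _ k]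
  · simp only [phaseRate, phaseSign]
    simp [mul_assoc (2 * m), ← Finset.mul_sum, h1, @eq_comm _ k]
    split_ifs <;> simp
  · simp [phaseRate, phaseSign]

/-- `dϑ^i` of the extended coframe in the extended frame. -/
def extStruct (m : ℝ) (g : MetricField) (A : CovField 4) (ϑ : Coframe) (x : Fin 4 → ℝ)
    (i : Fin 4) (k l : Fin 5) : ℝ :=
  frame2 (extFrame m g A ϑ x) (dform (extCoframe m ϑ i.castSucc) (col x 0)) k l

/-- The x^4-derivative of the phase adds 2m dx^4∧ϑ^2 to dϑ^1 and −2m dx^4∧ϑ^1 to dϑ^2, and dx^4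
takes the value A(e_k)/m on the k-th frame vector. The masses cancel, which is why the potential
enters L without a factor m. -/
theorem extStruct_castSucc (hm : m ≠ 0) (h : FrameAt g ϑ x)
    (hϑ : ∀ j α, DifferentiableAt ℝ (fun y => ϑ j y α) x) (i k l : Fin 4) :
    extStruct m g A ϑ x i k.castSucc l.castSucc = structCoeff g ϑ x i k l +
      2 * (framePot g A ϑ x k * phaseSign i l - framePot g A ϑ x l * phaseSign i k) := by
  obtain ⟨d1, d2, d3, d4⟩ := dform_extCoframe m hϑ i
  simp only [extStruct, frame2, Fin.sum_univ_castSucc (n := 4), d1, d2, d3, d4, extFrame_castSucc,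
    col_castSucc, col_last, Finset.sum_add_distrib]
  have hk := phaseRate_frame (m := m) h i k
  have hl := phaseRate_frame (m := m) h i l
  have e1 : ∑ α, -phaseRate m ϑ x i α * dualFrame g ϑ x k α * (framePot g A ϑ x l / m)
      = -(framePot g A ϑ x l / m * (2 * m * phaseSign i k)) := by
    rw [← hk, Finset.mul_sum, ← Finset.sum_neg_distrib]
    exact Finset.sum_congr rfl fun _ _ => by ring
  have e2 : ∑ α, phaseRate m ϑ x i α * (framePot g A ϑ x k / m) * dualFrame g ϑ x l α
      = framePot g A ϑ x k / m * (2 * m * phaseSign i l) := by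
    rw [← hl, Finset.mul_sum]
    exact Finset.sum_congr rfl fun _ _ => by ring
  rw [e1, e2, structCoeff, frame2]
  field_simp
  ring

theorem extStruct_last (h : FrameAt g ϑ x)
    (hϑ : ∀ j α, DifferentiableAt ℝ (fun y => ϑ j y α) x) (i k : Fin 4) :
    extStruct m g A ϑ x i k.castSucc (Fin.last 4) = -(2 * m * phaseSign i k) := by
  obtain ⟨d1, d2, d3, d4⟩ := dform_extCoframe m hϑ i
  simp only [extStruct, frame2, Fin.sum_univ_castSucc (n := 4), d1, d2, d3, d4, extFrame_castSucc,
    extFrame_last, col_castSucc, col_last]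
  rw [← phaseRate_frame (m := m) h i k, ← Finset.sum_neg_distrib]
  simp

theorem extStruct_antisymm (i : Fin 4) (k l : Fin 5) :
    extStruct m g A ϑ x i k l = -extStruct m g A ϑ x i l k :=
  frame2_antisymm (dform_antisymm _ _) k l

theorem frame3_axialTorsion (h : FrameAt g ϑ x) (j k l : Fin 5) :
    frame3 (extFrame m g A ϑ x) (axialTorsion m ϑ (col x 0)) j k l =
      (1 / 3) * ∑ i : Fin 4, sgn i *
        ((if i.castSucc = j then 1 else 0) * extStruct m g A ϑ x i k l +
         (if i.castSucc = k then 1 else 0) * extStruct m g A ϑ x i l j +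
         (if i.castSucc = l then 1 else 0) * extStruct m g A ϑ x i j k) := by
  have e : axialTorsion m ϑ (col x 0) = fun α β γ => ∑ i : Fin 5, ((1 / 3) * extSgn i) *
      wedge (extCoframe m ϑ i (col x 0)) (dform (extCoframe m ϑ i) (col x 0)) α β γ := by
    funext α β γ
    rw [axialTorsion, Finset.mul_sum]
    exact Finset.sum_congr rfl fun i _ => by rw [extSgn]; ring
  rw [e, frame3_sum, Fin.sum_univ_castSucc]
  simp only [frame3_wedge, extCoframe_frame h, extSgn_castSucc]
  -- The fifth covector dx^4 is closed, so its failure to belong to the orthonormal coframe does not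
  -- matter.
  have z : ∀ k l, frame2 (extFrame m g A ϑ x)
      (dform (extCoframe m ϑ (Fin.last 4)) (col x 0)) k l = 0 := fun k l => by
    simp only [frame2, dform_extCoframe_last, zero_mul, Finset.sum_const_zero]
  simp only [z, mul_zero, add_zero, Finset.mul_sum]
  exact Finset.sum_congr rfl fun i _ => by simp only [extStruct]; ring

end ExtendedFrame

/-- The squares of the components are totally symmetric and vanish on repeated indices, so each of
the ten index triples is counted six times. The 6 cancels the 1/3! in `dot3`. -/
theorem sum_antisymm_sq (s : Fin 5 → ℝ) {Q : Fin 5 → Fin 5 → Fin 5 → ℝ}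
    (h1 : ∀ j k l, Q j k l = -Q k j l) (h2 : ∀ j k l, Q j k l = -Q j l k) :
    ∑ l, ∑ k, ∑ j, s j * s k * s l * Q j k l ^ 2 = 6 *
      (s 0 * s 1 * s 2 * Q 0 1 2 ^ 2 + s 0 * s 1 * s 3 * Q 0 1 3 ^ 2 +
       s 0 * s 2 * s 3 * Q 0 2 3 ^ 2 + s 1 * s 2 * s 3 * Q 1 2 3 ^ 2 +
       s 0 * s 1 * s 4 * Q 0 1 4 ^ 2 + s 0 * s 2 * s 4 * Q 0 2 4 ^ 2 +
       s 1 * s 2 * s 4 * Q 1 2 4 ^ 2 + s 0 * s 3 * s 4 * Q 0 3 4 ^ 2 +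
       s 1 * s 3 * s 4 * Q 1 3 4 ^ 2 + s 2 * s 3 * s 4 * Q 2 3 4 ^ 2) := by
  -- Only the squares matter; naming them R turns antisymmetry into plain symmetry.
  obtain ⟨R, hR⟩ : ∃ R : Fin 5 → Fin 5 → Fin 5 → ℝ, ∀ j k l, Q j k l ^ 2 = R j k l :=
    ⟨_, fun _ _ _ => rfl⟩
  simp only [hR]
  have r1 : ∀ j k l, R j k l = R k j l := fun j k l => by rw [← hR, ← hR, h1, neg_sq]
  have r2 : ∀ j k l, R j k l = R j l k := fun j k l => by rw [← hR, ← hR, h2, neg_sq]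
  have z1 : ∀ j k, R j j k = 0 := fun j k => by
    rw [← hR, show Q j j k = 0 by linarith [h1 j j k], sq, zero_mul]
  have z2 : ∀ j k, R j k k = 0 := fun j k => by
    rw [← hR, show Q j k k = 0 by linarith [h2 j k k], sq, zero_mul]
  have z3 : ∀ j k, R j k j = 0 := fun j k => by rw [r2, z1]
  have c1 : ∀ j k l, R k j l = R j k l := fun j k l => r1 _ _ _
  have c2 : ∀ j k l, R j l k = R j k l := fun j k l => r2 _ _ _
  have c3 : ∀ j k l, R k l j = R j k l := fun j k l => by rw [r2, r1]
  have c4 : ∀ j k l, R l j k = R j k l := fun j k l => by rw [r1, r2]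
  have c5 : ∀ j k l, R l k j = R j k l := fun j k l => by rw [r1, r2, r1]
  simp only [Fin.sum_univ_five, z1, z2, z3, mul_zero, add_zero, zero_add]
  rw [c1 0 1 2, c2 0 1 2, c3 0 1 2, c4 0 1 2, c5 0 1 2, c1 0 1 3, c2 0 1 3, c3 0 1 3, c4 0 1 3,
    c5 0 1 3, c1 0 2 3, c2 0 2 3, c3 0 2 3, c4 0 2 3, c5 0 2 3, c1 1 2 3, c2 1 2 3, c3 1 2 3,
    c4 1 2 3, c5 1 2 3, c1 0 1 4, c2 0 1 4, c3 0 1 4, c4 0 1 4, c5 0 1 4, c1 0 2 4, c2 0 2 4,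
    c3 0 2 4, c4 0 2 4, c5 0 2 4, c1 1 2 4, c2 1 2 4, c3 1 2 4, c4 1 2 4, c5 1 2 4, c1 0 3 4,
    c2 0 3 4, c3 0 3 4, c4 0 3 4, c5 0 3 4, c1 1 3 4, c2 1 3 4, c3 1 3 4, c4 1 3 4, c5 1 3 4,
    c1 2 3 4, c2 2 3 4, c3 2 3 4, c4 2 3 4, c5 2 3 4]
  ring

/-! ### The Lagrangian in terms of structure coefficients -/

/-- The component `(0,1,2)` of `ϑ^0∧dϑ^0 - ϑ^1∧dϑ^1 - ϑ^2∧dϑ^2 - ϑ^3∧dϑ^3 + 4A∧ϑ^1∧ϑ^2`. -/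
def twist (g : MetricField) (A : CovField 4) (ϑ : Coframe) (x : Fin 4 → ℝ) : ℝ :=
  structCoeff g ϑ x 0 1 2 - structCoeff g ϑ x 1 2 0 - structCoeff g ϑ x 2 0 1
    + 4 * framePot g A ϑ x 0

/-- The components `(0,1,3)`, `(0,2,3)` and `(1,2,3)` of the same form. -/
def sideTwist (g : MetricField) (A : CovField 4) (ϑ : Coframe) (x : Fin 4 → ℝ) : Fin 3 → ℝ :=
  ![structCoeff g ϑ x 0 1 3 - structCoeff g ϑ x 1 3 0 - structCoeff g ϑ x 3 0 1,
    structCoeff g ϑ x 0 2 3 - structCoeff g ϑ x 2 3 0 - structCoeff g ϑ x 3 0 2,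
    -structCoeff g ϑ x 1 2 3 - structCoeff g ϑ x 2 3 1 - structCoeff g ϑ x 3 1 2
      + 4 * framePot g A ϑ x 3]

/-- Of the ten components of the torsion, those without the index 4 give `twist` and `sideTwist`
over 3. Of those with the index 4 only (1,2,4) survives: it equals 4m/3, and its signs give −16m²/9.
-/
theorem lagrangian_eq {m : ℝ} {g : MetricField} {A : CovField 4} {ϑ : Coframe}
    {ρ : (Fin 4 → ℝ) → ℝ} {x : Fin 4 → ℝ} (hm : m ≠ 0) (h : FrameAt g ϑ x)
    (hϑ : ∀ j α, DifferentiableAt ℝ (fun y => ϑ j y α) x) :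
    lagrangian m g A ϑ ρ x = (1 / 9) * ρ x * (twist g A ϑ x ^ 2 + sideTwist g A ϑ x 0 ^ 2 +
      sideTwist g A ϑ x 1 ^ 2 - sideTwist g A ϑ x 2 ^ 2 - 16 * m ^ 2) := by
  have hi := inv_eq_of_dual (G := extMetric m g A x) extSgn_mul_self (extMetric_eq h)
    (extFrame_dual h)
  rw [lagrangian, dot3_self hi]
  have a := fun i k l => extStruct_antisymm (m := m) (g := g) (A := A) (ϑ := ϑ) (x := x) i k l
  rw [sum_antisymm_sq]
  rotate_left
  · intro j k l
    simp only [frame3_axialTorsion h, ← mul_neg, ← Finset.sum_neg_distrib]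
    congr 1
    refine Finset.sum_congr rfl fun i _ => ?_
    rw [a i k l, a i l j, a i j k]
    ring
  · intro j k l
    simp only [frame3_axialTorsion h, ← mul_neg, ← Finset.sum_neg_distrib]
    congr 1
    refine Finset.sum_congr rfl fun i _ => ?_
    rw [a i k l, a i l j, a i j k]
    ring
  have sc := fun i k l => extStruct_castSucc (A := A) hm h hϑ i k l
  have sl := fun i k => extStruct_last (m := m) (A := A) h hϑ i k
  have sl' : ∀ i k, extStruct m g A ϑ x i (Fin.last 4) (Fin.castSucc k) = 2 * m * phaseSign i k :=
    fun i k => by rw [a, sl]; ring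
  have c0 : (0 : Fin 5) = Fin.castSucc (0 : Fin 4) := rfl
  have c1 : (1 : Fin 5) = Fin.castSucc (1 : Fin 4) := rfl
  have c2 : (2 : Fin 5) = Fin.castSucc (2 : Fin 4) := rfl
  have c3 : (3 : Fin 5) = Fin.castSucc (3 : Fin 4) := rfl
  have c4 : (4 : Fin 5) = Fin.last 4 := rfl
  have n4 : ∀ i : Fin 4, (i.castSucc = Fin.last 4) = False := fun i =>
    eq_false (Fin.castSucc_lt_last i).ne
  simp only [frame3_axialTorsion h]
  rw [c0, c1, c2, c3, c4]
  simp only [extSgn_castSucc, extSgn_last, sc, sl, sl', n4, Fin.castSucc_inj, if_false, zero_mul,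
    add_zero, Fin.sum_univ_four]
  simp [phaseSign, sgn, twist, sideTwist]
  ring

/-! ### First variation of the structure coefficients -/

/-- Derivative of a function along the `k`-th frame vector. -/
def frameDeriv (g : MetricField) (ϑ : Coframe) (k : Fin 4) (f : (Fin 4 → ℝ) → ℝ)
    (x : Fin 4 → ℝ) : ℝ :=
  ∑ α, dualFrame g ϑ x k α * pd α f x

/-- Velocity at parameter `0` of a family of coframes. -/
def coframeVelocity (Θ : ℝ → Coframe) : Coframe := fun j x α =>
  velocity (fun p : ℝ × (Fin 4 → ℝ) => Θ p.1 j p.2 α) x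

/-- The infinitesimal Lorentz transformation `B^j_k` with `ϑ'^j = B^j_k ϑ^k`. -/
def generator (g : MetricField) (ϑ : Coframe) (Θ : ℝ → Coframe) (j k : Fin 4)
    (x : Fin 4 → ℝ) : ℝ :=
  ∑ α, coframeVelocity Θ j x α * dualFrame g ϑ x k α

/-- A smooth family of coframes near `(0, x)` which starts at `ϑ`. -/
structure IsFamilyAt (g : MetricField) (ϑ : Coframe) (Θ : ℝ → Coframe) (x : Fin 4 → ℝ) :
    Prop where
  smooth : ∀ j α, ContDiffAt ℝ ∞ (fun p : ℝ × (Fin 4 → ℝ) => Θ p.1 j p.2 α) (0, x)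
  frame : ∀ᶠ p : ℝ × (Fin 4 → ℝ) in 𝓝 (0, x), FrameAt g (Θ p.1) p.2
  start : ∀ᶠ y in 𝓝 x, ∀ j, Θ 0 j y = ϑ j y
  smooth_frame : ∀ j α, DifferentiableAt ℝ (fun y => dualFrame g ϑ y j α) x

theorem FrameAt.congr {g : MetricField} {ϑ ϑ' : Coframe} {x : Fin 4 → ℝ} (h : FrameAt g ϑ x)
    (e : ∀ j, ϑ j x = ϑ' j x) : FrameAt g ϑ' x :=
  ⟨h.det_ne, fun α β => by simp only [h.metric, e]⟩

namespace IsFamilyAt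

variable {g : MetricField} {A : CovField 4} {ϑ : Coframe} {Θ : ℝ → Coframe} {x : Fin 4 → ℝ}

theorem eventually_frameAt (h : IsFamilyAt g ϑ Θ x) : ∀ᶠ y in 𝓝 x, FrameAt g ϑ y := by
  filter_upwards [eventually_slice h.frame, h.start] with y hy hs
  exact hy.congr hs

theorem frameAt (h : IsFamilyAt g ϑ Θ x) : FrameAt g ϑ x := h.eventually_frameAt.self_of_nhds

theorem start_self (h : IsFamilyAt g ϑ Θ x) (j : Fin 4) : Θ 0 j x = ϑ j x :=
  h.start.self_of_nhds j

theorem hasDerivAt_coframe (h : IsFamilyAt g ϑ Θ x) (j α : Fin 4) :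
    HasDerivAt (fun t => Θ t j x α) (coframeVelocity Θ j x α) 0 :=
  hasDerivAt_velocity ((h.smooth j α).differentiableAt (by simp))

theorem eventually_hasDerivAt (h : IsFamilyAt g ϑ Θ x) (j α : Fin 4) :
    ∀ᶠ y in 𝓝 x, HasDerivAt (fun t => Θ t j y α) (coframeVelocity Θ j y α) 0 := by
  filter_upwards [eventually_slice (eventually_differentiableAt (h.smooth j α))] with y hy
  exact hasDerivAt_velocity hy

theorem differentiableAt_velocity (h : IsFamilyAt g ϑ Θ x) (j α : Fin 4) :
    DifferentiableAt ℝ (fun y => coframeVelocity Θ j y α) x :=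
  (contDiffAt_velocity (h.smooth j α)).differentiableAt (by simp)

theorem differentiableAt_coframe (h : IsFamilyAt g ϑ Θ x) (j α : Fin 4) :
    DifferentiableAt ℝ (fun y => ϑ j y α) x := by
  have h1 : DifferentiableAt ℝ (fun y => Θ 0 j y α) x :=
    ((contDiffAt_slice (h.smooth j α) :
      ContDiffAt ℝ ∞ (fun y => Θ 0 j y α) x)).differentiableAt (by simp)
  refine h1.congr_of_eventuallyEq ?_
  filter_upwards [h.start] with y hy
  rw [hy]

theorem differentiableAt_generator (h : IsFamilyAt g ϑ Θ x) (j k : Fin 4) :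
    DifferentiableAt ℝ (generator g ϑ Θ j k) x :=
  DifferentiableAt.fun_sum fun α _ => (h.differentiableAt_velocity j α).mul (h.smooth_frame k α)

theorem velocity_eq_sum (h : FrameAt g ϑ x) (j α : Fin 4) :
    coframeVelocity Θ j x α = ∑ k, generator g ϑ Θ j k x * ϑ k x α := by
  simp only [generator, Finset.sum_mul]
  rw [Finset.sum_comm]
  simp only [mul_assoc, ← Finset.mul_sum, h.complete, mul_ite, mul_one, mul_zero,
    Finset.sum_ite_eq', Finset.mem_univ, if_true]

/-- The metric is fixed along the family, so differentiating Σ sgn_j ϑ^j⊗ϑ^j = g and evaluating on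
e_k, e_l shows that the generator lies in the Lorentz algebra. -/
theorem generator_antisymm_of
    (hd : ∀ j α, HasDerivAt (fun t => Θ t j x α) (coframeVelocity Θ j x α) 0)
    (hf : ∀ᶠ p : ℝ × (Fin 4 → ℝ) in 𝓝 (0, x), FrameAt g (Θ p.1) p.2)
    (h0 : ∀ j, Θ 0 j x = ϑ j x) (k l : Fin 4) :
    sgn k * generator g ϑ Θ k l x + sgn l * generator g ϑ Θ l k x = 0 := by
  have hev : ∀ᶠ t in 𝓝 (0 : ℝ), FrameAt g (Θ t) x :=
    (Continuous.tendsto (by fun_prop : Continuous fun s : ℝ => (s, x)) 0).eventually hf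
  have hfr : FrameAt g ϑ x := (hf.self_of_nhds : FrameAt g (Θ 0) x).congr h0
  have hαβ : ∀ α β, ∑ j, sgn j * (coframeVelocity Θ j x α * ϑ j x β +
      ϑ j x α * coframeVelocity Θ j x β) = 0 := fun α β => by
    have h1 : HasDerivAt (fun t => ∑ j, sgn j * (Θ t j x α * Θ t j x β)) (∑ j, sgn j *
        (coframeVelocity Θ j x α * Θ 0 j x β + Θ 0 j x α * coframeVelocity Θ j x β)) 0 :=
      HasDerivAt.fun_sum fun j _ =>
        ((hd j α).mul (hd j β)).const_mul (sgn j)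
    have h2 : HasDerivAt (fun t => ∑ j, sgn j * (Θ t j x α * Θ t j x β)) 0 0 := by
      refine (hasDerivAt_const (0 : ℝ) (g x α β)).congr_of_eventuallyEq ?_
      filter_upwards [hev] with t ht
      rw [ht.metric]
      exact Finset.sum_congr rfl fun j _ => by ring
    have := h1.unique h2
    simpa only [h0] using this
  have h3 : ∑ α, ∑ β, dualFrame g ϑ x k α * dualFrame g ϑ x l β * ∑ j, sgn j *
      (coframeVelocity Θ j x α * ϑ j x β + ϑ j x α * coframeVelocity Θ j x β) = 0 := by
    simp only [hαβ, mul_zero, Finset.sum_const_zero]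
  have h4 : ∑ α, ∑ β, dualFrame g ϑ x k α * dualFrame g ϑ x l β * ∑ j, sgn j *
      (coframeVelocity Θ j x α * ϑ j x β + ϑ j x α * coframeVelocity Θ j x β) =
      ∑ j, sgn j * ((∑ α, coframeVelocity Θ j x α * dualFrame g ϑ x k α) *
        (∑ β, ϑ j x β * dualFrame g ϑ x l β) +
        (∑ α, ϑ j x α * dualFrame g ϑ x k α) *
        (∑ β, coframeVelocity Θ j x β * dualFrame g ϑ x l β)) := by
    simp only [Finset.sum_mul_sum]
    simp only [Finset.mul_sum, ← Finset.sum_add_distrib]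
    rw [Finset.sum_congr rfl fun α _ => Finset.sum_comm, Finset.sum_comm]
    refine Finset.sum_congr rfl fun j _ => Finset.sum_congr rfl fun α _ =>
      Finset.sum_congr rfl fun β _ => ?_
    ring
  rw [h4] at h3
  simp only [hfr.dual] at h3
  simp only [mul_ite, ite_mul, mul_one, mul_zero, one_mul, zero_mul, mul_add,
    Finset.sum_add_distrib, Finset.sum_ite_eq', Finset.mem_univ, if_true] at h3
  rw [← h3, add_comm]
  rfl

theorem generator_antisymm (h : IsFamilyAt g ϑ Θ x) (k l : Fin 4) :
    sgn k * generator g ϑ Θ k l x + sgn l * generator g ϑ Θ l k x = 0 :=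
  generator_antisymm_of h.hasDerivAt_coframe h.frame h.start_self k l

theorem eventually_generator_antisymm (h : IsFamilyAt g ϑ Θ x) (k l : Fin 4) :
    ∀ᶠ y in 𝓝 x, sgn k * generator g ϑ Θ k l y + sgn l * generator g ϑ Θ l k y = 0 := by
  have hd : ∀ᶠ y in 𝓝 x, ∀ j α, HasDerivAt (fun t => Θ t j y α) (coframeVelocity Θ j y α) 0 :=
    eventually_all.2 fun j => eventually_all.2 fun α => h.eventually_hasDerivAt j α
  filter_upwards [hd, eventually_slice h.frame.eventually_nhds, h.start] with y h1 h2 h3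
  exact generator_antisymm_of h1 h2 h3 k l

theorem eventually_velocity_eq_sum (h : IsFamilyAt g ϑ Θ x) (j α : Fin 4) :
    (fun y => coframeVelocity Θ j y α) =ᶠ[𝓝 x] fun y => ∑ k, generator g ϑ Θ j k y * ϑ k y α := by
  filter_upwards [h.eventually_frameAt] with y hy
  exact velocity_eq_sum hy j α

/-- The dual frame is the coframe with its index raised by the fixed metric, so its velocity is the
raised velocity of ϑ^k; antisymmetry of the generator then transposes the coefficients. -/
theorem hasDerivAt_dualFrame (h : IsFamilyAt g ϑ Θ x) (k α : Fin 4) :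
    HasDerivAt (fun t => dualFrame g (Θ t) x k α)
      (-∑ n, generator g ϑ Θ n k x * dualFrame g ϑ x n α) 0 := by
  have h1 : HasDerivAt (fun t => dualFrame g (Θ t) x k α)
      (sgn k * ∑ β, (g x)⁻¹ α β * coframeVelocity Θ k x β) 0 :=
    (HasDerivAt.fun_sum fun β _ => (h.hasDerivAt_coframe k β).const_mul _).const_mul _
  refine h1.congr_deriv ?_
  simp only [velocity_eq_sum h.frameAt]
  have h2 : ∀ n, sgn k * ∑ β, (g x)⁻¹ α β * (generator g ϑ Θ k n x * ϑ n x β)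
      = -(generator g ϑ Θ n k x * dualFrame g ϑ x n α) := fun n => by
    have e : ∑ β, (g x)⁻¹ α β * (generator g ϑ Θ k n x * ϑ n x β)
      = generator g ϑ Θ k n x * ∑ β, (g x)⁻¹ α β * ϑ n x β := by
      rw [Finset.mul_sum]; exact Finset.sum_congr rfl fun _ _ => by ring
    rw [e, dualFrame]
    linear_combination (∑ β, (g x)⁻¹ α β * ϑ n x β) * h.generator_antisymm k n
  rw [← Finset.sum_neg_distrib, ← Finset.sum_congr rfl fun n _ => h2 n]
  simp only [Finset.mul_sum]
  rw [Finset.sum_comm]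

theorem hasDerivAt_dform (h : IsFamilyAt g ϑ Θ x) (i α β : Fin 4) :
    HasDerivAt (fun t => dform (Θ t i) x α β) (dform (coframeVelocity Θ i) x α β) 0 :=
  (hasDerivAt_pd_slice α (h.smooth i β)).sub (hasDerivAt_pd_slice β (h.smooth i α))

theorem dform_start (h : IsFamilyAt g ϑ Θ x) (i α β : Fin 4) :
    dform (Θ 0 i) x α β = dform (ϑ i) x α β := by
  have e : ∀ β, (fun z => Θ 0 i z β) =ᶠ[𝓝 x] fun z => ϑ i z β := fun β => by
    filter_upwards [h.start] with y hy
    rw [hy]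
  rw [dform, dform, pd_congr (e α), pd_congr (e β)]

theorem dualFrame_start (h : IsFamilyAt g ϑ Θ x) (k α : Fin 4) :
    dualFrame g (Θ 0) x k α = dualFrame g ϑ x k α := by
  simp only [dualFrame, h.start_self]

/-- This is d(B^i_n ϑ^n) = dB^i_n∧ϑ^n + B^i_n dϑ^n, evaluated on two frame vectors. -/
theorem frame2_dform_velocity (h : IsFamilyAt g ϑ Θ x) (i k l : Fin 4) :
    frame2 (dualFrame g ϑ x) (dform (coframeVelocity Θ i) x) k l =
      frameDeriv g ϑ k (generator g ϑ Θ i l) x - frameDeriv g ϑ l (generator g ϑ Θ i k) x +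
        ∑ n, generator g ϑ Θ i n x * structCoeff g ϑ x n k l := by
  have hp : ∀ α β, pd α (fun y => coframeVelocity Θ i y β) x =
      ∑ n, (pd α (generator g ϑ Θ i n) x * ϑ n x β +
        generator g ϑ Θ i n x * pd α (fun y => ϑ n y β) x) := fun α β => by
    rw [pd_congr (h.eventually_velocity_eq_sum i β), pd_sum _ fun n _ =>
      (h.differentiableAt_generator i n).fun_mul (h.differentiableAt_coframe n β)]
    exact Finset.sum_congr rfl fun n _ =>
      pd_mul (h.differentiableAt_generator i n) (h.differentiableAt_coframe n β)
  have h1 : frame2 (dualFrame g ϑ x) (dform (coframeVelocity Θ i) x) k l =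
      ∑ n, ((∑ α, dualFrame g ϑ x k α * pd α (generator g ϑ Θ i n) x) *
          (∑ β, ϑ n x β * dualFrame g ϑ x l β) -
        (∑ α, ϑ n x α * dualFrame g ϑ x k α) *
          (∑ β, dualFrame g ϑ x l β * pd β (generator g ϑ Θ i n) x) +
        generator g ϑ Θ i n x * structCoeff g ϑ x n k l) := by
    simp only [Finset.sum_mul_sum]
    simp only [frame2, structCoeff, dform, hp, Finset.mul_sum,
      ← Finset.sum_add_distrib, ← Finset.sum_sub_distrib]
    simp only [Finset.sum_mul]
    rw [Finset.sum_congr rfl fun α _ => Finset.sum_comm, Finset.sum_comm]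
    refine Finset.sum_congr rfl fun n _ => Finset.sum_congr rfl fun α _ =>
      Finset.sum_congr rfl fun β _ => ?_
    ring
  rw [h1]
  simp only [h.frameAt.dual, Finset.sum_add_distrib, Finset.sum_sub_distrib, mul_ite, ite_mul,
    mul_one, mul_zero, one_mul, zero_mul, Finset.sum_ite_eq', Finset.mem_univ, if_true]
  rfl

/-- Three sources of variation: the form dϑ^i itself, and each of the two frame vectors on which it
is evaluated. -/
theorem hasDerivAt_structCoeff (h : IsFamilyAt g ϑ Θ x) (i k l : Fin 4) :
    HasDerivAt (fun t => structCoeff g (Θ t) x i k l)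
      (frameDeriv g ϑ k (generator g ϑ Θ i l) x - frameDeriv g ϑ l (generator g ϑ Θ i k) x +
        ∑ n, (generator g ϑ Θ i n x * structCoeff g ϑ x n k l -
          generator g ϑ Θ n k x * structCoeff g ϑ x i n l -
          generator g ϑ Θ n l x * structCoeff g ϑ x i k n)) 0 := by
  have h0 : (fun t => structCoeff g (Θ t) x i k l) = fun t => ∑ α, ∑ β,
      dform (Θ t i) x α β * dualFrame g (Θ t) x k α * dualFrame g (Θ t) x l β := rfl
  have h1 : HasDerivAt (fun t => ∑ α, ∑ β,
      dform (Θ t i) x α β * dualFrame g (Θ t) x k α * dualFrame g (Θ t) x l β) _ 0 :=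
    HasDerivAt.fun_sum fun α _ => HasDerivAt.fun_sum fun β _ =>
      ((h.hasDerivAt_dform i α β).fun_mul (h.hasDerivAt_dualFrame k α)).fun_mul
        (h.hasDerivAt_dualFrame l β)
  rw [h0]
  refine h1.congr_deriv ?_
  simp only [h.dform_start, h.dualFrame_start, Finset.sum_sub_distrib]
  have h2 := h.frame2_dform_velocity i k l
  have h3 : ∑ n, generator g ϑ Θ n k x * structCoeff g ϑ x i n l = ∑ α, ∑ β,
      dform (ϑ i) x α β * (∑ n, generator g ϑ Θ n k x * dualFrame g ϑ x n α) *
        dualFrame g ϑ x l β := by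
    simp only [structCoeff, frame2, Finset.mul_sum, Finset.sum_mul]
    rw [Finset.sum_comm, Finset.sum_congr rfl fun α _ => Finset.sum_comm]
    refine Finset.sum_congr rfl fun n _ => Finset.sum_congr rfl fun α _ =>
      Finset.sum_congr rfl fun β _ => ?_
    ring
  have h4 : ∑ n, generator g ϑ Θ n l x * structCoeff g ϑ x i k n = ∑ α, ∑ β,
      dform (ϑ i) x α β * dualFrame g ϑ x k α *
        (∑ n, generator g ϑ Θ n l x * dualFrame g ϑ x n β) := by
    simp only [structCoeff, frame2, Finset.mul_sum]
    rw [Finset.sum_comm, Finset.sum_congr rfl fun α _ => Finset.sum_comm]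
    refine Finset.sum_congr rfl fun n _ => Finset.sum_congr rfl fun α _ =>
      Finset.sum_congr rfl fun β _ => ?_
    ring
  rw [h3, h4, add_sub_assoc', add_sub_assoc', ← h2, frame2]
  simp only [← Finset.sum_sub_distrib]
  refine Finset.sum_congr rfl fun α _ => Finset.sum_congr rfl fun β _ => ?_
  ring

theorem hasDerivAt_framePot (h : IsFamilyAt g ϑ Θ x) (k : Fin 4) :
    HasDerivAt (fun t => framePot g A (Θ t) x k)
      (-∑ n, generator g ϑ Θ n k x * framePot g A ϑ x n) 0 := by
  have h1 : HasDerivAt (fun t => framePot g A (Θ t) x k) _ 0 :=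
    HasDerivAt.fun_sum fun α _ => (h.hasDerivAt_dualFrame k α).const_mul (A x α)
  refine h1.congr_deriv ?_
  simp only [framePot, Finset.mul_sum, ← Finset.sum_neg_distrib]
  rw [Finset.sum_comm]
  refine Finset.sum_congr rfl fun n _ => Finset.sum_congr rfl fun α _ => ?_
  ring

/-- First variation of the `(0,1,2)` component. -/
theorem hasDerivAt_twist (h : IsFamilyAt g ϑ Θ x) (hside : ∀ i, sideTwist g A ϑ x i = 0) :
    HasDerivAt (fun t => twist g A (Θ t) x)
      (2 * (frameDeriv g ϑ 0 (generator g ϑ Θ 1 2) x + frameDeriv g ϑ 1 (generator g ϑ Θ 0 2) x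
        - frameDeriv g ϑ 2 (generator g ϑ Θ 0 1) x)
        - 4 * (generator g ϑ Θ 0 1 x * framePot g A ϑ x 1 +
          generator g ϑ Θ 0 2 x * framePot g A ϑ x 2)) 0 := by
  have h1 : HasDerivAt (fun t => twist g A (Θ t) x) _ 0 :=
    (((h.hasDerivAt_structCoeff 0 1 2).fun_sub (h.hasDerivAt_structCoeff 1 2 0)).fun_sub
      (h.hasDerivAt_structCoeff 2 0 1)).fun_add ((h.hasDerivAt_framePot (A := A) 0).const_mul 4)
  refine h1.congr_deriv ?_
  have s0 := hside 0
  have s1 := hside 1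
  have s2 := hside 2
  have an := h.generator_antisymm
  have b00 := an 0 0
  have b11 := an 1 1
  have b22 := an 2 2
  have b01 := an 0 1
  have b02 := an 0 2
  have b03 := an 0 3
  have b12 := an 1 2
  have b13 := an 1 3
  have b23 := an 2 3
  -- Since generators are differentiated here, their antisymmetry is needed near x and not only at
  -- x.
  have d01 : frameDeriv g ϑ 2 (generator g ϑ Θ 1 0) x
      = frameDeriv g ϑ 2 (generator g ϑ Θ 0 1) x := by
    have e : generator g ϑ Θ 1 0 =ᶠ[𝓝 x] generator g ϑ Θ 0 1 := by
      filter_upwards [h.eventually_generator_antisymm 0 1] with y hy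
      simp [sgn] at hy
      linarith
    simp only [frameDeriv, pd_congr e]
  have d02 : frameDeriv g ϑ 1 (generator g ϑ Θ 2 0) x
      = frameDeriv g ϑ 1 (generator g ϑ Θ 0 2) x := by
    have e : generator g ϑ Θ 2 0 =ᶠ[𝓝 x] generator g ϑ Θ 0 2 := by
      filter_upwards [h.eventually_generator_antisymm 0 2] with y hy
      simp [sgn] at hy
      linarith
    simp only [frameDeriv, pd_congr e]
  have d12 : frameDeriv g ϑ 0 (generator g ϑ Θ 2 1) x
      = -frameDeriv g ϑ 0 (generator g ϑ Θ 1 2) x := by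
    have e : generator g ϑ Θ 2 1 =ᶠ[𝓝 x] fun y => (-1) * generator g ϑ Θ 1 2 y := by
      filter_upwards [h.eventually_generator_antisymm 1 2] with y hy
      simp [sgn] at hy
      linarith
    simp only [frameDeriv, pd_congr e, pd_const_mul (-1) (h.differentiableAt_generator 1 2),
      ← Finset.sum_neg_distrib]
    exact Finset.sum_congr rfl fun _ _ => by ring
  have c : ∀ i k l, structCoeff g ϑ x i k l = -structCoeff g ϑ x i l k :=
    structCoeff_antisymm g ϑ x
  have cz : ∀ i k, structCoeff g ϑ x i k k = 0 := fun i k => by linarith [c i k k]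
  simp only [sgn, Matrix.cons_val, one_mul] at b00 b11 b22 b01 b02 b03 b12 b13 b23
  simp only [sideTwist, Matrix.cons_val] at s0 s1 s2
  have e00 : generator g ϑ Θ 0 0 x = 0 := by linarith
  have e11 : generator g ϑ Θ 1 1 x = 0 := by linarith
  have e22 : generator g ϑ Θ 2 2 x = 0 := by linarith
  have e10 : generator g ϑ Θ 1 0 x = generator g ϑ Θ 0 1 x := by linarith
  have e20 : generator g ϑ Θ 2 0 x = generator g ϑ Θ 0 2 x := by linarith
  have e30 : generator g ϑ Θ 3 0 x = generator g ϑ Θ 0 3 x := by linarith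
  have e21 : generator g ϑ Θ 2 1 x = -generator g ϑ Θ 1 2 x := by linarith
  have e31 : generator g ϑ Θ 3 1 x = -generator g ϑ Θ 1 3 x := by linarith
  have e32 : generator g ϑ Θ 3 2 x = -generator g ϑ Θ 2 3 x := by linarith
  simp only [Fin.sum_univ_four, e00, e11, e22, e10, e20, e30, e21, e31, e32, d01, d02, d12, cz]
  simp only [c _ 1 0, c _ 2 0, c _ 3 0, c _ 2 1, c _ 3 1, c _ 3 2] at s0 s1 s2 ⊢
  -- The generators B^0_1, B^0_2, B^1_2 leave no undifferentiated structure terms, because Σ sgn_i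
  -- ϑ^i∧dϑ^i is invariant under constant Lorentz transformations. The generators that move ϑ^3
  -- appear only multiplied by the side twists, which vanish.
  linear_combination (-generator g ϑ Θ 0 3 x) * s2 - generator g ϑ Θ 1 3 x * s1
    + generator g ϑ Θ 2 3 x * s0

end IsFamilyAt

/-! ### Smoothness of the geometric quantities -/

theorem IsLorentzMetric.det_ne {M : Set (Fin 4 → ℝ)} {g : MetricField} (hg : IsLorentzMetric M g)
    {x : Fin 4 → ℝ} (hx : x ∈ M) : (g x).det ≠ 0 := by
  obtain ⟨P, hP, e⟩ := hg.signature x hx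
  rw [e, Matrix.det_mul, Matrix.det_mul, Matrix.det_transpose, Matrix.det_diagonal]
  have : ∏ i, sgn i = -1 := by simp [Fin.prod_univ_four, sgn]
  rw [this]
  have := hP.ne_zero
  simp [this]

theorem IsCoframe.frameAt {M : Set (Fin 4 → ℝ)} {g : MetricField} {ϑ : Coframe}
    (h : IsCoframe M g ϑ) (hg : IsLorentzMetric M g) {x : Fin 4 → ℝ} (hx : x ∈ M) :
    FrameAt g ϑ x := ⟨hg.det_ne hx, h x hx⟩

section Smoothness

variable {M : Set (Fin 4 → ℝ)} {S : Set (ℝ × (Fin 4 → ℝ))} {g : MetricField} {A : CovField 4}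
  {Θ : ℝ → Coframe}

theorem contDiffOn_metric_inv (hg : IsLorentzMetric M g) (α β : Fin 4) :
    ContDiffOn ℝ ∞ (fun x => (g x)⁻¹ α β) M :=
  contDiffOn_inv hg.smooth (fun _ hx => hg.det_ne hx) α β

theorem contDiffOn_dualFrame_family (hSM : ∀ p ∈ S, p.2 ∈ M) (hg : IsLorentzMetric M g)
    (hΘ : ∀ j α, ContDiffOn ℝ ∞ (fun p : ℝ × (Fin 4 → ℝ) => Θ p.1 j p.2 α) S) (k α : Fin 4) :
    ContDiffOn ℝ ∞ (fun p : ℝ × (Fin 4 → ℝ) => dualFrame g (Θ p.1) p.2 k α) S :=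
  contDiffOn_const.mul (ContDiffOn.sum fun β _ =>
    ((contDiffOn_metric_inv hg α β).comp contDiffOn_snd hSM).mul (hΘ k β))

theorem contDiffOn_structCoeff_family (hS : IsOpen S) (hSM : ∀ p ∈ S, p.2 ∈ M)
    (hg : IsLorentzMetric M g)
    (hΘ : ∀ j α, ContDiffOn ℝ ∞ (fun p : ℝ × (Fin 4 → ℝ) => Θ p.1 j p.2 α) S) (i k l : Fin 4) :
    ContDiffOn ℝ ∞ (fun p : ℝ × (Fin 4 → ℝ) => structCoeff g (Θ p.1) p.2 i k l) S := by
  have hd := contDiffOn_dualFrame_family hSM hg hΘ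
  have h0 : (fun p : ℝ × (Fin 4 → ℝ) => structCoeff g (Θ p.1) p.2 i k l) = fun p => ∑ α, ∑ β,
      dform (Θ p.1 i) p.2 α β * dualFrame g (Θ p.1) p.2 k α * dualFrame g (Θ p.1) p.2 l β := rfl
  rw [h0]
  exact ContDiffOn.sum fun α _ => ContDiffOn.sum fun β _ =>
    (((contDiffOn_pd_slice α hS (hΘ i β)).sub (contDiffOn_pd_slice β hS (hΘ i α))).mul
      (hd k α)).mul (hd l β)

theorem contDiffOn_framePot_family (hSM : ∀ p ∈ S, p.2 ∈ M) (hg : IsLorentzMetric M g)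
    (hA : ∀ α, ContDiffOn ℝ ∞ (fun x => A x α) M)
    (hΘ : ∀ j α, ContDiffOn ℝ ∞ (fun p : ℝ × (Fin 4 → ℝ) => Θ p.1 j p.2 α) S) (k : Fin 4) :
    ContDiffOn ℝ ∞ (fun p : ℝ × (Fin 4 → ℝ) => framePot g A (Θ p.1) p.2 k) S :=
  ContDiffOn.sum fun α _ => ((hA α).comp contDiffOn_snd hSM).mul
    (contDiffOn_dualFrame_family hSM hg hΘ k α)

theorem contDiffOn_twist_family (hS : IsOpen S) (hSM : ∀ p ∈ S, p.2 ∈ M)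
    (hg : IsLorentzMetric M g) (hA : ∀ α, ContDiffOn ℝ ∞ (fun x => A x α) M)
    (hΘ : ∀ j α, ContDiffOn ℝ ∞ (fun p : ℝ × (Fin 4 → ℝ) => Θ p.1 j p.2 α) S) :
    ContDiffOn ℝ ∞ (fun p : ℝ × (Fin 4 → ℝ) => twist g A (Θ p.1) p.2) S := by
  have hc := contDiffOn_structCoeff_family hS hSM hg hΘ
  exact (((hc 0 1 2).sub (hc 1 2 0)).sub (hc 2 0 1)).add
    (contDiffOn_const.mul (contDiffOn_framePot_family hSM hg hA hΘ 0))

theorem contDiffOn_sideTwist_family (hS : IsOpen S) (hSM : ∀ p ∈ S, p.2 ∈ M)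
    (hg : IsLorentzMetric M g) (hA : ∀ α, ContDiffOn ℝ ∞ (fun x => A x α) M)
    (hΘ : ∀ j α, ContDiffOn ℝ ∞ (fun p : ℝ × (Fin 4 → ℝ) => Θ p.1 j p.2 α) S) (i : Fin 3) :
    ContDiffOn ℝ ∞ (fun p : ℝ × (Fin 4 → ℝ) => sideTwist g A (Θ p.1) p.2 i) S := by
  have hc := contDiffOn_structCoeff_family hS hSM hg hΘ
  fin_cases i
  · exact ((hc 0 1 3).sub (hc 1 3 0)).sub (hc 3 0 1)
  · exact ((hc 0 2 3).sub (hc 2 3 0)).sub (hc 3 0 2)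
  · exact (((hc 1 2 3).neg.sub (hc 2 3 1)).sub (hc 3 1 2)).add
      (contDiffOn_const.mul (contDiffOn_framePot_family hSM hg hA hΘ 3))

/-- Smoothness of a quantity attached to a constant family. -/
theorem contDiffOn_of_family {f : (Fin 4 → ℝ) → ℝ}
    (h : ContDiffOn ℝ ∞ (fun p : ℝ × (Fin 4 → ℝ) => f p.2) (Set.univ ×ˢ M)) :
    ContDiffOn ℝ ∞ f M :=
  h.comp (f := fun x : Fin 4 → ℝ => ((0 : ℝ), x)) (contDiffOn_const.prodMk contDiffOn_id)
    fun _ hx => ⟨trivial, hx⟩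

theorem contDiffOn_comp_snd {f : (Fin 4 → ℝ) → ℝ} (h : ContDiffOn ℝ ∞ f M) :
    ContDiffOn ℝ ∞ (fun p : ℝ × (Fin 4 → ℝ) => f p.2) (Set.univ ×ˢ M) :=
  h.comp contDiffOn_snd fun _ hp => hp.2

variable {ϑ : Coframe}

theorem contDiffOn_dualFrame (hg : IsLorentzMetric M g)
    (hϑ : ∀ j α, ContDiffOn ℝ ∞ (fun x => ϑ j x α) M) (k α : Fin 4) :
    ContDiffOn ℝ ∞ (fun x => dualFrame g ϑ x k α) M :=
  contDiffOn_of_family (contDiffOn_dualFrame_family (Θ := fun _ => ϑ) (fun _ hp => hp.2) hg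
    (fun j α => contDiffOn_comp_snd (hϑ j α)) k α)

theorem contDiffOn_framePot (hg : IsLorentzMetric M g)
    (hA : ∀ α, ContDiffOn ℝ ∞ (fun x => A x α) M)
    (hϑ : ∀ j α, ContDiffOn ℝ ∞ (fun x => ϑ j x α) M) (k : Fin 4) :
    ContDiffOn ℝ ∞ (fun x => framePot g A ϑ x k) M :=
  contDiffOn_of_family (contDiffOn_framePot_family (Θ := fun _ => ϑ) (fun _ hp => hp.2) hg hA
    (fun j α => contDiffOn_comp_snd (hϑ j α)) k)

theorem contDiffOn_twist (hM : IsOpen M) (hg : IsLorentzMetric M g)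
    (hA : ∀ α, ContDiffOn ℝ ∞ (fun x => A x α) M)
    (hϑ : ∀ j α, ContDiffOn ℝ ∞ (fun x => ϑ j x α) M) :
    ContDiffOn ℝ ∞ (fun x => twist g A ϑ x) M :=
  contDiffOn_of_family (contDiffOn_twist_family (Θ := fun _ => ϑ) (isOpen_univ.prod hM)
    (fun _ hp => hp.2) hg hA (fun j α => contDiffOn_comp_snd (hϑ j α)))

/-- The set S may be smaller than ℝ × M: a family of spinors yields a coframe only where its norm is
positive. -/
theorem isFamilyAt_of_local (hM : IsOpen M) (hg : IsLorentzMetric M g)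
    (hϑ : ∀ j α, ContDiffOn ℝ ∞ (fun x => ϑ j x α) M) (hS : IsOpen S)
    (hΘ : ∀ j α, ContDiffOn ℝ ∞ (fun p : ℝ × (Fin 4 → ℝ) => Θ p.1 j p.2 α) S)
    (hf : ∀ p ∈ S, FrameAt g (Θ p.1) p.2) (h0 : ∀ x ∈ M, ∀ j, Θ 0 j x = ϑ j x)
    {x : Fin 4 → ℝ} (hx : x ∈ M) (hxS : ((0 : ℝ), x) ∈ S) : IsFamilyAt g ϑ Θ x where
  smooth j α := (hΘ j α).contDiffAt (hS.mem_nhds hxS)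
  frame := by filter_upwards [hS.mem_nhds hxS] with p hp using hf p hp
  start := by filter_upwards [hM.mem_nhds hx] with y hy using h0 y hy
  smooth_frame j α :=
    ((contDiffOn_dualFrame hg hϑ j α).contDiffAt (hM.mem_nhds hx)).differentiableAt (by simp)

theorem contDiffOn_generator (hg : IsLorentzMetric M g)
    (hϑ : ∀ j α, ContDiffOn ℝ ∞ (fun x => ϑ j x α) M)
    (hΘ : ∀ x ∈ M, ∀ j α, ContDiffAt ℝ ∞ (fun p : ℝ × (Fin 4 → ℝ) => Θ p.1 j p.2 α) (0, x))
    (j k : Fin 4) : ContDiffOn ℝ ∞ (generator g ϑ Θ j k) M :=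
  ContDiffOn.sum fun α _ => ContDiffOn.mul
    (fun x hx => (contDiffAt_velocity (hΘ x hx j α)).contDiffWithinAt)
    (contDiffOn_dualFrame hg hϑ k α)

end Smoothness

/-! ### Quantities which do not depend on `x^3` -/

section Cylinder

variable {U : Set (Fin 3 → ℝ)}

theorem isOpen_cyl (hU : IsOpen U) : IsOpen (cyl U) :=
  hU.preimage contDiff_base.continuous

theorem col_mem_cyl {u : Fin 3 → ℝ} (hu : u ∈ U) (a : ℝ) : col u a ∈ cyl U := by
  rw [cyl, Set.mem_ofPred_eq, base_col]; exact hu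

theorem contDiff_col {n : ℕ} (a : ℝ) : ContDiff ℝ ∞ (fun u : Fin n → ℝ => col u a) := by
  refine contDiff_pi.2 fun α => ?_
  refine Fin.lastCases ?_ (fun α => ?_) α
  · simp only [col_last]; exact contDiff_const
  · simp only [col_castSucc]; exact contDiff_apply ℝ ℝ α

theorem hasFDerivAt_col {n : ℕ} (a : ℝ) (u : Fin n → ℝ) :
    HasFDerivAt (fun u : Fin n → ℝ => col u a)
      (ContinuousLinearMap.pi (Fin.lastCases (motive := fun _ => (Fin n → ℝ) →L[ℝ] ℝ) 0
        fun α => ContinuousLinearMap.proj α)) u := by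
  rw [hasFDerivAt_pi']
  intro α
  refine Fin.lastCases ?_ (fun α => ?_) α
  · simp only [col_last]
    refine (hasFDerivAt_const a u).congr_fderiv ?_
    ext v; simp
  · simp only [col_castSucc]
    refine (hasFDerivAt_apply α u).congr_fderiv ?_
    ext v; simp

theorem pd_comp_col {n : ℕ} {f : (Fin (n + 1) → ℝ) → ℝ} {a : ℝ} {u : Fin n → ℝ}
    (hf : DifferentiableAt ℝ f (col u a)) (α : Fin n) :
    pd α (fun v => f (col v a)) u = pd α.castSucc f (col u a) := by
  have h : HasFDerivAt (fun v => f (col v a)) _ u :=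
    HasFDerivAt.comp u (g := f) (f := fun v => col v a) hf.hasFDerivAt (hasFDerivAt_col a u)
  rw [pd, h.fderiv, pd, ContinuousLinearMap.comp_apply]
  congr 1
  funext β
  refine Fin.lastCases ?_ (fun β => ?_) β
  · simp [Fin.castSucc_ne_last]
  · simp [Pi.single_apply]

theorem contDiffOn_comp_col {f : (Fin 4 → ℝ) → ℝ} (hf : ContDiffOn ℝ ∞ f (cyl U)) (a : ℝ) :
    ContDiffOn ℝ ∞ (fun u => f (col u a)) U :=
  hf.comp (contDiff_col a).contDiffOn fun _ hu => col_mem_cyl hu a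

theorem IndepX3.eq_col {β : Type*} {f : (Fin 4 → ℝ) → β} (hf : IndepX3 (cyl U) f)
    {x : Fin 4 → ℝ} (hx : x ∈ cyl U) (a : ℝ) : f x = f (col (base x) a) :=
  hf x hx _ (col_mem_cyl hx a) (by rw [base_col])

theorem IndepX3.pd_eq (hU : IsOpen U) {f : (Fin 4 → ℝ) → ℝ} (hf : IndepX3 (cyl U) f)
    (hs : ContDiffOn ℝ ∞ f (cyl U)) {x : Fin 4 → ℝ} (hx : x ∈ cyl U) :
    pd 3 f x = 0 ∧ ∀ α : Fin 3, pd α.castSucc f x = pd α (fun u => f (col u 0)) (base x) := by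
  have e : f =ᶠ[𝓝 x] fun y => f (col (base y) 0) := by
    filter_upwards [(isOpen_cyl hU).mem_nhds hx] with y hy using hf.eq_col hy 0
  have hd : DifferentiableAt ℝ (fun u => f (col u 0)) (base x) :=
    ((contDiffOn_comp_col hs 0).contDiffAt (hU.mem_nhds hx)).differentiableAt (by simp)
  refine ⟨?_, fun α => ?_⟩
  · rw [pd_congr e]
    exact pd_base_last (n := 3) (f := fun u => f (col u 0)) hd
  · rw [pd_congr e]
    exact pd_base_castSucc (f := fun u => f (col u 0)) hd α

/-- The term ∂_3 V^3 vanishes and the other derivatives can be taken on the slice x^3 = 0, so the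
four-dimensional divergence equation is equivalent to a three-dimensional one. -/
theorem divergence_iff (hU : IsOpen U) {V : Fin 4 → (Fin 4 → ℝ) → ℝ} {c : (Fin 4 → ℝ) → ℝ}
    (hV : ∀ α, ContDiffOn ℝ ∞ (V α) (cyl U)) (hVi : ∀ α, IndepX3 (cyl U) (V α))
    (hc : IndepX3 (cyl U) c) :
    (∀ x ∈ cyl U, ∑ α, pd α (V α) x = c x) ↔
      ∀ u ∈ U, ∑ α : Fin 3, pd α (fun v => V α.castSucc (col v 0)) u = c (col u 0) := by
  have key : ∀ x ∈ cyl U, ∑ α, pd α (V α) x =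
      ∑ α : Fin 3, pd α (fun v => V α.castSucc (col v 0)) (base x) := fun x hx => by
    rw [Fin.sum_univ_castSucc]
    have h3 : pd (Fin.last 3) (V (Fin.last 3)) x = 0 := ((hVi 3).pd_eq hU (hV 3) hx).1
    rw [h3, add_zero]
    exact Finset.sum_congr rfl fun α _ => ((hVi α.castSucc).pd_eq hU (hV α.castSucc) hx).2 α
  constructor
  · intro h u hu
    have hx := col_mem_cyl hu 0
    rw [← h _ hx, key _ hx, base_col]
  · intro h x hx
    rw [key x hx, h _ hx, ← hc.eq_col hx]

end Cylinder

/-! ### Special states -/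

namespace IsSpecialBackground

variable {U : Set (Fin 3 → ℝ)} {g : MetricField} {A : CovField 4} {σ : PauliField}
  {ϑ : Coframe} {ρ : (Fin 4 → ℝ) → ℝ} {x : Fin 4 → ℝ}

theorem metric_three (h : IsSpecialBackground U g A σ) (hx : x ∈ cyl U) (α : Fin 4) :
    g x α 3 = -(Pi.single 3 1 : Fin 4 → ℝ) α := by
  refine Fin.lastCases ?_ (fun α => ?_) α
  · exact (h.metric_last x hx).trans (by simp [← Fin.reduceLast])
  · have : α.castSucc ≠ (3 : Fin 4) := (Fin.castSucc_lt_last α).ne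
    rw [(h.metric_off x hx α).1, Pi.single_eq_of_ne this, neg_zero]

/-- The block form of g gives g∂_3 = −dx^3; inverting it, the raised dx^3 is −∂_3, and the sign of
the index 3 makes e_3 = ∂_3. -/
theorem dualFrame_three (h : IsSpecialBackground U g A σ) (hx : x ∈ cyl U)
    (h3 : ϑ 3 x = Pi.single 3 1) (α : Fin 4) :
    dualFrame g ϑ x 3 α = (Pi.single 3 1 : Fin 4 → ℝ) α := by
  have h1 : g x *ᵥ Pi.single 3 1 = -(Pi.single 3 1 : Fin 4 → ℝ) := by
    funext α
    rw [Matrix.mulVec_single_one, Pi.neg_apply, ← h.metric_three hx]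
    rfl
  have h2 : (g x)⁻¹ *ᵥ (Pi.single 3 1 : Fin 4 → ℝ) = -Pi.single 3 1 := by
    have := congrArg ((g x)⁻¹ *ᵥ ·) h1
    simp only [Matrix.mulVec_mulVec, Matrix.mulVec_neg] at this
    rw [Matrix.nonsing_inv_mul _ (isUnit_iff_ne_zero.2 (h.metric.det_ne hx)),
      Matrix.one_mulVec] at this
    rw [eq_neg_iff_add_eq_zero, add_comm, ← eq_neg_iff_add_eq_zero]
    exact this
  have h4 := congrFun h2 α
  rw [Matrix.mulVec, dotProduct] at h4
  rw [dualFrame, h3, h4]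
  simp [sgn]

theorem dualFrame_last (hf : FrameAt g ϑ x) (h3 : ϑ 3 x = Pi.single 3 1) (k : Fin 4) :
    dualFrame g ϑ x k 3 = if 3 = k then 1 else 0 := by
  rw [← hf.dual 3 k, h3]
  simp [Pi.single_apply]

theorem coframe_three (h : IsSpecialBackground U g A σ) (hx : x ∈ cyl U) (hf : FrameAt g ϑ x)
    (h3 : ϑ 3 x = Pi.single 3 1) (j : Fin 4) : ϑ j x 3 = if j = 3 then 1 else 0 := by
  rw [← hf.dual j 3]
  simp only [h.dualFrame_three hx h3]
  simp [Pi.single_apply]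

theorem frameAt (h : IsSpecialBackground U g A σ) (hs : IsSpecialState U g ϑ ρ)
    (hx : x ∈ cyl U) : FrameAt g ϑ x := hs.coframe.frameAt h.metric hx

theorem dualFrame_indep (h : IsSpecialBackground U g A σ) (hs : IsSpecialState U g ϑ ρ)
    (k α : Fin 4) : IndepX3 (cyl U) fun x => dualFrame g ϑ x k α := fun x hx y hy e => by
  simp only [dualFrame, h.metric_indep x hx y hy e, hs.indep_coframe k x hx y hy e]

theorem framePot_indep (h : IsSpecialBackground U g A σ) (hs : IsSpecialState U g ϑ ρ)
    (k : Fin 4) : IndepX3 (cyl U) fun x => framePot g A ϑ x k := fun x hx y hy e => by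
  simp only [framePot, h.potential_indep x hx y hy e, h.dualFrame_indep hs k _ x hx y hy e]

/-- Here e_3 = ∂_3, the components ϑ^i_3 are constant and nothing depends on x^3, so dϑ^i(·, e_3) =
0. Also dϑ^3 = 0 and A(e_3) = A_3 = 0, and every term of a side twist is of one of these kinds. -/
theorem sideTwist_eq_zero (hU : IsOpen U) (h : IsSpecialBackground U g A σ)
    (hs : IsSpecialState U g ϑ ρ) (hx : x ∈ cyl U) (i : Fin 3) : sideTwist g A ϑ x i = 0 := by
  have hM := isOpen_cyl hU
  have hpd3 : ∀ i α β, pd α (fun z => ϑ i z 3) x = 0 ∧ pd 3 (fun z => ϑ i z β) x = 0 :=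
    fun i α β => by
      constructor
      · have e : (fun z => ϑ i z 3) =ᶠ[𝓝 x] fun _ => if i = 3 then 1 else 0 := by
          filter_upwards [hM.mem_nhds hx] with y hy
          exact h.coframe_three hy (h.frameAt hs hy) (hs.third y hy) i
        rw [pd_congr e, pd_const]
      · exact (IndepX3.pd_eq hU (f := fun z => ϑ i z β)
          (fun y hy z hz e => by simp only [hs.indep_coframe i y hy z hz e])
          (hs.smooth_coframe i β) hx).1
  have hC : ∀ i k, structCoeff g ϑ x i k 3 = 0 := fun i k => by
    rw [structCoeff, frame2]
    refine Finset.sum_eq_zero fun α _ => Finset.sum_eq_zero fun β _ => ?_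
    rw [h.dualFrame_three hx (hs.third x hx)]
    by_cases hβ : β = 3
    · subst hβ
      rw [dform, (hpd3 i α α).1, (hpd3 i α α).2]; simp
    · rw [Pi.single_eq_of_ne hβ, mul_zero]
  have hC3 : ∀ k l, structCoeff g ϑ x 3 k l = 0 := fun k l => by
    have e : ∀ β, (fun z => ϑ 3 z β) =ᶠ[𝓝 x] fun _ => (Pi.single 3 1 : Fin 4 → ℝ) β := fun β => by
      filter_upwards [hM.mem_nhds hx] with y hy
      rw [hs.third y hy]
    rw [structCoeff, frame2]
    refine Finset.sum_eq_zero fun α _ => Finset.sum_eq_zero fun β _ => ?_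
    rw [dform, pd_congr (e α), pd_congr (e β), pd_const, pd_const]; simp
  have hC' : ∀ i k, structCoeff g ϑ x i 3 k = 0 := fun i k => by
    rw [structCoeff_antisymm, hC, neg_zero]
  have hA : framePot g A ϑ x 3 = 0 := by
    simp only [framePot, h.dualFrame_three hx (hs.third x hx)]
    simp [Pi.single_apply, h.potential_third x hx]
  fin_cases i <;> simp [sideTwist, hC, hC3, hC', hA]

end IsSpecialBackground

/-! ### The Euler–Lagrange equations in divergence form -/

/-- The conserved-type currents `2ρe_0`, `2ρe_1`, `-2ρe_2`. -/
def current (g : MetricField) (ϑ : Coframe) (ρ : (Fin 4 → ℝ) → ℝ) (k : Fin 3) (α : Fin 4)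
    (x : Fin 4 → ℝ) : ℝ :=
  ![2, 2, -2] k * (ρ x * dualFrame g ϑ x k.castSucc α)

/-- The sources of the currents. -/
def source (g : MetricField) (A : CovField 4) (ϑ : Coframe) (ρ : (Fin 4 → ℝ) → ℝ) (k : Fin 3)
    (x : Fin 4 → ℝ) : ℝ :=
  ![0, -4, -4] k * (ρ x * framePot g A ϑ x (![0, 2, 1] k))

/-- The equations `ϑ^0∧dϑ^0 - … = 4κm` and `div` of currents `=` sources. -/
structure EulerLagrange (U : Set (Fin 3 → ℝ)) (m : ℝ) (g : MetricField) (A : CovField 4)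
    (ϑ : Coframe) (ρ : (Fin 4 → ℝ) → ℝ) (κ : ℝ) : Prop where
  twist_eq : ∀ x ∈ cyl U, twist g A ϑ x = 4 * κ * m
  divergence : ∀ k, ∀ x ∈ cyl U, ∑ α, pd α (current g ϑ ρ k α) x = source g A ϑ ρ k x

/-- The first variation density in the direction of three infinitesimal rotations. -/
def rotDensity (g : MetricField) (A : CovField 4) (ϑ : Coframe) (ρ : (Fin 4 → ℝ) → ℝ)
    (b : Fin 3 → (Fin 4 → ℝ) → ℝ) (x : Fin 4 → ℝ) : ℝ :=
  ∑ k, (∑ α, current g ϑ ρ k α x * pd α (b k) x + source g A ϑ ρ k x * b k x)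

/-- The three generators of rotations preserving `ϑ^3`. -/
def rotParam (g : MetricField) (ϑ : Coframe) (Θ : ℝ → Coframe) (k : Fin 3) :
    (Fin 4 → ℝ) → ℝ :=
  ![generator g ϑ Θ 1 2, generator g ϑ Θ 0 2, generator g ϑ Θ 0 1] k

theorem rotDensity_congr {g : MetricField} {A : CovField 4} {ϑ : Coframe}
    {ρ : (Fin 4 → ℝ) → ℝ} {b b' : Fin 3 → (Fin 4 → ℝ) → ℝ} {x : Fin 4 → ℝ}
    (h : ∀ k, b k =ᶠ[𝓝 x] b' k) : rotDensity g A ϑ ρ b x = rotDensity g A ϑ ρ b' x := by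
  simp only [rotDensity, pd_congr (h _), (h _).self_of_nhds]

/-- The velocity of the twist times the density is the first variation density. -/
theorem IsFamilyAt.hasDerivAt_twist_rotDensity {g : MetricField} {A : CovField 4} {ϑ : Coframe}
    {Θ : ℝ → Coframe} {x : Fin 4 → ℝ} (h : IsFamilyAt g ϑ Θ x)
    (hside : ∀ i, sideTwist g A ϑ x i = 0) {ρ : (Fin 4 → ℝ) → ℝ} (hρ : ρ x ≠ 0) :
    HasDerivAt (fun t => twist g A (Θ t) x)
      (rotDensity g A ϑ ρ (rotParam g ϑ Θ) x / ρ x) 0 := by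
  refine (h.hasDerivAt_twist hside).congr_deriv ?_
  rw [eq_div_iff hρ]
  simp only [rotDensity, current, source, rotParam, Fin.sum_univ_three, frameDeriv, mul_assoc,
    ← Finset.mul_sum]
  simp
  ring

/-! ### The first variation of L at a special state -/

section Lagrangian

variable {U : Set (Fin 3 → ℝ)} {m : ℝ} {g : MetricField} {A : CovField 4} {σ : PauliField}
  {ϑ : Coframe} {ρ : (Fin 4 → ℝ) → ℝ} {Θ : ℝ → Coframe} {P : ℝ → (Fin 4 → ℝ) → ℝ}
  {x : Fin 4 → ℝ}

/-- The value of the derivative is irrelevant: it will be multiplied by the side twist itself, which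
is zero at special states. -/
theorem IsFamilyAt.exists_hasDerivAt_sideTwist (h : IsFamilyAt g ϑ Θ x) (i : Fin 3) :
    ∃ d, HasDerivAt (fun t => sideTwist g A (Θ t) x i) d 0 := by
  have hc := h.hasDerivAt_structCoeff
  fin_cases i
  · exact ⟨_, ((hc 0 1 3).fun_sub (hc 1 3 0)).fun_sub (hc 3 0 1)⟩
  · exact ⟨_, ((hc 0 2 3).fun_sub (hc 2 3 0)).fun_sub (hc 3 0 2)⟩
  · exact ⟨_, (((hc 1 2 3).fun_neg.fun_sub (hc 2 3 1)).fun_sub (hc 3 1 2)).fun_add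
      ((h.hasDerivAt_framePot (A := A) 3).const_mul 4)⟩

theorem IsFamilyAt.hasDerivAt_lagrangian (h : IsFamilyAt g ϑ Θ x) (hm : m ≠ 0)
    (hside : ∀ i, sideTwist g A ϑ x i = 0) {P' : ℝ} (hP : HasDerivAt (fun t => P t x) P' 0)
    (hP0 : P 0 x = ρ x) (hρ : ρ x ≠ 0) :
    HasDerivAt (fun t => lagrangian m g A (Θ t) (P t) x)
      ((1 / 9) * (P' * (twist g A ϑ x ^ 2 - 16 * m ^ 2) +
        2 * twist g A ϑ x * rotDensity g A ϑ ρ (rotParam g ϑ Θ) x)) 0 := by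
  obtain ⟨d0, h0⟩ := h.exists_hasDerivAt_sideTwist (A := A) 0
  obtain ⟨d1, h1⟩ := h.exists_hasDerivAt_sideTwist (A := A) 1
  obtain ⟨d2, h2⟩ := h.exists_hasDerivAt_sideTwist (A := A) 2
  have ht := h.hasDerivAt_twist_rotDensity hside hρ
  have eC : ∀ i k l, structCoeff g (Θ 0) x i k l = structCoeff g ϑ x i k l := fun i k l => by
    simp only [structCoeff, frame2, h.dform_start, h.dualFrame_start]
  have eA : ∀ k, framePot g A (Θ 0) x k = framePot g A ϑ x k := fun k => by
    simp only [framePot, h.dualFrame_start]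
  have e0 : twist g A (Θ 0) x = twist g A ϑ x := by simp only [twist, eC, eA]
  have e1 : ∀ i, sideTwist g A (Θ 0) x i = 0 := fun i => by
    have : sideTwist g A (Θ 0) x = sideTwist g A ϑ x := by simp only [sideTwist, eC, eA]
    rw [this, hside]
  -- The squares of the side twists have derivative 2·0·d, so only the density and the twist
  -- contribute.
  have key := (hP.const_mul (1 / 9)).fun_mul (((((ht.fun_pow 2).fun_add (h0.fun_pow 2)).fun_add
    (h1.fun_pow 2)).fun_sub (h2.fun_pow 2)).fun_sub (hasDerivAt_const (0 : ℝ) (16 * m ^ 2)))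
  refine (key.congr_deriv ?_).congr_of_eventuallyEq ?_
  · simp only [e0, e1, hP0]
    field_simp
    ring
  · have hcont : Continuous fun t : ℝ => (t, x) := by fun_prop
    have hs : ∀ᶠ p : ℝ × (Fin 4 → ℝ) in 𝓝 (0, x), ∀ j α,
        DifferentiableAt ℝ (fun q : ℝ × (Fin 4 → ℝ) => Θ q.1 j q.2 α) p :=
      eventually_all.2 fun j => eventually_all.2 fun α => eventually_differentiableAt (h.smooth j α)
    filter_upwards [(hcont.tendsto 0).eventually hs, (hcont.tendsto 0).eventually h.frame]
      with t h3 h4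
    exact lagrangian_eq hm h4 fun j α => DifferentiableAt.comp x
      (g := fun q : ℝ × (Fin 4 → ℝ) => Θ q.1 j q.2 α) (f := fun y => (t, y)) (h3 j α)
      (by fun_prop)

theorem contDiffOn_lagrangian_family {M : Set (Fin 4 → ℝ)} (hM : IsOpen M) (hm : m ≠ 0)
    (hg : IsLorentzMetric M g) (hA : ∀ α, ContDiffOn ℝ ∞ (fun x => A x α) M)
    {K : Set (Fin 4 → ℝ)} (hv : IsVariation M K g ϑ ρ Θ P) :
    ContDiffOn ℝ ∞ (fun p : ℝ × (Fin 4 → ℝ) => lagrangian m g A (Θ p.1) (P p.1) p.2)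
      (Set.univ ×ˢ M) := by
  have hO : IsOpen ((Set.univ : Set ℝ) ×ˢ M) := isOpen_univ.prod hM
  have hs := contDiffOn_sideTwist_family hO (fun _ hp => hp.2) hg hA hv.smooth_coframe
  have h1 := (contDiffOn_const (c := (1 / 9 : ℝ))).mul hv.smooth_density |>.mul
    (((((contDiffOn_twist_family hO (fun _ hp => hp.2) hg hA hv.smooth_coframe).pow 2).add
      ((hs 0).pow 2)).add ((hs 1).pow 2)).sub ((hs 2).pow 2) |>.sub
        (contDiffOn_const (c := 16 * m ^ 2)))
  refine h1.congr fun p hp => ?_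
  exact lagrangian_eq hm ((hv.state p.1).coframe.frameAt hg hp.2) fun j α =>
    (((hv.state p.1).smooth_coframe j α).contDiffAt (hM.mem_nhds hp.2)).differentiableAt (by simp)

theorem IsVariation.isFamilyAt {M K : Set (Fin 4 → ℝ)} (hv : IsVariation M K g ϑ ρ Θ P)
    (hM : IsOpen M) (hg : IsLorentzMetric M g) (hs : IsState M g ϑ ρ) (hx : x ∈ M) :
    IsFamilyAt g ϑ Θ x :=
  isFamilyAt_of_local hM hg hs.smooth_coframe (isOpen_univ.prod hM) hv.smooth_coframe
    (fun p hp => (hv.state p.1).coframe.frameAt hg hp.2) (fun y hy j => (hv.start y hy).1 j) hx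
    ⟨trivial, hx⟩

theorem IsVariation.hasDerivAt_density {M K : Set (Fin 4 → ℝ)} (hv : IsVariation M K g ϑ ρ Θ P)
    (hM : IsOpen M) (hx : x ∈ M) :
    HasDerivAt (fun t => P t x) (velocity (fun p : ℝ × (Fin 4 → ℝ) => P p.1 p.2) x) 0 :=
  hasDerivAt_velocity (f := fun p : ℝ × (Fin 4 → ℝ) => P p.1 p.2) ((hv.smooth_density.contDiffAt
    ((isOpen_univ.prod hM).mem_nhds ⟨trivial, hx⟩)).differentiableAt (by simp))

/-- The pointwise first variation of the Lagrangian at a special state. -/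
theorem IsVariation.hasDerivAt_lagrangian {K : Set (Fin 4 → ℝ)} (hU : IsOpen U)
    (hbg : IsSpecialBackground U g A σ) (hs : IsSpecialState U g ϑ ρ) (hm : m ≠ 0)
    (hv : IsVariation (cyl U) K g ϑ ρ Θ P) (hx : x ∈ cyl U) :
    HasDerivAt (fun t => lagrangian m g A (Θ t) (P t) x)
      ((1 / 9) * (velocity (fun p : ℝ × (Fin 4 → ℝ) => P p.1 p.2) x *
        (twist g A ϑ x ^ 2 - 16 * m ^ 2) +
        2 * twist g A ϑ x * rotDensity g A ϑ ρ (rotParam g ϑ Θ) x)) 0 :=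
  (hv.isFamilyAt (isOpen_cyl hU) hbg.metric hs.toIsState hx).hasDerivAt_lagrangian hm
    (hbg.sideTwist_eq_zero hU hs hx) (hv.hasDerivAt_density (isOpen_cyl hU) hx)
    (hv.start x hx).2 (hs.pos x hx).ne'

theorem generator_eq_zero (h : ∀ t, ∀ j, Θ t j x = ϑ j x) (j k : Fin 4) :
    generator g ϑ Θ j k x = 0 := by
  have : ∀ α, coframeVelocity Θ j x α = 0 := fun α => by
    simp only [coframeVelocity, velocity, h, deriv_const]
  simp only [generator, this, zero_mul, Finset.sum_const_zero]

theorem rotParam_eq_zero (h : ∀ t, ∀ j, Θ t j x = ϑ j x) (k : Fin 3) :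
    rotParam g ϑ Θ k x = 0 := by
  fin_cases k <;> exact generator_eq_zero h _ _

theorem contDiffOn_rotParam {M : Set (Fin 4 → ℝ)} (hg : IsLorentzMetric M g)
    (hϑ : ∀ j α, ContDiffOn ℝ ∞ (fun x => ϑ j x α) M)
    (hΘ : ∀ x ∈ M, ∀ j α, ContDiffAt ℝ ∞ (fun p : ℝ × (Fin 4 → ℝ) => Θ p.1 j p.2 α) (0, x))
    (k : Fin 3) : ContDiffOn ℝ ∞ (rotParam g ϑ Θ k) M := by
  fin_cases k <;> exact contDiffOn_generator hg hϑ hΘ _ _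

/-! ### Currents of a special state -/

theorem contDiffOn_current (hbg : IsSpecialBackground U g A σ) (hs : IsSpecialState U g ϑ ρ)
    (k : Fin 3) (α : Fin 4) : ContDiffOn ℝ ∞ (current g ϑ ρ k α) (cyl U) :=
  contDiffOn_const.mul (hs.smooth_density.mul
    (contDiffOn_dualFrame hbg.metric hs.smooth_coframe k.castSucc α))

theorem contDiffOn_source (hbg : IsSpecialBackground U g A σ) (hs : IsSpecialState U g ϑ ρ)
    (k : Fin 3) : ContDiffOn ℝ ∞ (source g A ϑ ρ k) (cyl U) :=
  contDiffOn_const.mul (hs.smooth_density.mul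
    (contDiffOn_framePot hbg.metric hbg.potential_smooth hs.smooth_coframe _))

theorem current_indep (hbg : IsSpecialBackground U g A σ) (hs : IsSpecialState U g ϑ ρ)
    (k : Fin 3) (α : Fin 4) : IndepX3 (cyl U) (current g ϑ ρ k α) := fun x hx y hy e => by
  simp only [current, hs.indep_density x hx y hy e, hbg.dualFrame_indep hs _ _ x hx y hy e]

theorem source_indep (hbg : IsSpecialBackground U g A σ) (hs : IsSpecialState U g ϑ ρ)
    (k : Fin 3) : IndepX3 (cyl U) (source g A ϑ ρ k) := fun x hx y hy e => by
  simp only [source, hs.indep_density x hx y hy e, hbg.framePot_indep hs _ x hx y hy e]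

/-- The 3-component of e_k is ϑ^3(e_k), because ϑ^3 = dx^3, and here k is 0, 1 or 2. -/
theorem current_last (hbg : IsSpecialBackground U g A σ) (hs : IsSpecialState U g ϑ ρ)
    (hx : x ∈ cyl U) (k : Fin 3) : current g ϑ ρ k 3 x = 0 := by
  have : (3 : Fin 4) ≠ k.castSucc := (Fin.castSucc_lt_last k).ne'
  rw [current, IsSpecialBackground.dualFrame_last (hbg.frameAt hs hx) (hs.third x hx),
    if_neg this, mul_zero, mul_zero]

/-- Since the current has no 3-component, the x^3-derivative of b does not enter, and the sum can be
read on the slice. -/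
theorem sum_current_pd (hbg : IsSpecialBackground U g A σ) (hs : IsSpecialState U g ϑ ρ)
    {u : Fin 3 → ℝ} (hu : u ∈ U) (k : Fin 3) {b : (Fin 4 → ℝ) → ℝ}
    (hb : DifferentiableAt ℝ b (col u 0)) :
    ∑ α, current g ϑ ρ k α (col u 0) * pd α b (col u 0) =
      ∑ α : Fin 3, current g ϑ ρ k α.castSucc (col u 0) * pd α (fun v => b (col v 0)) u := by
  rw [Fin.sum_univ_castSucc]
  have : current g ϑ ρ k (Fin.last 3) (col u 0) = 0 := current_last hbg hs (col_mem_cyl hu 0) k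
  rw [this, zero_mul, add_zero]
  exact Finset.sum_congr rfl fun α _ => by rw [pd_comp_col hb]

theorem contDiffOn_twist_special (hU : IsOpen U) (hbg : IsSpecialBackground U g A σ)
    (hs : IsSpecialState U g ϑ ρ) : ContDiffOn ℝ ∞ (twist g A ϑ) (cyl U) :=
  contDiffOn_twist (isOpen_cyl hU) hbg.metric hbg.potential_smooth hs.smooth_coframe

theorem twist_indep (hU : IsOpen U) (hbg : IsSpecialBackground U g A σ)
    (hs : IsSpecialState U g ϑ ρ) : IndepX3 (cyl U) (twist g A ϑ) := by
  have hpd : ∀ i α β, IndepX3 (cyl U) (pd α fun z => ϑ i z β) := fun i α β x hx y hy e => by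
    have hi : IndepX3 (cyl U) fun z => ϑ i z β := fun x hx y hy e => by
      simp only [hs.indep_coframe i x hx y hy e]
    have h1 := hi.pd_eq hU (hs.smooth_coframe i β) hx
    have h2 := hi.pd_eq hU (hs.smooth_coframe i β) hy
    refine Fin.lastCases ?_ (fun α => ?_) α
    · exact h1.1.trans h2.1.symm
    · rw [h1.2, h2.2, e]
  intro x hx y hy e
  have hC : ∀ i k l, structCoeff g ϑ x i k l = structCoeff g ϑ y i k l := fun i k l => by
    simp only [structCoeff, frame2, dform, hpd i _ _ x hx y hy e,
      hbg.dualFrame_indep hs _ _ x hx y hy e]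
  simp only [twist, hC, hbg.framePot_indep hs _ x hx y hy e]

/-! ### From the Euler–Lagrange equations to stationarity -/

theorem setIntegral_sum_divergence {n : ℕ} {M K : Set (Fin n → ℝ)} (hM : IsOpen M)
    (hK : IsCompact K) (hKM : K ⊆ M) {V : Fin 3 → Fin n → (Fin n → ℝ) → ℝ}
    {b : Fin 3 → (Fin n → ℝ) → ℝ} {c : Fin 3 → (Fin n → ℝ) → ℝ}
    (hV : ∀ k α, ContDiffOn ℝ ∞ (V k α) M) (hb : ∀ k, ContDiffOn ℝ ∞ (b k) M)
    (h0 : ∀ k, ∀ x ∈ M \ K, b k x = 0) (hc : ∀ k, ∀ x ∈ M, ∑ α, pd α (V k α) x = c k x) :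
    ∫ x in K, ∑ k, (∑ α, V k α x * pd α (b k) x + c k x * b k x) = 0 := by
  have e : ∀ x ∈ K, ∑ k, (∑ α, V k α x * pd α (b k) x + c k x * b k x) =
      ∑ k, (∑ α, V k α x * pd α (b k) x + (∑ α, pd α (V k α) x) * b k x) := fun x hx =>
    Finset.sum_congr rfl fun k _ => by rw [hc k x (hKM hx)]
  rw [setIntegral_congr_fun hK.measurableSet e, integral_finsetSum]
  · exact Finset.sum_eq_zero fun k _ => setIntegral_divergence hM hK hKM (hV k) (hb k) (h0 k)
  · intro k _
    have i1 : ContDiffOn ℝ ∞ (fun x => ∑ α, V k α x * pd α (b k) x) M :=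
      ContDiffOn.sum fun α _ => (hV k α).mul (contDiffOn_pd hM (hb k))
    have i2 : ContDiffOn ℝ ∞ (fun x => (∑ α, pd α (V k α) x) * b k x) M :=
      (ContDiffOn.sum fun α _ => contDiffOn_pd hM (hV k α)).mul (hb k)
    have hcont : ContinuousOn (fun x => ∑ α, V k α x * pd α (b k) x +
        (∑ α, pd α (V k α) x) * b k x) K := (i1.add i2).continuousOn.mono hKM
    exact hcont.integrableOn_compact hK

variable {κ : ℝ} {b : Fin 3 → (Fin 4 → ℝ) → ℝ}

theorem EulerLagrange.setIntegral_rotDensity (hU : IsOpen U)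
    (hbg : IsSpecialBackground U g A σ) (hs : IsSpecialState U g ϑ ρ)
    (hE : EulerLagrange U m g A ϑ ρ κ) {K : Set (Fin 4 → ℝ)} (hK : IsCompact K) (hKM : K ⊆ cyl U)
    (hb : ∀ k, ContDiffOn ℝ ∞ (b k) (cyl U)) (h0 : ∀ k, ∀ x ∈ cyl U \ K, b k x = 0) :
    ∫ x in K, rotDensity g A ϑ ρ b x = 0 :=
  setIntegral_sum_divergence (isOpen_cyl hU) hK hKM (contDiffOn_current hbg hs) hb h0 hE.divergence

/-- A function supported over K need not have compact support in the cylinder, so the integration by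
parts is done on the slice x^3 = 0. -/
theorem EulerLagrange.setIntegral_rotDensity_col (hU : IsOpen U)
    (hbg : IsSpecialBackground U g A σ) (hs : IsSpecialState U g ϑ ρ)
    (hE : EulerLagrange U m g A ϑ ρ κ) {K : Set (Fin 3 → ℝ)} (hK : IsCompact K) (hKU : K ⊆ U)
    (hb : ∀ k, ContDiffOn ℝ ∞ (b k) (cyl U)) (h0 : ∀ k, ∀ x ∈ cyl U \ cyl K, b k x = 0) :
    ∫ u in K, rotDensity g A ϑ ρ b (col u 0) = 0 := by
  have e : ∀ u ∈ K, rotDensity g A ϑ ρ b (col u 0) = ∑ k, (∑ α : Fin 3,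
      current g ϑ ρ k α.castSucc (col u 0) * pd α (fun v => b k (col v 0)) u +
      source g A ϑ ρ k (col u 0) * b k (col u 0)) := fun u hu => by
    have hx := (isOpen_cyl hU).mem_nhds (col_mem_cyl (hKU hu) 0)
    refine Finset.sum_congr rfl fun k _ => ?_
    rw [sum_current_pd hbg hs (hKU hu) k (((hb k).contDiffAt hx).differentiableAt (by simp))]
  rw [setIntegral_congr_fun hK.measurableSet e]
  refine setIntegral_sum_divergence (c := fun k u => source g A ϑ ρ k (col u 0))
    (b := fun k u => b k (col u 0)) hU hK hKU
    (V := fun k α u => current g ϑ ρ k (Fin.castSucc α) (col u 0))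
    (fun k α => contDiffOn_comp_col (contDiffOn_current hbg hs k _) 0)
    (fun k => contDiffOn_comp_col (hb k) 0) (fun k u hu => ?_) fun k => ?_
  · exact h0 k _ ⟨col_mem_cyl hu.1 0, fun h => hu.2 (by
      rw [cyl, Set.mem_ofPred_eq, base_col] at h; exact h)⟩
  · exact (divergence_iff hU (contDiffOn_current hbg hs k) (current_indep hbg hs k)
      (source_indep hbg hs k)).1 (hE.divergence k)

theorem IsVariation.contDiffOn_rotParam {K : Set (Fin 4 → ℝ)} (hU : IsOpen U)
    (hbg : IsSpecialBackground U g A σ) (hs : IsSpecialState U g ϑ ρ)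
    (hv : IsVariation (cyl U) K g ϑ ρ Θ P) (k : Fin 3) :
    ContDiffOn ℝ ∞ (rotParam g ϑ Θ k) (cyl U) :=
  Cosserat.contDiffOn_rotParam hbg.metric hs.smooth_coframe (fun _ hx j α =>
    (hv.smooth_coframe j α).contDiffAt
      ((isOpen_univ.prod (isOpen_cyl hU)).mem_nhds ⟨trivial, hx⟩)) k

theorem EulerLagrange.isSolution (hU : IsOpen U) (hbg : IsSpecialBackground U g A σ)
    (hs : IsSpecialState U g ϑ ρ) (hm : m ≠ 0) (hκ : κ ^ 2 = 1)
    (hE : EulerLagrange U m g A ϑ ρ κ) : IsSolution (cyl U) m g A ϑ ρ := by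
  intro K hK hKM Θ P hv
  have hM := isOpen_cyl hU
  have h1 := hasDerivAt_setIntegral (isOpen_univ.prod hM)
    (contDiffOn_lagrangian_family hM hm hbg.metric hbg.potential_smooth hv) hK
    (fun x hx => ⟨trivial, hKM hx⟩)
    (fun x hx => hv.hasDerivAt_lagrangian hU hbg hs hm (hKM hx))
  refine h1.congr_deriv ?_
  -- With T = 4κm and κ² = 1 the variation of the density drops out, and the factor 2T/9 = 8κm/9 of
  -- the other term is constant. What remains is an integrated divergence.
  rw [setIntegral_congr_fun (g := fun x => (8 / 9 * κ * m) *
    rotDensity g A ϑ ρ (rotParam g ϑ Θ) x) hK.measurableSet fun x hx => ?_, integral_const_mul,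
    hE.setIntegral_rotDensity hU hbg hs hK hKM (hv.contDiffOn_rotParam hU hbg hs)
      (fun k x hx => rotParam_eq_zero (fun t => (hv.support t x hx).1) k), mul_zero]
  simp only [hE.twist_eq x (hKM hx)]
  linear_combination (16 / 9 * m ^ 2 * velocity (fun p : ℝ × (Fin 4 → ℝ) => P p.1 p.2) x) * hκ

theorem contDiffOn_family_col {F : ℝ × (Fin 4 → ℝ) → ℝ}
    (hF : ContDiffOn ℝ ∞ F (Set.univ ×ˢ cyl U)) :
    ContDiffOn ℝ ∞ (fun p : ℝ × (Fin 3 → ℝ) => F (p.1, col p.2 0)) (Set.univ ×ˢ U) := by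
  have hcol : ContDiff ℝ ∞ fun p : ℝ × (Fin 3 → ℝ) => (col p.2 0 : Fin 4 → ℝ) :=
    (contDiff_col (n := 3) 0).comp contDiff_snd
  have hpair : ContDiff ℝ ∞ fun p : ℝ × (Fin 3 → ℝ) => (p.1, (col p.2 0 : Fin 4 → ℝ)) :=
    contDiff_fst.prodMk hcol
  have hmaps : Set.MapsTo (fun p : ℝ × (Fin 3 → ℝ) => (p.1, (col p.2 0 : Fin 4 → ℝ)))
      (Set.univ ×ˢ U) (Set.univ ×ˢ cyl U) := fun p hp =>
    Set.mk_mem_prod (Set.mem_univ _) (col_mem_cyl (Set.mem_prod.1 hp).2 0)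
  exact ContDiffOn.comp hF hpair.contDiffOn hmaps

theorem EulerLagrange.isSpecialSolution (hU : IsOpen U) (hbg : IsSpecialBackground U g A σ)
    (hs : IsSpecialState U g ϑ ρ) (hm : m ≠ 0) (hκ : κ ^ 2 = 1)
    (hE : EulerLagrange U m g A ϑ ρ κ) : IsSpecialSolution U m g A ϑ ρ := by
  intro K hK hKU Θ P hv _
  have hM := isOpen_cyl hU
  have hF := contDiffOn_family_col
    (contDiffOn_lagrangian_family hM hm hbg.metric hbg.potential_smooth hv)
  have hF' := fun u (hu : u ∈ K) =>
    hv.hasDerivAt_lagrangian hU hbg hs hm (col_mem_cyl (hKU hu) 0)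
  have h1 := hasDerivAt_setIntegral (isOpen_univ.prod hU) hF hK (fun u hu => ⟨trivial, hKU hu⟩) hF'
  have e : ∀ u ∈ K, (1 / 9) * (velocity (fun p : ℝ × (Fin 4 → ℝ) => P p.1 p.2) (col u 0) *
      (twist g A ϑ (col u 0) ^ 2 - 16 * m ^ 2) +
      2 * twist g A ϑ (col u 0) * rotDensity g A ϑ ρ (rotParam g ϑ Θ) (col u 0)) =
      (8 / 9 * κ * m) * rotDensity g A ϑ ρ (rotParam g ϑ Θ) (col u 0) := fun u hu => by
    rw [hE.twist_eq _ (col_mem_cyl (hKU hu) 0)]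
    linear_combination (16 / 9 * m ^ 2 *
      velocity (fun p : ℝ × (Fin 4 → ℝ) => P p.1 p.2) (col u 0)) * hκ
  have h2 := hE.setIntegral_rotDensity_col hU hbg hs hK hKU (hv.contDiffOn_rotParam hU hbg hs)
    (fun k x hx => rotParam_eq_zero (fun t => (hv.support t x hx).1) k)
  refine h1.congr_deriv ?_
  rw [setIntegral_congr_fun hK.measurableSet e, integral_const_mul, h2, mul_zero]

/-! ### From weak equations to the Euler–Lagrange equations -/

theorem isPreconnected_cyl (hUc : IsPreconnected U) : IsPreconnected (cyl U) := by
  have hc : Continuous fun p : (Fin 3 → ℝ) × ℝ => (col p.1 p.2 : Fin 4 → ℝ) := by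
    refine continuous_pi fun α => ?_
    refine Fin.lastCases ?_ (fun α => ?_) α
    · simp only [col_last]; fun_prop
    · simp only [col_castSucc]; fun_prop
  have e : cyl U = (fun p : (Fin 3 → ℝ) × ℝ => (col p.1 p.2 : Fin 4 → ℝ)) '' (U ×ˢ Set.univ) := by
    ext y
    constructor
    · intro hy
      exact ⟨(base y, y (Fin.last 3)), ⟨hy, trivial⟩, col_base_last y⟩
    · rintro ⟨p, hp, rfl⟩
      exact col_mem_cyl hp.1 _
  rw [e]
  exact (hUc.prod isPreconnected_univ).image _ hc.continuousOn

/-- The twist is continuous and its square is 16m², which is nonzero; on a connected set such a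
function cannot change sign. -/
theorem exists_twist_sign (hU : IsOpen U) (hUc : IsPreconnected U)
    (hbg : IsSpecialBackground U g A σ) (hs : IsSpecialState U g ϑ ρ) (hm : m ≠ 0)
    (h : ∀ x ∈ cyl U, ρ x * (twist g A ϑ x ^ 2 - 16 * m ^ 2) = 0) :
    (∀ x ∈ cyl U, twist g A ϑ x = 4 * 1 * m) ∨ ∀ x ∈ cyl U, twist g A ϑ x = 4 * (-1) * m := by
  have hsq : Set.EqOn (twist g A ϑ ^ 2) ((fun _ => 4 * m) ^ 2) (cyl U) := fun x hx => by
    have := (mul_eq_zero.1 (h x hx)).resolve_left (hs.pos x hx).ne'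
    simp only [Pi.pow_apply]
    linarith
  rcases (isPreconnected_cyl hUc).eq_or_eq_neg_of_sq_eq
    (contDiffOn_twist_special hU hbg hs).continuousOn continuousOn_const hsq
    (fun _ => by positivity) with h1 | h1
  · left; intro x hx; rw [h1 hx]; ring
  · right; intro x hx; rw [h1 hx, Pi.neg_apply]; ring

end Lagrangian

/-! ### One-parameter groups of Lorentz transformations -/

/-- The rotation in the `(1,2)`-plane and the boosts in the `(0,2)`- and `(0,1)`-planes. -/
def flow (k : Fin 3) (s : ℝ) : Matrix (Fin 4) (Fin 4) ℝ :=
  ![!![1, 0, 0, 0; 0, Real.cos s, Real.sin s, 0; 0, -Real.sin s, Real.cos s, 0; 0, 0, 0, 1],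
    !![Real.cosh s, 0, Real.sinh s, 0; 0, 1, 0, 0; Real.sinh s, 0, Real.cosh s, 0; 0, 0, 0, 1],
    !![Real.cosh s, Real.sinh s, 0, 0; Real.sinh s, Real.cosh s, 0, 0; 0, 0, 1, 0; 0, 0, 0, 1]] k

/-- The infinitesimal generators of `flow`. -/
def flowGen (k : Fin 3) : Matrix (Fin 4) (Fin 4) ℝ :=
  ![!![0, 0, 0, 0; 0, 0, 1, 0; 0, -1, 0, 0; 0, 0, 0, 0],
    !![0, 0, 1, 0; 0, 0, 0, 0; 1, 0, 0, 0; 0, 0, 0, 0],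
    !![0, 1, 0, 0; 1, 0, 0, 0; 0, 0, 0, 0; 0, 0, 0, 0]] k

theorem contDiff_flow (k : Fin 3) (i j : Fin 4) : ContDiff ℝ ∞ fun s => flow k s i j := by
  fin_cases k <;> fin_cases i <;> fin_cases j <;> simp [flow] <;> fun_prop

theorem flow_zero (k : Fin 3) (i j : Fin 4) : flow k 0 i j = if i = j then 1 else 0 := by
  fin_cases k <;> fin_cases i <;> fin_cases j <;> simp [flow]

/-- This keeps ϑ^3 fixed, so the same flows are admissible in the full and in the reduced
variational problem. -/
theorem flow_three (k : Fin 3) (s : ℝ) (j : Fin 4) : flow k s 3 j = if j = 3 then 1 else 0 := by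
  fin_cases k <;> fin_cases j <;> simp [flow]

theorem hasDerivAt_flow (k : Fin 3) (i j : Fin 4) :
    HasDerivAt (fun s => flow k s i j) (flowGen k i j) 0 := by
  have h1 := Real.hasDerivAt_cos 0
  have h2 := Real.hasDerivAt_sin 0
  have h3 := Real.hasDerivAt_cosh 0
  have h4 := Real.hasDerivAt_sinh 0
  have h5 := h2.neg
  simp only [Real.cos_zero, Real.sin_zero, Real.cosh_zero, Real.sinh_zero, neg_zero] at h1 h2 h3 h4 h5
  fin_cases k <;> fin_cases i <;> fin_cases j <;>
  first
    | exact h1 | exact h2 | exact h3 | exact h4 | exact h5 | exact hasDerivAt_const _ _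

theorem flow_lorentz (k : Fin 3) (s : ℝ) (i l : Fin 4) :
    ∑ j, sgn j * flow k s j i * flow k s j l = if i = l then sgn i else 0 := by
  have h1 := Real.cosh_sq s
  have h2 := Real.sin_sq_add_cos_sq s
  rw [Fin.sum_univ_four]
  fin_cases k <;> fin_cases i <;> fin_cases l <;> simp [flow, sgn] <;> nlinarith

/-- A coframe rotated by a position-dependent amount. -/
def flowCoframe (k : Fin 3) (b : (Fin 4 → ℝ) → ℝ) (ϑ : Coframe) (t : ℝ) : Coframe := fun j y α =>
  ∑ i, flow k (t * b y) j i * ϑ i y α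

/-- One of three functions equal to `b`, the others being zero. -/
def singleParam (k : Fin 3) (b : (Fin 4 → ℝ) → ℝ) (k' : Fin 3) (x : Fin 4 → ℝ) : ℝ :=
  if k' = k then b x else 0

theorem rotDensity_single (g : MetricField) (A : CovField 4) (ϑ : Coframe)
    (ρ : (Fin 4 → ℝ) → ℝ) (k : Fin 3) (b : (Fin 4 → ℝ) → ℝ) (x : Fin 4 → ℝ) :
    rotDensity g A ϑ ρ (singleParam k b) x =
      ∑ α, current g ϑ ρ k α x * pd α b x + source g A ϑ ρ k x * b x := by
  rw [rotDensity, Finset.sum_eq_single k]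
  · have : singleParam k b k = b := by funext y; simp [singleParam]
    rw [this]
  · intro k' _ hk
    have : singleParam k b k' = fun _ => 0 := by funext y; simp [singleParam, hk]
    simp [this, pd_const]
  · simp

theorem rotDensity_zero (g : MetricField) (A : CovField 4) (ϑ : Coframe)
    (ρ : (Fin 4 → ℝ) → ℝ) (k : Fin 3) (x : Fin 4 → ℝ) :
    rotDensity g A ϑ ρ (singleParam k fun _ => 0) x = 0 := by
  simp [rotDensity_single, pd_const]

/-! ### Test variations along the flows -/

section FlowVariation

variable {M K : Set (Fin 4 → ℝ)} {U : Set (Fin 3 → ℝ)} {m : ℝ} {g : MetricField} {A : CovField 4}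
  {σ : PauliField} {ϑ : Coframe} {ρ : (Fin 4 → ℝ) → ℝ} {b c : (Fin 4 → ℝ) → ℝ} {x : Fin 4 → ℝ}

theorem flowCoframe_eq (k : Fin 3) {t : ℝ} (h : t * b x = 0) (j : Fin 4) :
    flowCoframe k b ϑ t j x = ϑ j x := by
  funext α
  simp [flowCoframe, h, flow_zero]

theorem contDiffOn_slice {F : ℝ × (Fin 4 → ℝ) → ℝ} (hF : ContDiffOn ℝ ∞ F (Set.univ ×ˢ M)) (t : ℝ) :
    ContDiffOn ℝ ∞ (fun y => F (t, y)) M := by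
  have h : ContDiffOn ℝ ∞ (fun y : Fin 4 → ℝ => (t, y)) M := contDiffOn_const.prodMk contDiffOn_id
  exact ContDiffOn.comp hF h fun y hy => Set.mk_mem_prod (Set.mem_univ _) hy

/-- The metric constraint is kept because each flow is a Lorentz transformation pointwise, and the
factor exp(tc) keeps the density positive for all t. -/
theorem isVariation_flow (hs : IsState M g ϑ ρ) (k : Fin 3)
    (hb : ContDiff ℝ ∞ b) (hc : ContDiff ℝ ∞ c) (hb0 : ∀ x ∈ M \ K, b x = 0)
    (hc0 : ∀ x ∈ M \ K, c x = 0) :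
    IsVariation M K g ϑ ρ (flowCoframe k b ϑ) (fun t y => Real.exp (t * c y) * ρ y) := by
  have e1 : ∀ j α, ContDiffOn ℝ ∞ (fun p : ℝ × (Fin 4 → ℝ) => flowCoframe k b ϑ p.1 j p.2 α)
      (Set.univ ×ˢ M) := fun j α => by
    refine ContDiffOn.sum fun i _ => ContDiffOn.mul ?_ (contDiffOn_comp_snd (hs.smooth_coframe i α))
    have : ContDiff ℝ ∞ fun p : ℝ × (Fin 4 → ℝ) => p.1 * b p.2 :=
      contDiff_fst.mul (hb.comp contDiff_snd)
    exact ((contDiff_flow k j i).comp this).contDiffOn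
  have e2 : ContDiffOn ℝ ∞ (fun p : ℝ × (Fin 4 → ℝ) => Real.exp (p.1 * c p.2) * ρ p.2)
      (Set.univ ×ˢ M) := by
    refine ContDiffOn.mul ?_ (contDiffOn_comp_snd hs.smooth_density)
    have : ContDiff ℝ ∞ fun p : ℝ × (Fin 4 → ℝ) => p.1 * c p.2 :=
      contDiff_fst.mul (hc.comp contDiff_snd)
    exact this.exp.contDiffOn
  refine ⟨e1, e2, fun t => ⟨fun j α => ?_, ?_, ?_, fun x hx => ?_⟩, fun x _ => ⟨fun j => ?_, ?_⟩,
    fun t x hx => ⟨fun j => ?_, ?_⟩⟩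
  · exact contDiffOn_slice (e1 j α) t
  · exact contDiffOn_slice e2 t
  · intro x hx α β
    rw [hs.coframe x hx α β]
    have h1 : ∀ j, sgn j * flowCoframe k b ϑ t j x α * flowCoframe k b ϑ t j x β =
        ∑ i, ∑ l, sgn j * flow k (t * b x) j i * flow k (t * b x) j l * (ϑ i x α * ϑ l x β) := by
      intro j
      rw [mul_assoc, flowCoframe, flowCoframe, Finset.sum_mul_sum]
      simp only [Finset.mul_sum]
      exact Finset.sum_congr rfl fun i _ => Finset.sum_congr rfl fun l _ => by ring
    simp only [h1]
    rw [Finset.sum_comm]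
    refine Finset.sum_congr rfl fun i _ => ?_
    rw [Finset.sum_comm]
    simp only [← Finset.sum_mul, flow_lorentz]
    simp
    ring
  · exact mul_pos (Real.exp_pos _) (hs.pos x hx)
  · exact flowCoframe_eq k (zero_mul _) j
  · simp
  · exact flowCoframe_eq k (by rw [hb0 x hx, mul_zero]) j
  · simp [hc0 x hx]

theorem generator_flow (hf : FrameAt g ϑ x) (k : Fin 3) (j i : Fin 4) :
    generator g ϑ (flowCoframe k b ϑ) j i x = b x * flowGen k j i := by
  have hv : ∀ α, coframeVelocity (flowCoframe k b ϑ) j x α =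
      ∑ i, b x * flowGen k j i * ϑ i x α := fun α => by
    have h1 : ∀ i, HasDerivAt (fun t : ℝ => flow k (t * b x) j i) (b x * flowGen k j i) 0 :=
      fun i => by
        have h2 : HasDerivAt (fun t : ℝ => t * b x) (b x) 0 := by
          simpa using (hasDerivAt_id (0 : ℝ)).mul_const (b x)
        have h3 : HasDerivAt (fun s => flow k s j i) (flowGen k j i) (0 * b x) := by
          rw [zero_mul]; exact hasDerivAt_flow k j i
        rw [mul_comm]
        exact h3.comp (0 : ℝ) h2
    exact (HasDerivAt.fun_sum fun i _ => (h1 i).mul_const (ϑ i x α)).deriv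
  simp only [generator, hv, Finset.sum_mul]
  rw [Finset.sum_comm]
  simp only [mul_assoc, ← Finset.mul_sum, hf.dual]
  simp

/-- Each of the three flows switches on exactly one of the three relevant generators, so the
divergence equations can be obtained one by one. -/
theorem rotParam_flow (hf : FrameAt g ϑ x) (k k' : Fin 3) :
    rotParam g ϑ (flowCoframe k b ϑ) k' x = singleParam k b k' x := by
  fin_cases k' <;> fin_cases k <;>
    simp [rotParam, generator_flow hf, singleParam, flowGen]

theorem velocity_exp : velocity (fun p : ℝ × (Fin 4 → ℝ) => Real.exp (p.1 * c p.2) * ρ p.2) x =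
    c x * ρ x := by
  have h2 : HasDerivAt (fun t : ℝ => t * c x) (c x) 0 := by
    simpa using (hasDerivAt_id (0 : ℝ)).mul_const (c x)
  have := (h2.exp.mul_const (ρ x)).deriv
  simpa only [velocity, zero_mul, Real.exp_zero, one_mul] using this

/-- The pointwise first variation of the Lagrangian along a flow. -/
def flowDensity (m : ℝ) (g : MetricField) (A : CovField 4) (ϑ : Coframe) (ρ : (Fin 4 → ℝ) → ℝ)
    (k : Fin 3) (b c : (Fin 4 → ℝ) → ℝ) (x : Fin 4 → ℝ) : ℝ :=
  (1 / 9) * (c x * ρ x * (twist g A ϑ x ^ 2 - 16 * m ^ 2) +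
    2 * twist g A ϑ x * rotDensity g A ϑ ρ (singleParam k b) x)

theorem hasDerivAt_lagrangian_flow (hU : IsOpen U) (hbg : IsSpecialBackground U g A σ)
    (hs : IsSpecialState U g ϑ ρ) (hm : m ≠ 0) (k : Fin 3)
    (hv : IsVariation (cyl U) K g ϑ ρ (flowCoframe k b ϑ)
      (fun t y => Real.exp (t * c y) * ρ y)) (hx : x ∈ cyl U) :
    HasDerivAt (fun t => lagrangian m g A (flowCoframe k b ϑ t)
      (fun y => Real.exp (t * c y) * ρ y) x) (flowDensity m g A ϑ ρ k b c x) 0 := by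
  have h := hv.hasDerivAt_lagrangian hU hbg hs hm hx
  rw [velocity_exp, rotDensity_congr (b' := singleParam k b) fun k' => ?_] at h
  · exact h
  · filter_upwards [(isOpen_cyl hU).mem_nhds hx] with y hy
    exact rotParam_flow (hbg.frameAt hs hy) k k'

theorem IsSolution.setIntegral_flowDensity (h : IsSolution (cyl U) m g A ϑ ρ) (hU : IsOpen U)
    (hbg : IsSpecialBackground U g A σ) (hs : IsSpecialState U g ϑ ρ) (hm : m ≠ 0) (k : Fin 3)
    (hK : IsCompact K) (hKM : K ⊆ cyl U) (hb : ContDiff ℝ ∞ b) (hc : ContDiff ℝ ∞ c)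
    (hb0 : ∀ x ∉ K, b x = 0) (hc0 : ∀ x ∉ K, c x = 0) :
    ∫ x in K, flowDensity m g A ϑ ρ k b c x = 0 := by
  have hM := isOpen_cyl hU
  have hv := isVariation_flow (K := K) hs.toIsState k hb hc (fun x hx => hb0 x hx.2)
    (fun x hx => hc0 x hx.2)
  have h1 := hasDerivAt_setIntegral (isOpen_univ.prod hM)
    (contDiffOn_lagrangian_family hM hm hbg.metric hbg.potential_smooth hv) hK
    (fun x hx => ⟨trivial, hKM hx⟩)
    (fun x hx => hasDerivAt_lagrangian_flow hU hbg hs hm k hv (hKM hx))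
  exact h1.unique (h K hK hKM _ _ hv)

theorem isSpecialState_flow {K : Set (Fin 3 → ℝ)} {b c : (Fin 3 → ℝ) → ℝ}
    (hs : IsSpecialState U g ϑ ρ) (k : Fin 3)
    (hv : IsVariation (cyl U) (cyl K) g ϑ ρ (flowCoframe k (fun x => b (base x)) ϑ)
      (fun t y => Real.exp (t * c (base y)) * ρ y)) (t : ℝ) :
    IsSpecialState U g (flowCoframe k (fun x => b (base x)) ϑ t)
      (fun y => Real.exp (t * c (base y)) * ρ y) where
  toIsState := hv.state t
  indep_coframe j x hx y hy e := by
    funext α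
    simp only [flowCoframe, e, hs.indep_coframe _ x hx y hy e]
  indep_density x hx y hy e := by
    simp only [e, hs.indep_density x hx y hy e]
  third x hx := by
    rw [← hs.third x hx]
    funext α
    simp [flowCoframe, flow_three]

theorem IsSpecialSolution.setIntegral_flowDensity {K : Set (Fin 3 → ℝ)} {b c : (Fin 3 → ℝ) → ℝ}
    (h : IsSpecialSolution U m g A ϑ ρ) (hU : IsOpen U)
    (hbg : IsSpecialBackground U g A σ) (hs : IsSpecialState U g ϑ ρ) (hm : m ≠ 0) (k : Fin 3)
    (hK : IsCompact K) (hKU : K ⊆ U) (hb : ContDiff ℝ ∞ b) (hc : ContDiff ℝ ∞ c)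
    (hb0 : ∀ x ∉ K, b x = 0) (hc0 : ∀ x ∉ K, c x = 0) :
    ∫ u in K, flowDensity m g A ϑ ρ k (fun x => b (base x)) (fun x => c (base x)) (col u 0) = 0 := by
  have hM := isOpen_cyl hU
  have hb' : ContDiff ℝ ∞ fun x : Fin 4 → ℝ => b (base x) := hb.comp contDiff_base
  have hc' : ContDiff ℝ ∞ fun x : Fin 4 → ℝ => c (base x) := hc.comp contDiff_base
  have hv := isVariation_flow (K := cyl K) hs.toIsState k hb' hc' (fun x hx => hb0 (base x) hx.2) (fun x hx => hc0 (base x) hx.2)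
  have hF := contDiffOn_family_col
    (contDiffOn_lagrangian_family hM hm hbg.metric hbg.potential_smooth hv)
  have hF' : ∀ u ∈ K, HasDerivAt (fun t => lagrangian m g A (flowCoframe k (fun x => b (base x)) ϑ t)
      (fun y => Real.exp (t * c (base y)) * ρ y) (col u 0))
      (flowDensity m g A ϑ ρ k (fun x => b (base x)) (fun x => c (base x)) (col u 0)) 0 :=
    fun u hu => hasDerivAt_lagrangian_flow hU hbg hs hm k hv (col_mem_cyl (hKU hu) 0)
  have hmem : ∀ u ∈ K, ((0 : ℝ), u) ∈ (Set.univ : Set ℝ) ×ˢ U := fun u hu => ⟨trivial, hKU hu⟩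
  have h1 := hasDerivAt_setIntegral (isOpen_univ.prod hU) hF hK hmem hF'
  have h2 := h K hK hKU _ _ hv (isSpecialState_flow hs k hv)
  exact h1.unique h2

/-! ### The Euler–Lagrange equations of solutions -/

/-- Test functions of (x^0,x^1,x^2) alone are enough: for data independent of x^3 the equation on
the cylinder is equivalent to the one on U. -/
theorem divergence_of_weak_col (hU : IsOpen U) (hbg : IsSpecialBackground U g A σ)
    (hs : IsSpecialState U g ϑ ρ) (k : Fin 3)
    (h : ∀ b : (Fin 3 → ℝ) → ℝ, ContDiff ℝ ∞ b → HasCompactSupport b → tsupport b ⊆ U →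
      ∫ u in tsupport b, rotDensity g A ϑ ρ (singleParam k fun x => b (base x)) (col u 0) = 0) :
    ∀ x ∈ cyl U, ∑ α, pd α (current g ϑ ρ k α) x = source g A ϑ ρ k x := by
  refine (divergence_iff hU (contDiffOn_current hbg hs k) (current_indep hbg hs k)
    (source_indep hbg hs k)).2 ?_
  refine divergence_eq_of_weak (V := fun α u => current g ϑ ρ k (Fin.castSucc α) (col u 0))
    (c := fun u => source g A ϑ ρ k (col u 0)) hU
    (fun α => contDiffOn_comp_col (contDiffOn_current hbg hs k _) 0)
    (contDiffOn_comp_col (contDiffOn_source hbg hs k) 0) fun b hb hcs hsub => ?_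
  refine Eq.trans ?_ (h b hb hcs hsub)
  refine setIntegral_congr_fun (IsCompact.measurableSet hcs) fun u hu => ?_
  simp only [rotDensity_single]
  rw [sum_current_pd hbg hs (hsub hu) k (b := fun x => b (base x))
    ((hb.comp contDiff_base).differentiable (by simp) _)]
  simp only [base_col]

theorem divergence_of_weak (hU : IsOpen U) (hbg : IsSpecialBackground U g A σ)
    (hs : IsSpecialState U g ϑ ρ) (k : Fin 3)
    (h : ∀ b : (Fin 4 → ℝ) → ℝ, ContDiff ℝ ∞ b → HasCompactSupport b → tsupport b ⊆ cyl U →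
      ∫ x in tsupport b, rotDensity g A ϑ ρ (singleParam k b) x = 0) :
    ∀ x ∈ cyl U, ∑ α, pd α (current g ϑ ρ k α) x = source g A ϑ ρ k x := by
  refine divergence_eq_of_weak (isOpen_cyl hU) (contDiffOn_current hbg hs k)
    (contDiffOn_source hbg hs k) fun b hb hcs hsub => ?_
  have h1 := h b hb hcs hsub
  simp only [rotDensity_single] at h1
  exact h1

theorem contDiffOn_mass (hU : IsOpen U) (hbg : IsSpecialBackground U g A σ)
    (hs : IsSpecialState U g ϑ ρ) :
    ContDiffOn ℝ ∞ (fun x => ρ x * (twist g A ϑ x ^ 2 - 16 * m ^ 2)) (cyl U) :=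
  hs.smooth_density.mul (((contDiffOn_twist_special hU hbg hs).pow 2).sub contDiffOn_const)

theorem eulerLagrange_of_sign
    (hd : ∀ κ : ℝ, κ ≠ 0 → (∀ x ∈ cyl U, twist g A ϑ x = 4 * κ * m) →
      ∀ k, ∀ x ∈ cyl U, ∑ α, pd α (current g ϑ ρ k α) x = source g A ϑ ρ k x)
    (h : (∀ x ∈ cyl U, twist g A ϑ x = 4 * 1 * m) ∨ ∀ x ∈ cyl U, twist g A ϑ x = 4 * (-1) * m) :
    EulerLagrange U m g A ϑ ρ 1 ∨ EulerLagrange U m g A ϑ ρ (-1) := by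
  rcases h with h | h
  · exact Or.inl ⟨h, hd 1 (by norm_num) h⟩
  · exact Or.inr ⟨h, hd (-1) (by norm_num) h⟩

/-- The density is varied first: the resulting constant, nonzero twist can then be taken out of the
integral when the coframe is varied. -/
theorem IsSolution.eulerLagrange (h : IsSolution (cyl U) m g A ϑ ρ) (hU : IsOpen U)
    (hUc : IsPreconnected U) (hbg : IsSpecialBackground U g A σ) (hs : IsSpecialState U g ϑ ρ)
    (hm : m ≠ 0) : EulerLagrange U m g A ϑ ρ 1 ∨ EulerLagrange U m g A ϑ ρ (-1) := by
  have hz : ∀ b : (Fin 4 → ℝ) → ℝ, ∀ x ∉ tsupport b, b x = 0 := fun b x hx =>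
    image_eq_zero_of_notMem_tsupport hx
  refine eulerLagrange_of_sign (fun κ hκ htw k => ?_)
    (exists_twist_sign hU hUc hbg hs hm ?_)
  -- Only the coframe moves (c = 0).
  · refine divergence_of_weak hU hbg hs k fun b hb hcs hsub => ?_
    have h1 := h.setIntegral_flowDensity hU hbg hs hm k hcs hsub hb (c := fun _ => 0)
      contDiff_const (hz b) (fun _ _ => rfl)
    have e : ∀ x ∈ tsupport b, flowDensity m g A ϑ ρ k b (fun _ => 0) x =
        8 / 9 * κ * m * rotDensity g A ϑ ρ (singleParam k b) x := fun x hx => by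
      rw [flowDensity, htw x (hsub hx)]; ring
    rw [setIntegral_congr_fun (IsCompact.measurableSet hcs) e, integral_const_mul] at h1
    exact (mul_eq_zero.1 h1).resolve_left
      (mul_ne_zero (mul_ne_zero (by norm_num) hκ) hm)
  -- Only the density moves (b = 0); the index 0 of the flow is then immaterial.
  · refine eq_zero_of_weak (isOpen_cyl hU) (contDiffOn_mass hU hbg hs) fun c hc hcs hsub => ?_
    have h1 := h.setIntegral_flowDensity hU hbg hs hm 0 hcs hsub (b := fun _ => 0)
      contDiff_const hc (fun _ _ => rfl) (hz c)
    have e : ∀ x ∈ tsupport c, flowDensity m g A ϑ ρ 0 (fun _ => 0) c x =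
        1 / 9 * (ρ x * (twist g A ϑ x ^ 2 - 16 * m ^ 2) * c x) := fun x hx => by
      rw [flowDensity, rotDensity_zero]; ring
    rw [setIntegral_congr_fun (IsCompact.measurableSet hcs) e, integral_const_mul] at h1
    exact (mul_eq_zero.1 h1).resolve_left (by norm_num)

/-- The argument for the full equations, with test functions pulled back from U and integrals over
the slice x^3 = 0; independence of x^3 carries the result back to the cylinder. -/
theorem IsSpecialSolution.eulerLagrange (h : IsSpecialSolution U m g A ϑ ρ) (hU : IsOpen U)
    (hUc : IsPreconnected U) (hbg : IsSpecialBackground U g A σ) (hs : IsSpecialState U g ϑ ρ)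
    (hm : m ≠ 0) : EulerLagrange U m g A ϑ ρ 1 ∨ EulerLagrange U m g A ϑ ρ (-1) := by
  have hz : ∀ b : (Fin 3 → ℝ) → ℝ, ∀ x ∉ tsupport b, b x = 0 := fun b x hx =>
    image_eq_zero_of_notMem_tsupport hx
  refine eulerLagrange_of_sign (fun κ hκ htw k => ?_)
    (exists_twist_sign hU hUc hbg hs hm ?_)
  · refine divergence_of_weak_col hU hbg hs k fun b hb hcs hsub => ?_
    have h1 := h.setIntegral_flowDensity hU hbg hs hm k hcs hsub hb (c := fun _ => 0)
      contDiff_const (hz b) (fun _ _ => rfl)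
    have e : ∀ u ∈ tsupport b, flowDensity m g A ϑ ρ k (fun x => b (base x)) (fun _ => 0)
        (col u 0) = 8 / 9 * κ * m *
          rotDensity g A ϑ ρ (singleParam k fun x => b (base x)) (col u 0) := fun u hu => by
      rw [flowDensity, htw _ (col_mem_cyl (hsub hu) 0)]; ring
    rw [setIntegral_congr_fun (IsCompact.measurableSet hcs) e, integral_const_mul] at h1
    exact (mul_eq_zero.1 h1).resolve_left
      (mul_ne_zero (mul_ne_zero (by norm_num) hκ) hm)
  · have key : ∀ u ∈ U, ρ (col u 0) * (twist g A ϑ (col u 0) ^ 2 - 16 * m ^ 2) = 0 := by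
      refine eq_zero_of_weak hU (contDiffOn_comp_col (contDiffOn_mass hU hbg hs) 0)
        fun c hc hcs hsub => ?_
      have h1 := h.setIntegral_flowDensity hU hbg hs hm 0 hcs hsub (b := fun _ => 0)
        contDiff_const hc (fun _ _ => rfl) (hz c)
      have e : ∀ u ∈ tsupport c, flowDensity m g A ϑ ρ 0 (fun _ => 0) (fun x => c (base x))
          (col u 0) = 1 / 9 * (ρ (col u 0) * (twist g A ϑ (col u 0) ^ 2 - 16 * m ^ 2) * c u) :=
        fun u hu => by
          rw [flowDensity, rotDensity_zero, base_col]; ring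
      rw [setIntegral_congr_fun (IsCompact.measurableSet hcs) e, integral_const_mul] at h1
      exact (mul_eq_zero.1 h1).resolve_left (by norm_num)
    intro x hx
    rw [hs.indep_density.eq_col hx 0, (twist_indep hU hbg hs).eq_col hx 0]
    exact key _ hx

theorem isSolution_iff (hU : IsOpen U) (hUc : IsPreconnected U)
    (hbg : IsSpecialBackground U g A σ) (hs : IsSpecialState U g ϑ ρ) (hm : m ≠ 0) :
    IsSolution (cyl U) m g A ϑ ρ ↔
      EulerLagrange U m g A ϑ ρ 1 ∨ EulerLagrange U m g A ϑ ρ (-1) :=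
  ⟨fun h => h.eulerLagrange hU hUc hbg hs hm, fun h => h.elim
    (fun h => h.isSolution hU hbg hs hm (by norm_num))
    (fun h => h.isSolution hU hbg hs hm (by norm_num))⟩

theorem isSpecialSolution_iff (hU : IsOpen U) (hUc : IsPreconnected U)
    (hbg : IsSpecialBackground U g A σ) (hs : IsSpecialState U g ϑ ρ) (hm : m ≠ 0) :
    IsSpecialSolution U m g A ϑ ρ ↔
      EulerLagrange U m g A ϑ ρ 1 ∨ EulerLagrange U m g A ϑ ρ (-1) :=
  ⟨fun h => h.eulerLagrange hU hUc hbg hs hm, fun h => h.elim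
    (fun h => h.isSpecialSolution hU hbg hs hm (by norm_num))
    (fun h => h.isSpecialSolution hU hbg hs hm (by norm_num))⟩

end FlowVariation

/-! ### The Levi-Civita connection in a frame -/

/-- Connection coefficients `ϕ^k_β ∇_α e_j^β`. -/
def connCoeff (g : MetricField) (ϕ : Coframe) (x : Fin 4 → ℝ) (α k j : Fin 4) : ℝ :=
  ∑ β, ϕ k x β * (pd α (fun z => dualFrame g ϕ z j β) x +
    ∑ γ, christoffel g x β α γ * dualFrame g ϕ x j γ)

/-- Connection coefficients with all indices in the frame. -/
def frameConn (g : MetricField) (ϕ : Coframe) (x : Fin 4 → ℝ) (i k j : Fin 4) : ℝ :=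
  ∑ α, dualFrame g ϕ x i α * connCoeff g ϕ x α k j

/-- A differentiable frame near a point. -/
structure SmoothFrameAt (g : MetricField) (ϕ : Coframe) (x : Fin 4 → ℝ) : Prop where
  frame : ∀ᶠ y in 𝓝 x, FrameAt g ϕ y
  coframe : ∀ j α, DifferentiableAt ℝ (fun y => ϕ j y α) x
  dual : ∀ j α, DifferentiableAt ℝ (fun y => dualFrame g ϕ y j α) x

namespace SmoothFrameAt

variable {g : MetricField} {ϕ : Coframe} {x : Fin 4 → ℝ}

theorem frameAt (h : SmoothFrameAt g ϕ x) : FrameAt g ϕ x := h.frame.self_of_nhds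

theorem pd_metric (h : SmoothFrameAt g ϕ x) (α γ δ : Fin 4) : pd α (fun z => g z γ δ) x =
    ∑ l, sgn l * (pd α (fun z => ϕ l z γ) x * ϕ l x δ + ϕ l x γ * pd α (fun z => ϕ l z δ) x) := by
  have e : (fun z => g z γ δ) =ᶠ[𝓝 x] fun z => ∑ l, sgn l * (ϕ l z γ * ϕ l z δ) := by
    filter_upwards [h.frame] with y hy
    rw [hy.metric]
    exact Finset.sum_congr rfl fun l _ => by ring
  rw [pd_congr e, pd_sum _ fun l _ =>
    ((h.coframe l γ).fun_mul (h.coframe l δ)).const_mul (sgn l)]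
  refine Finset.sum_congr rfl fun l _ => ?_
  rw [pd_const_mul _ ((h.coframe l γ).fun_mul (h.coframe l δ)),
    pd_mul (h.coframe l γ) (h.coframe l δ)]

theorem pd_metric_symm (h : SmoothFrameAt g ϕ x) (α γ δ : Fin 4) :
    pd α (fun z => g z γ δ) x = pd α (fun z => g z δ γ) x := by
  rw [h.pd_metric, h.pd_metric]
  exact Finset.sum_congr rfl fun l _ => by ring

/-- Differentiate the constant pairing ϕ^k(e_j). -/
theorem sum_pd_dual (h : SmoothFrameAt g ϕ x) (α k j : Fin 4) :
    ∑ β, ϕ k x β * pd α (fun z => dualFrame g ϕ z j β) x =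
      -∑ β, pd α (fun z => ϕ k z β) x * dualFrame g ϕ x j β := by
  have e : (fun z => ∑ β, ϕ k z β * dualFrame g ϕ z j β) =ᶠ[𝓝 x]
      fun _ => if k = j then 1 else 0 := by
    filter_upwards [h.frame] with y hy using hy.dual k j
  have h1 := pd_congr (α := α) e
  rw [pd_const, pd_sum _ fun β _ => (h.coframe k β).fun_mul (h.dual j β)] at h1
  rw [eq_neg_iff_add_eq_zero, ← Finset.sum_add_distrib, ← h1]
  refine Finset.sum_congr rfl fun β _ => ?_
  rw [pd_mul (h.coframe k β) (h.dual j β)]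
  ring

theorem christoffel_symm (h : SmoothFrameAt g ϕ x) (β α γ : Fin 4) :
    christoffel g x β α γ = christoffel g x β γ α := by
  rw [christoffel, christoffel]
  congr 1
  refine Finset.sum_congr rfl fun δ _ => ?_
  rw [h.pd_metric_symm δ α γ]
  ring

/-- This is ∇_{e_i}e_j − ∇_{e_j}e_i = [e_i, e_j] together with ϕ^k([e_i, e_j]) = −dϕ^k(e_i, e_j).
The Christoffel terms cancel by symmetry of Γ in its lower indices. -/
theorem torsion_free (h : SmoothFrameAt g ϕ x) (i k j : Fin 4) :
    frameConn g ϕ x i k j - frameConn g ϕ x j k i = -structCoeff g ϕ x k i j := by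
  have e : ∀ i j, frameConn g ϕ x i k j =
      -(∑ α, ∑ β, pd α (fun z => ϕ k z β) x * dualFrame g ϕ x i α * dualFrame g ϕ x j β) +
      ∑ α, ∑ γ, dualFrame g ϕ x i α * dualFrame g ϕ x j γ *
        ∑ β, ϕ k x β * christoffel g x β α γ := fun i j => by
    rw [frameConn, ← Finset.sum_neg_distrib, ← Finset.sum_add_distrib]
    refine Finset.sum_congr rfl fun α _ => ?_
    simp only [connCoeff, mul_add, Finset.sum_add_distrib]
    rw [h.sum_pd_dual]
    congr 1
    · rw [mul_neg, Finset.mul_sum]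
      congr 1
      exact Finset.sum_congr rfl fun _ _ => by ring
    · simp only [Finset.mul_sum]
      rw [Finset.sum_comm]
      exact Finset.sum_congr rfl fun _ _ => Finset.sum_congr rfl fun _ _ => by ring
  have e2 : ∑ α, ∑ γ, dualFrame g ϕ x i α * dualFrame g ϕ x j γ *
        ∑ β, ϕ k x β * christoffel g x β α γ =
      ∑ α, ∑ γ, dualFrame g ϕ x j α * dualFrame g ϕ x i γ *
        ∑ β, ϕ k x β * christoffel g x β α γ := by
    rw [Finset.sum_comm]
    refine Finset.sum_congr rfl fun α _ => Finset.sum_congr rfl fun γ _ => ?_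
    simp only [h.christoffel_symm _ α γ]
    ring
  have e3 : ∑ α, ∑ β, pd α (fun z => ϕ k z β) x * dualFrame g ϕ x j α * dualFrame g ϕ x i β =
      ∑ α, ∑ β, pd β (fun z => ϕ k z α) x * dualFrame g ϕ x i α * dualFrame g ϕ x j β := by
    rw [Finset.sum_comm]
    exact Finset.sum_congr rfl fun _ _ => Finset.sum_congr rfl fun _ _ => by ring
  rw [e i j, e j i, e2, e3, structCoeff, frame2]
  simp only [dform, sub_mul, Finset.sum_sub_distrib]
  ring

theorem metric_lower (h : SmoothFrameAt g ϕ x) (k δ : Fin 4) :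
    ∑ β, sgn k * ϕ k x β * (g x)⁻¹ β δ = dualFrame g ϕ x k δ := by
  rw [dualFrame, Finset.mul_sum]
  refine Finset.sum_congr rfl fun β _ => ?_
  have : (g x)⁻¹ β δ = (g x)⁻¹ δ β := by
    rw [h.frameAt.inv_metric, h.frameAt.inv_metric]
    exact Finset.sum_congr rfl fun _ _ => by ring
  rw [this]; ring

/-- With the index k lowered, the Christoffel part becomes a symbol of the first kind. Adding the
same expression with k and j exchanged leaves (∂_α g)(e_j, e_k), and the product rule for g = Σ
sgn_l ϕ^l⊗ϕ^l cancels this against the derivatives of the coframe. -/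
theorem metric_compatible (h : SmoothFrameAt g ϕ x) (α k j : Fin 4) :
    sgn k * connCoeff g ϕ x α k j + sgn j * connCoeff g ϕ x α j k = 0 := by
  have e : ∀ k j, sgn k * connCoeff g ϕ x α k j =
      -(sgn k * ∑ β, pd α (fun z => ϕ k z β) x * dualFrame g ϕ x j β) +
      (1 / 2) * ∑ γ, ∑ δ, dualFrame g ϕ x j γ * dualFrame g ϕ x k δ *
        (pd α (fun z => g z γ δ) x + pd γ (fun z => g z α δ) x - pd δ (fun z => g z α γ) x) := by
    intro k j
    simp only [connCoeff, mul_add, Finset.sum_add_distrib]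
    rw [h.sum_pd_dual, mul_neg]
    congr 1
    simp only [christoffel, ← h.metric_lower k, Finset.mul_sum, Finset.sum_mul]
    rw [Finset.sum_comm]
    refine Finset.sum_congr rfl fun γ _ => ?_
    rw [Finset.sum_comm]
    exact Finset.sum_congr rfl fun δ _ => Finset.sum_congr rfl fun β _ => by ring
  have e2 : ∑ γ, ∑ δ, dualFrame g ϕ x k γ * dualFrame g ϕ x j δ *
        (pd α (fun z => g z γ δ) x + pd γ (fun z => g z α δ) x - pd δ (fun z => g z α γ) x) =
      ∑ γ, ∑ δ, dualFrame g ϕ x j γ * dualFrame g ϕ x k δ *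
        (pd α (fun z => g z γ δ) x - pd γ (fun z => g z α δ) x + pd δ (fun z => g z α γ) x) := by
    rw [Finset.sum_comm]
    refine Finset.sum_congr rfl fun γ _ => Finset.sum_congr rfl fun δ _ => ?_
    rw [h.pd_metric_symm α γ δ]
    ring
  have e3 : ∑ γ, ∑ δ, dualFrame g ϕ x j γ * dualFrame g ϕ x k δ * pd α (fun z => g z γ δ) x =
      sgn k * (∑ β, pd α (fun z => ϕ k z β) x * dualFrame g ϕ x j β) +
      sgn j * ∑ β, pd α (fun z => ϕ j z β) x * dualFrame g ϕ x k β := by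
    have e4 : ∑ γ, ∑ δ, dualFrame g ϕ x j γ * dualFrame g ϕ x k δ * pd α (fun z => g z γ δ) x =
        ∑ l, sgn l * ((∑ γ, pd α (fun z => ϕ l z γ) x * dualFrame g ϕ x j γ) *
          (∑ δ, ϕ l x δ * dualFrame g ϕ x k δ) + (∑ γ, ϕ l x γ * dualFrame g ϕ x j γ) *
          ∑ δ, pd α (fun z => ϕ l z δ) x * dualFrame g ϕ x k δ) := by
      simp only [Finset.sum_mul_sum]
      simp only [h.pd_metric, Finset.mul_sum, ← Finset.sum_add_distrib]
      rw [Finset.sum_congr rfl fun γ _ => Finset.sum_comm, Finset.sum_comm]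
      exact Finset.sum_congr rfl fun _ _ => Finset.sum_congr rfl fun _ _ =>
        Finset.sum_congr rfl fun _ _ => by ring
    rw [e4]
    simp only [h.frameAt.dual, mul_ite, ite_mul, mul_one, mul_zero, one_mul, zero_mul, mul_add,
      Finset.sum_add_distrib, Finset.sum_ite_eq', Finset.mem_univ, if_true]
  rw [e k j, e j k, e2]
  have e5 : (1 / 2 : ℝ) * ∑ γ, ∑ δ, dualFrame g ϕ x j γ * dualFrame g ϕ x k δ *
        (pd α (fun z => g z γ δ) x + pd γ (fun z => g z α δ) x - pd δ (fun z => g z α γ) x) +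
      (1 / 2) * ∑ γ, ∑ δ, dualFrame g ϕ x j γ * dualFrame g ϕ x k δ *
        (pd α (fun z => g z γ δ) x - pd γ (fun z => g z α δ) x + pd δ (fun z => g z α γ) x) =
      ∑ γ, ∑ δ, dualFrame g ϕ x j γ * dualFrame g ϕ x k δ * pd α (fun z => g z γ δ) x := by
    simp only [Finset.mul_sum, ← Finset.sum_add_distrib]
    exact Finset.sum_congr rfl fun _ _ => Finset.sum_congr rfl fun _ _ => by ring
  linarith

theorem frameConn_antisymm (h : SmoothFrameAt g ϕ x) (i k j : Fin 4) :
    sgn k * frameConn g ϕ x i k j + sgn j * frameConn g ϕ x i j k = 0 := by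
  simp only [frameConn, Finset.mul_sum, ← Finset.sum_add_distrib]
  refine Finset.sum_eq_zero fun α _ => ?_
  linear_combination dualFrame g ϕ x i α * h.metric_compatible α k j

end SmoothFrameAt

/-! ### The Lorentz transformation of a spinor -/

/-- The indefinite norm `|z^0|² - |z^1|²`. -/
def spinNorm (z : Fin 2 → ℂ) : ℝ :=
  (z 0).re * (z 0).re + (z 0).im * (z 0).im - (z 1).re * (z 1).re - (z 1).im * (z 1).im

/-- The quadratic map to `spinNorm z` times a Lorentz transformation preserving the last axis. -/
def spinMat (z : Fin 2 → ℂ) : Matrix (Fin 4) (Fin 4) ℝ :=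
  !![(z 0).re * (z 0).re + (z 0).im * (z 0).im + (z 1).re * (z 1).re + (z 1).im * (z 1).im,
      2 * ((z 0).re * (z 1).re + (z 0).im * (z 1).im),
      2 * ((z 0).re * (z 1).im - (z 0).im * (z 1).re), 0;
    2 * ((z 0).re * (z 1).re - (z 0).im * (z 1).im),
      (z 0).re * (z 0).re - (z 0).im * (z 0).im + (z 1).re * (z 1).re - (z 1).im * (z 1).im,
      2 * ((z 1).re * (z 1).im - (z 0).re * (z 0).im), 0;
    2 * ((z 0).re * (z 1).im + (z 0).im * (z 1).re),
      2 * ((z 0).re * (z 0).im + (z 1).re * (z 1).im),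
      (z 0).re * (z 0).re - (z 0).im * (z 0).im - (z 1).re * (z 1).re + (z 1).im * (z 1).im, 0;
    0, 0, 0,
      (z 0).re * (z 0).re + (z 0).im * (z 0).im - (z 1).re * (z 1).re - (z 1).im * (z 1).im]

/-- The Lorentz transformation of a spinor of nonzero norm. -/
def spinRot (z : Fin 2 → ℂ) : Matrix (Fin 4) (Fin 4) ℝ := fun i j => spinMat z i j / spinNorm z

/-- The polarization of `spinMat`. -/
def spinMatPolar (z w : Fin 2 → ℂ) (i j : Fin 4) : ℝ :=
  spinMat (z + w) i j - spinMat z i j - spinMat w i j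

/-- The polarization of `spinNorm`. -/
def spinNormPolar (z w : Fin 2 → ℂ) : ℝ := spinNorm (z + w) - spinNorm z - spinNorm w

/-- The entries of `spinMat` are quadratic in z, so this is a polynomial identity of degree four;
dividing by N² makes `spinRot` a Lorentz matrix. -/
theorem spinMat_lorentz (z : Fin 2 → ℂ) (k l : Fin 4) :
    ∑ j, sgn j * spinMat z j k * spinMat z j l = if k = l then sgn k * spinNorm z ^ 2 else 0 := by
  rw [Fin.sum_univ_four]
  fin_cases k <;> fin_cases l <;> simp [spinMat, sgn, spinNorm] <;> ring

theorem spinRot_lorentz {z : Fin 2 → ℂ} (hz : spinNorm z ≠ 0) (k l : Fin 4) :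
    ∑ j, sgn j * spinRot z j k * spinRot z j l = if k = l then sgn k else 0 := by
  have h := spinMat_lorentz z k l
  have e : ∑ j, sgn j * spinRot z j k * spinRot z j l =
      (∑ j, sgn j * spinMat z j k * spinMat z j l) / spinNorm z ^ 2 := by
    rw [Finset.sum_div]
    refine Finset.sum_congr rfl fun j _ => ?_
    simp only [spinRot]
    field_simp
  rw [e, h]
  split_ifs
  · field_simp
  · simp

theorem spinRot_three {z : Fin 2 → ℂ} (hz : spinNorm z ≠ 0) (j : Fin 4) :
    spinRot z 3 j = if j = 3 then 1 else 0 := by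
  fin_cases j <;> simp [spinRot, spinMat]
  exact div_self hz

/-- The contraction of the cofactors of `spinMat` with an antisymmetric form. -/
theorem spinMat_cofactor (z : Fin 2 → ℂ) {X : Fin 4 → Fin 4 → ℝ} (hX : ∀ p q, X p q = -X q p) :
    (∑ p, ∑ q, sgn p * spinMat z 1 p * (sgn q * spinMat z 2 q) * X p q =
      spinNorm z * (spinMat z 0 0 * X 1 2 + spinMat z 0 1 * X 2 0 + spinMat z 0 2 * X 0 1)) ∧
    (∑ p, ∑ q, sgn p * spinMat z 2 p * (sgn q * spinMat z 0 q) * X p q =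
      -(spinNorm z * (spinMat z 1 0 * X 1 2 + spinMat z 1 1 * X 2 0 + spinMat z 1 2 * X 0 1))) ∧
    (∑ p, ∑ q, sgn p * spinMat z 0 p * (sgn q * spinMat z 1 q) * X p q =
      -(spinNorm z * (spinMat z 2 0 * X 1 2 + spinMat z 2 1 * X 2 0 + spinMat z 2 2 * X 0 1))) := by
  have h0 : ∀ p, X p p = 0 := fun p => by linarith [hX p p]
  have h1 := hX 1 0
  have h2 := hX 0 2
  have h3 := hX 2 1
  refine ⟨?_, ?_, ?_⟩ <;>
  · simp only [Fin.sum_univ_four, h0, h1, h2, h3]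
    simp [spinMat, spinNorm, sgn]
    ring

theorem hasDerivAt_spinNorm {z : ℝ → Fin 2 → ℂ} {z' : Fin 2 → ℂ} {t : ℝ}
    (h : HasDerivAt z z' t) : HasDerivAt (fun s => spinNorm (z s)) (spinNormPolar (z t) z') t := by
  have hz := hasDerivAt_pi.1 h
  have hr : ∀ a, HasDerivAt (fun s => (z s a).re) (z' a).re t := fun a =>
    Complex.reCLM.hasFDerivAt.comp_hasDerivAt t (hz a)
  have hi : ∀ a, HasDerivAt (fun s => (z s a).im) (z' a).im t := fun a =>
    Complex.imCLM.hasFDerivAt.comp_hasDerivAt t (hz a)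
  refine HasDerivAt.congr_deriv (((((hr 0).fun_mul (hr 0)).fun_add ((hi 0).fun_mul (hi 0))).fun_sub
    ((hr 1).fun_mul (hr 1))).fun_sub ((hi 1).fun_mul (hi 1))) ?_
  simp [spinNormPolar, spinNorm]
  ring

theorem hasDerivAt_spinMat {z : ℝ → Fin 2 → ℂ} {z' : Fin 2 → ℂ} {t : ℝ}
    (h : HasDerivAt z z' t) (i j : Fin 4) :
    HasDerivAt (fun s => spinMat (z s) i j) (spinMatPolar (z t) z' i j) t := by
  have hz := hasDerivAt_pi.1 h
  have hr : ∀ a, HasDerivAt (fun s => (z s a).re) (z' a).re t := fun a =>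
    Complex.reCLM.hasFDerivAt.comp_hasDerivAt t (hz a)
  have hi : ∀ a, HasDerivAt (fun s => (z s a).im) (z' a).im t := fun a =>
    Complex.imCLM.hasFDerivAt.comp_hasDerivAt t (hz a)
  have aa := (hr 0).fun_mul (hr 0)
  have bb := (hi 0).fun_mul (hi 0)
  have cc := (hr 1).fun_mul (hr 1)
  have dd := (hi 1).fun_mul (hi 1)
  have ab := (hr 0).fun_mul (hi 0)
  have ac := (hr 0).fun_mul (hr 1)
  have ad := (hr 0).fun_mul (hi 1)
  have bc := (hi 0).fun_mul (hr 1)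
  have bd := (hi 0).fun_mul (hi 1)
  have cd := (hr 1).fun_mul (hi 1)
  fin_cases i <;> fin_cases j <;> simp [spinMatPolar, spinMat]
  · exact (((aa.fun_add bb).fun_add cc).fun_add dd).congr_deriv (by ring)
  · exact ((ac.fun_add bd).const_mul 2).congr_deriv (by ring)
  · exact ((ad.fun_sub bc).const_mul 2).congr_deriv (by ring)
  · exact hasDerivAt_const _ _
  · exact ((ac.fun_sub bd).const_mul 2).congr_deriv (by ring)
  · exact (((aa.fun_sub bb).fun_add cc).fun_sub dd).congr_deriv (by ring)
  · exact ((cd.fun_sub ab).const_mul 2).congr_deriv (by ring)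
  · exact hasDerivAt_const _ _
  · exact ((ad.fun_add bc).const_mul 2).congr_deriv (by ring)
  · exact ((ab.fun_add cd).const_mul 2).congr_deriv (by ring)
  · exact (((aa.fun_sub bb).fun_sub cc).fun_add dd).congr_deriv (by ring)
  · exact hasDerivAt_const _ _
  · exact hasDerivAt_const _ _
  · exact hasDerivAt_const _ _
  · exact hasDerivAt_const _ _
  · exact (((aa.fun_add bb).fun_sub cc).fun_sub dd).congr_deriv (by ring)

/-- The derivative of `spinRot`. -/
def spinRotDeriv (z w : Fin 2 → ℂ) (i j : Fin 4) : ℝ :=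
  (spinMatPolar z w i j * spinNorm z - spinMat z i j * spinNormPolar z w) / spinNorm z ^ 2

theorem hasDerivAt_spinRot {z : ℝ → Fin 2 → ℂ} {z' : Fin 2 → ℂ} {t : ℝ}
    (h : HasDerivAt z z' t) (hz : spinNorm (z t) ≠ 0) (i j : Fin 4) :
    HasDerivAt (fun s => spinRot (z s) i j) (spinRotDeriv (z t) z' i j) t :=
  (hasDerivAt_spinMat h i j).fun_div (hasDerivAt_spinNorm h) hz

/-- The flat Pauli matrices. -/
def flatPauli (i : Fin 4) : Matrix (Fin 2) (Fin 2) ℂ :=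
  ![!![1, 0; 0, 1], !![0, 1; 1, 0], !![0, Complex.I; -Complex.I, 0], !![1, 0; 0, -1]] i

/-- The imaginary part of `z̄^ḃ s_{a ḃ} w^a`. -/
def imPair (i : Fin 4) (z w : Fin 2 → ℂ) : ℝ :=
  (∑ a, ∑ b, star (z b) * flatPauli i a b * w a).im

/-- The derivative of the normalising factor 1/N is multiplied by the product of two different
columns, which are orthogonal. -/
theorem sum_spinRot_mul_deriv {z : Fin 2 → ℂ} (hz : spinNorm z ≠ 0) (w : Fin 2 → ℂ) {r q : Fin 4}
    (hrq : r ≠ q) : ∑ i, sgn i * spinRot z i r * spinRotDeriv z w i q =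
      (∑ i, sgn i * spinMat z i r * spinMatPolar z w i q) / spinNorm z ^ 2 := by
  have h := spinMat_lorentz z r q
  rw [if_neg hrq] at h
  have e : ∑ i, sgn i * spinRot z i r * spinRotDeriv z w i q =
      (∑ i, sgn i * spinMat z i r * spinMatPolar z w i q) / spinNorm z ^ 2 -
      (∑ i, sgn i * spinMat z i r * spinMat z i q) * (spinNormPolar z w / spinNorm z ^ 3) := by
    rw [Finset.sum_div, Finset.sum_mul, ← Finset.sum_sub_distrib]
    refine Finset.sum_congr rfl fun i _ => ?_
    simp only [spinRot, spinRotDeriv]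
    field_simp
  rw [e, h, zero_mul, sub_zero]

/-- The logarithmic derivative of `spinRot`. -/
theorem spinRot_log_deriv {z : Fin 2 → ℂ} (hz : spinNorm z ≠ 0) (w : Fin 2 → ℂ) :
    (∑ i, sgn i * spinRot z i 0 * spinRotDeriv z w i 1 = -(2 * imPair 2 z w / spinNorm z) ∧
      ∑ i, sgn i * spinRot z i 1 * spinRotDeriv z w i 0 = 2 * imPair 2 z w / spinNorm z) ∧
    (∑ i, sgn i * spinRot z i 0 * spinRotDeriv z w i 2 = 2 * imPair 1 z w / spinNorm z ∧
      ∑ i, sgn i * spinRot z i 2 * spinRotDeriv z w i 0 = -(2 * imPair 1 z w / spinNorm z)) ∧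
    (∑ i, sgn i * spinRot z i 1 * spinRotDeriv z w i 2 = 2 * imPair 0 z w / spinNorm z ∧
      ∑ i, sgn i * spinRot z i 2 * spinRotDeriv z w i 1 = -(2 * imPair 0 z w / spinNorm z)) := by
  refine ⟨⟨?_, ?_⟩, ⟨?_, ?_⟩, ?_, ?_⟩ <;>
  · rw [sum_spinRot_mul_deriv hz w (by decide), div_eq_iff (pow_ne_zero 2 hz)]
    have : ∀ u : ℝ, u / spinNorm z * spinNorm z ^ 2 = u * spinNorm z := fun u => by field_simp
    simp only [neg_mul, this]
    simp [Fin.sum_univ_four, spinMatPolar, spinMat, spinNorm, sgn, imPair, flatPauli]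
    ring

/-! ### Coframes obtained from a given one by a position-dependent transformation -/

/-- The coframe `Λ^j_k ϕ^k`. -/
def mulFrame (Λ : (Fin 4 → ℝ) → Matrix (Fin 4) (Fin 4) ℝ) (ϕ : Coframe) : Coframe := fun j x α =>
  ∑ k, Λ x j k * ϕ k x α

section MulFrame

variable {g : MetricField} {A : CovField 4} {ϕ : Coframe}
  {Λ : (Fin 4 → ℝ) → Matrix (Fin 4) (Fin 4) ℝ} {x : Fin 4 → ℝ}

/-- Raising an index is linear in the coframe; the signs only convert raised covectors into dual
vectors and back. -/
theorem dualFrame_mulFrame (k α : Fin 4) : dualFrame g (mulFrame Λ ϕ) x k α =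
    ∑ p, sgn k * (sgn p * Λ x k p) * dualFrame g ϕ x p α := by
  simp only [dualFrame, mulFrame, Finset.mul_sum]
  rw [Finset.sum_comm]
  refine Finset.sum_congr rfl fun p _ => Finset.sum_congr rfl fun β _ => ?_
  linear_combination (-sgn k * Λ x k p * (g x)⁻¹ α β * ϕ p x β) * sgn_mul_self p

theorem framePot_mulFrame (k : Fin 4) : framePot g A (mulFrame Λ ϕ) x k =
    ∑ p, sgn k * (sgn p * Λ x k p) * framePot g A ϕ x p := by
  simp only [framePot, dualFrame_mulFrame, Finset.mul_sum]
  rw [Finset.sum_comm]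
  exact Finset.sum_congr rfl fun p _ => Finset.sum_congr rfl fun β _ => by ring

theorem frameAt_mulFrame (h : FrameAt g ϕ x)
    (hΛ : ∀ k l, ∑ j, sgn j * Λ x j k * Λ x j l = if k = l then sgn k else 0) :
    FrameAt g (mulFrame Λ ϕ) x := by
  refine ⟨h.det_ne, fun α β => ?_⟩
  have e : ∑ j, sgn j * mulFrame Λ ϕ j x α * mulFrame Λ ϕ j x β =
      ∑ k, ∑ l, (∑ j, sgn j * Λ x j k * Λ x j l) * (ϕ k x α * ϕ l x β) := by
    simp only [mulFrame, mul_assoc (sgn _), Finset.sum_mul_sum]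
    simp only [Finset.mul_sum, Finset.sum_mul]
    rw [Finset.sum_comm]
    refine Finset.sum_congr rfl fun k _ => ?_
    rw [Finset.sum_comm]
    exact Finset.sum_congr rfl fun l _ => Finset.sum_congr rfl fun j _ => by ring
  rw [e, h.metric]
  simp only [hΛ, ite_mul, zero_mul, Finset.sum_ite_eq, Finset.mem_univ, if_true]
  exact Finset.sum_congr rfl fun _ _ => by ring

theorem frame2_sum {n : ℕ} {e : Fin n → Fin n → ℝ} {f : Fin n → Fin n → ℝ} {M : Fin n → Fin n → ℝ}
    (he : ∀ k α, e k α = ∑ p, M k p * f p α) (b : Fin n → Fin n → ℝ) (k l : Fin n) :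
    frame2 e b k l = ∑ p, ∑ q, M k p * M l q * frame2 f b p q := by
  have h1 : ∀ α β, b α β * e k α * e l β =
      ∑ p, ∑ q, M k p * M l q * (b α β * f p α * f q β) := fun α β => by
    rw [mul_assoc, he, he, Finset.sum_mul_sum, Finset.mul_sum]
    refine Finset.sum_congr rfl fun p _ => ?_
    rw [Finset.mul_sum]
    exact Finset.sum_congr rfl fun q _ => by ring
  simp only [frame2, h1, Finset.mul_sum]
  rw [Finset.sum_congr rfl fun α _ => Finset.sum_comm, Finset.sum_comm]
  refine Finset.sum_congr rfl fun p _ => ?_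
  rw [Finset.sum_congr rfl fun α _ => Finset.sum_comm, Finset.sum_comm]

/-- This is d(Λ^i_n ϕ^n) = dΛ^i_n∧ϕ^n + Λ^i_n dϕ^n on two vectors of the frame dual to ϕ. -/
theorem frame2_dform_mulFrame (h : SmoothFrameAt g ϕ x)
    (hΛ : ∀ i q, DifferentiableAt ℝ (fun y => Λ y i q) x) (i k l : Fin 4) :
    frame2 (dualFrame g ϕ x) (dform (mulFrame Λ ϕ i) x) k l =
      frameDeriv g ϕ k (fun y => Λ y i l) x - frameDeriv g ϕ l (fun y => Λ y i k) x +
        ∑ n, Λ x i n * structCoeff g ϕ x n k l := by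
  have hp : ∀ α β, pd α (fun y => mulFrame Λ ϕ i y β) x =
      ∑ n, (pd α (fun y => Λ y i n) x * ϕ n x β + Λ x i n * pd α (fun y => ϕ n y β) x) :=
    fun α β => by
      have := pd_sum (α := α) Finset.univ fun n _ => (hΛ i n).fun_mul (h.coframe n β)
      refine Eq.trans this (Finset.sum_congr rfl fun n _ => pd_mul (hΛ i n) (h.coframe n β))
  have h1 : frame2 (dualFrame g ϕ x) (dform (mulFrame Λ ϕ i) x) k l =
      ∑ n, ((∑ α, dualFrame g ϕ x k α * pd α (fun y => Λ y i n) x) *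
          (∑ β, ϕ n x β * dualFrame g ϕ x l β) -
        (∑ α, ϕ n x α * dualFrame g ϕ x k α) *
          (∑ β, dualFrame g ϕ x l β * pd β (fun y => Λ y i n) x) +
        Λ x i n * structCoeff g ϕ x n k l) := by
    simp only [Finset.sum_mul_sum]
    simp only [frame2, structCoeff, dform, hp, Finset.mul_sum,
      ← Finset.sum_add_distrib, ← Finset.sum_sub_distrib]
    simp only [Finset.sum_mul]
    rw [Finset.sum_congr rfl fun α _ => Finset.sum_comm, Finset.sum_comm]
    refine Finset.sum_congr rfl fun n _ => Finset.sum_congr rfl fun α _ =>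
      Finset.sum_congr rfl fun β _ => ?_
    ring
  rw [h1]
  simp only [h.frameAt.dual, Finset.sum_add_distrib, Finset.sum_sub_distrib, mul_ite, ite_mul,
    mul_one, mul_zero, one_mul, zero_mul, Finset.sum_ite_eq', Finset.mem_univ, if_true]
  rfl

theorem structCoeff_mulFrame (i k l : Fin 4) : structCoeff g (mulFrame Λ ϕ) x i k l =
    sgn k * sgn l * ∑ p, ∑ q, sgn p * Λ x k p * (sgn q * Λ x l q) *
      frame2 (dualFrame g ϕ x) (dform (mulFrame Λ ϕ i) x) p q := by
  rw [structCoeff, frame2_sum (M := fun k p => sgn k * (sgn p * Λ x k p))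
    (fun k α => dualFrame_mulFrame k α)]
  simp only [Finset.mul_sum]
  exact Finset.sum_congr rfl fun p _ => Finset.sum_congr rfl fun q _ => by ring

end MulFrame

/-! ### The twist of the coframe of a spinor field -/

section SpinFrame

variable {g : MetricField} {A : CovField 4} {ϕ : Coframe} {ξ : SpinorField} {x : Fin 4 → ℝ}

/-- The coframe of a spinor field relative to a given coframe. -/
def spinFrame (ϕ : Coframe) (ξ : SpinorField) : Coframe := mulFrame (fun y => spinRot (ξ y)) ϕ

/-- The derivative of a spinor field along a frame vector. -/
def spinDeriv (g : MetricField) (ϕ : Coframe) (k : Fin 4) (ξ : SpinorField) (x : Fin 4 → ℝ) :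
    Fin 2 → ℂ := fun a => ∑ α, (dualFrame g ϕ x k α : ℂ) * pd α (fun y => ξ y a) x

theorem frameDeriv_eq_fderiv (f : (Fin 4 → ℝ) → ℝ) (k : Fin 4) :
    frameDeriv g ϕ k f x = fderiv ℝ f x (dualFrame g ϕ x k) := by
  rw [← Finset.univ_sum_single (dualFrame g ϕ x k), map_sum, frameDeriv]
  refine Finset.sum_congr rfl fun α _ => ?_
  rw [pd, ← smul_eq_mul, ← map_smul, ← Pi.single_smul, smul_eq_mul, mul_one]

theorem spinDeriv_eq_fderiv (hξ : DifferentiableAt ℝ ξ x) (k : Fin 4) :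
    spinDeriv g ϕ k ξ x = fderiv ℝ ξ x (dualFrame g ϕ x k) := by
  funext a
  have h1 : fderiv ℝ (fun y => ξ y a) x (dualFrame g ϕ x k) =
      fderiv ℝ ξ x (dualFrame g ϕ x k) a := by
    have h2 : HasFDerivAt (fun y => ξ y a)
        ((ContinuousLinearMap.proj (R := ℝ) (φ := fun _ : Fin 2 => ℂ) a).comp (fderiv ℝ ξ x)) x :=
      hasFDerivAt_pi'.1 hξ.hasFDerivAt a
    rw [h2.fderiv]
    rfl
  rw [← h1, ← Finset.univ_sum_single (dualFrame g ϕ x k), map_sum, spinDeriv]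
  refine Finset.sum_congr rfl fun α _ => ?_
  rw [pd, ← Complex.real_smul, ← map_smul, ← Pi.single_smul, smul_eq_mul, mul_one]

theorem contDiff_spinMat (i j : Fin 4) : ContDiff ℝ ∞ fun z : Fin 2 → ℂ => spinMat z i j := by
  have hr : ∀ a, ContDiff ℝ ∞ fun z : Fin 2 → ℂ => (z a).re := fun a =>
    Complex.reCLM.contDiff.comp (contDiff_apply ℝ ℂ a)
  have hi : ∀ a, ContDiff ℝ ∞ fun z : Fin 2 → ℂ => (z a).im := fun a =>
    Complex.imCLM.contDiff.comp (contDiff_apply ℝ ℂ a)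
  have h0r := hr 0
  have h1r := hr 1
  have h0i := hi 0
  have h1i := hi 1
  fin_cases i <;> fin_cases j <;> simp [spinMat] <;> fun_prop

theorem contDiff_spinNorm : ContDiff ℝ ∞ spinNorm := by
  have h : spinNorm = fun z => spinMat z 3 3 := by funext z; simp [spinMat, spinNorm]
  rw [h]
  exact contDiff_spinMat 3 3

theorem contDiffAt_spinRot {z : Fin 2 → ℂ} (hz : spinNorm z ≠ 0) (i j : Fin 4) :
    ContDiffAt ℝ ∞ (fun z => spinRot z i j) z :=
  ContDiffAt.div (f := fun z => spinMat z i j) (contDiff_spinMat i j).contDiffAt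
    contDiff_spinNorm.contDiffAt hz

theorem differentiableAt_spinRot (hξ : DifferentiableAt ℝ ξ x) (hz : spinNorm (ξ x) ≠ 0)
    (i j : Fin 4) : DifferentiableAt ℝ (fun y => spinRot (ξ y) i j) x :=
  DifferentiableAt.comp x (g := fun z => spinRot z i j)
    ((contDiffAt_spinRot hz i j).differentiableAt (by simp)) hξ

/-- Restricting to the line x + t e_k reduces the chain rule to the one-variable formula for
`spinRot` along a curve. -/
theorem frameDeriv_spinRot (hξ : DifferentiableAt ℝ ξ x) (hz : spinNorm (ξ x) ≠ 0) (k i j : Fin 4) :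
    frameDeriv g ϕ k (fun y => spinRot (ξ y) i j) x =
      spinRotDeriv (ξ x) (spinDeriv g ϕ k ξ x) i j := by
  rw [frameDeriv_eq_fderiv, spinDeriv_eq_fderiv hξ]
  have h1 : HasDerivAt (fun t : ℝ => x + t • dualFrame g ϕ x k) (dualFrame g ϕ x k) 0 := by
    simpa using ((hasDerivAt_id (0 : ℝ)).smul_const (dualFrame g ϕ x k)).const_add x
  have e0 : x + (0 : ℝ) • dualFrame g ϕ x k = x := by simp
  have h2 : HasDerivAt (fun t : ℝ => ξ (x + t • dualFrame g ϕ x k))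
      (fderiv ℝ ξ x (dualFrame g ϕ x k)) 0 := by
    have h : HasFDerivAt ξ (fderiv ℝ ξ x) (x + (0 : ℝ) • dualFrame g ϕ x k) := by
      rw [e0]; exact hξ.hasFDerivAt
    exact h.comp_hasDerivAt 0 h1
  have h3 : HasDerivAt (fun t : ℝ => spinRot (ξ (x + t • dualFrame g ϕ x k)) i j)
      (fderiv ℝ (fun y => spinRot (ξ y) i j) x (dualFrame g ϕ x k)) 0 := by
    have h : HasFDerivAt (fun y => spinRot (ξ y) i j) (fderiv ℝ (fun y => spinRot (ξ y) i j) x)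
        (x + (0 : ℝ) • dualFrame g ϕ x k) := by
      rw [e0]; exact (differentiableAt_spinRot hξ hz i j).hasFDerivAt
    exact h.comp_hasDerivAt 0 h1
  have h4 := hasDerivAt_spinRot h2 (by rw [e0]; exact hz) i j
  rw [e0] at h4
  exact h3.unique h4

/-- The twist of the coframe of a spinor field. -/
theorem twist_spinFrame (h : SmoothFrameAt g ϕ x) (hξ : DifferentiableAt ℝ ξ x)
    (hz : spinNorm (ξ x) ≠ 0) : twist g A (spinFrame ϕ ξ) x =
      structCoeff g ϕ x 0 1 2 - structCoeff g ϕ x 1 2 0 - structCoeff g ϕ x 2 0 1 +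
      4 / spinNorm (ξ x) * (imPair 1 (ξ x) (spinDeriv g ϕ 1 ξ x) +
        imPair 2 (ξ x) (spinDeriv g ϕ 2 ξ x) - imPair 0 (ξ x) (spinDeriv g ϕ 0 ξ x)) +
      4 / spinNorm (ξ x) * ∑ p, sgn p * spinMat (ξ x) 0 p * framePot g A ϕ x p := by
  set X : Fin 4 → Fin 4 → Fin 4 → ℝ := fun i p q =>
    frame2 (dualFrame g ϕ x) (dform (spinFrame ϕ ξ i) x) p q with hX
  have hXa : ∀ i p q, X i p q = -X i q p := fun i p q => frame2_antisymm (dform_antisymm _ _) p q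
  have hXe : ∀ i p q, X i p q = spinRotDeriv (ξ x) (spinDeriv g ϕ p ξ x) i q -
      spinRotDeriv (ξ x) (spinDeriv g ϕ q ξ x) i p +
      ∑ n, spinRot (ξ x) i n * structCoeff g ϕ x n p q := fun i p q => by
    simp only [hX]
    rw [spinFrame, frame2_dform_mulFrame h (fun i q => differentiableAt_spinRot hξ hz i q),
      frameDeriv_spinRot hξ hz, frameDeriv_spinRot hξ hz]
  have hC : ∀ i k l, structCoeff g (spinFrame ϕ ξ) x i k l = sgn k * sgn l *
      (∑ p, ∑ q, sgn p * spinMat (ξ x) k p * (sgn q * spinMat (ξ x) l q) * X i p q) /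
        spinNorm (ξ x) ^ 2 := fun i k l => by
    rw [spinFrame, structCoeff_mulFrame, mul_div_assoc, Finset.sum_div]
    congr 1
    refine Finset.sum_congr rfl fun p _ => ?_
    rw [Finset.sum_div]
    refine Finset.sum_congr rfl fun q _ => ?_
    simp only [spinRot, hX, spinFrame]
    field_simp
  have hP : framePot g A (spinFrame ϕ ξ) x 0 =
      (∑ p, sgn p * spinMat (ξ x) 0 p * framePot g A ϕ x p) / spinNorm (ξ x) := by
    rw [spinFrame, framePot_mulFrame, Finset.sum_div]
    refine Finset.sum_congr rfl fun p _ => ?_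
    simp only [spinRot, sgn]
    simp
    field_simp
  -- The twist is a component of a 3-form, and Λ acts with determinant 1 on the directions 0, 1, 2.
  -- The cofactor identities therefore replace products of two rows by the remaining row, so that
  -- the component is evaluated on the frame of ϕ.
  rw [twist, hC, hC, hC, (spinMat_cofactor (ξ x) (hXa 0)).1, (spinMat_cofactor (ξ x) (hXa 1)).2.1,
    (spinMat_cofactor (ξ x) (hXa 2)).2.2, hP]
  have hs1 : sgn 1 * sgn 2 = 1 := by simp [sgn]
  have hs2 : sgn 2 * sgn 0 = -1 := by simp [sgn]
  have hs3 : sgn 0 * sgn 1 = -1 := by simp [sgn]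
  -- The part of dϑ^i containing dϕ is contracted to dϕ^r by orthogonality of the columns; the part
  -- containing dΛ becomes the logarithmic derivative of Λ.
  have key : ∀ r p q : Fin 4, ∑ i, sgn i * spinRot (ξ x) i r * X i p q =
      ∑ i, sgn i * spinRot (ξ x) i r * spinRotDeriv (ξ x) (spinDeriv g ϕ p ξ x) i q -
      ∑ i, sgn i * spinRot (ξ x) i r * spinRotDeriv (ξ x) (spinDeriv g ϕ q ξ x) i p +
      sgn r * structCoeff g ϕ x r p q := fun r p q => by
    have h1 : ∑ i, sgn i * spinRot (ξ x) i r * ∑ n, spinRot (ξ x) i n * structCoeff g ϕ x n p q =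
        ∑ n, (∑ i, sgn i * spinRot (ξ x) i r * spinRot (ξ x) i n) * structCoeff g ϕ x n p q := by
      simp only [Finset.mul_sum, Finset.sum_mul]
      rw [Finset.sum_comm]
      exact Finset.sum_congr rfl fun _ _ => Finset.sum_congr rfl fun _ _ => by ring
    simp only [spinRot_lorentz hz, ite_mul, zero_mul, Finset.sum_ite_eq, Finset.mem_univ,
      if_true] at h1
    simp only [hXe, mul_add, mul_sub, Finset.sum_add_distrib, Finset.sum_sub_distrib, h1]
  have k0 := key 0 1 2
  have k1 := key 1 2 0
  have k2 := key 2 0 1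
  -- The term i = 3 of the sums is absent, as Λ fixes the last axis.
  have h30 : spinRot (ξ x) 3 0 = 0 := by simp [spinRot_three hz]
  have h31 : spinRot (ξ x) 3 1 = 0 := by simp [spinRot_three hz]
  have h32 : spinRot (ξ x) 3 2 = 0 := by simp [spinRot_three hz]
  rw [(spinRot_log_deriv hz _).2.1.1, (spinRot_log_deriv hz _).1.1] at k0
  rw [(spinRot_log_deriv hz _).1.2, (spinRot_log_deriv hz _).2.2.1] at k1
  rw [(spinRot_log_deriv hz _).2.2.2, (spinRot_log_deriv hz _).2.1.2] at k2
  rw [Fin.sum_univ_four] at k0 k1 k2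
  rw [h30] at k0
  rw [h31] at k1
  rw [h32] at k2
  have hM : ∀ i j, spinMat (ξ x) i j = spinRot (ξ x) i j * spinNorm (ξ x) := fun i j => by
    simp only [spinRot]; field_simp
  have s0 : sgn 0 = 1 := rfl
  have s1 : sgn 1 = -1 := rfl
  have s2 : sgn 2 = -1 := rfl
  rw [s0, s1, s2] at k0 k1 k2
  have e3 : ∀ a b c d e f : ℝ, spinNorm (ξ x) * (a * spinNorm (ξ x) * d + b * spinNorm (ξ x) * e +
      c * spinNorm (ξ x) * f) / spinNorm (ξ x) ^ 2 = a * d + b * e + c * f :=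
    fun a b c d e f => by field_simp
  rw [hs1, hs2, hs3, ← mul_div_assoc, mul_div_right_comm 4]
  simp only [hM 0 0, hM 0 1, hM 0 2, hM 1 0, hM 1 1, hM 1 2, hM 2 0, hM 2 1, hM 2 2, one_mul,
    neg_mul, mul_neg, neg_neg, e3]
  linear_combination k0 + k1 + k2

end SpinFrame

/-! ### The coframe of a field of Pauli matrices -/

/-- Real coordinates of a Hermitian matrix in the basis of flat Pauli matrices. -/
def pauliCoord (S : Matrix (Fin 2) (Fin 2) ℂ) (j : Fin 4) : ℝ :=
  ![((S 0 0).re + (S 1 1).re) / 2, (S 0 1).re, (S 0 1).im, ((S 0 0).re - (S 1 1).re) / 2] j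

/-- A Hermitian 2×2 matrix has real diagonal and conjugate off-diagonal entries: four real numbers,
which are its coordinates. -/
theorem eq_sum_pauliCoord {S : Matrix (Fin 2) (Fin 2) ℂ} (hS : S.IsHermitian) (a b : Fin 2) :
    S a b = ∑ j, (pauliCoord S j : ℂ) * flatPauli j a b := by
  have h0 := hS.apply 0 0
  have h1 := hS.apply 1 1
  have h2 := hS.apply 1 0
  have h0i := congrArg Complex.im h0
  have h1i := congrArg Complex.im h1
  simp at h0i h1i
  have h0i' : (S 0 0).im = 0 := by linarith
  have h1i' : (S 1 1).im = 0 := by linarith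
  rw [Fin.sum_univ_four]
  fin_cases a <;> fin_cases b <;>
    refine Complex.ext ?_ ?_ <;> simp [pauliCoord, flatPauli, ← h2, h0i', h1i'] <;> ring

theorem spinUp_sum (c : Fin 4 → ℂ) (S : Fin 4 → Matrix (Fin 2) (Fin 2) ℂ)
    {T : Matrix (Fin 2) (Fin 2) ℂ} (h : ∀ a b, T a b = ∑ j, c j * S j a b) (a b : Fin 2) :
    spinUp T a b = ∑ j, c j * spinUp (S j) a b := by
  simp only [spinUp, Matrix.of_apply, h, Finset.mul_sum]
  rw [Finset.sum_congr rfl fun _ _ => Finset.sum_comm, Finset.sum_comm]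
  exact Finset.sum_congr rfl fun _ _ => Finset.sum_congr rfl fun _ _ =>
    Finset.sum_congr rfl fun _ _ => by ring

/-- The coframe consisting of the coordinates of the Pauli matrices. -/
def pauliCoframe (σ : PauliField) : Coframe := fun j x α => pauliCoord (σ α x) j

section Pauli

variable {M : Set (Fin 4 → ℝ)} {g : MetricField} {σ : PauliField} {x : Fin 4 → ℝ}

theorem IsPauli.eq_sum (h : IsPauli M g σ) (hx : x ∈ M) (α : Fin 4) (a b : Fin 2) :
    σ α x a b = ∑ j, (pauliCoframe σ j x α : ℂ) * flatPauli j a b :=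
  eq_sum_pauliCoord (h.hermitian α x hx) a b

/-- The real part of the (0,0) entry of the Clifford relation is the metric constraint, because
raising both spinor indices polarises the determinant, which has signature (+,−,−,−) on Hermitian
matrices. -/
theorem IsPauli.isCoframe (h : IsPauli M g σ) : IsCoframe M g (pauliCoframe σ) := by
  intro x hx α β
  have hc := h.clifford x hx α β 0 0
  simp only [spinUp, Matrix.of_apply, eps, h.eq_sum hx α, h.eq_sum hx β, Fin.sum_univ_four,
    Fin.sum_univ_two] at hc
  have := congrArg Complex.re hc
  simp [flatPauli] at this
  rw [Fin.sum_univ_four]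
  simp only [sgn]
  simp
  linarith

theorem IsPauli.contDiffOn_coframe (h : IsPauli M g σ) (j α : Fin 4) :
    ContDiffOn ℝ ∞ (fun x => pauliCoframe σ j x α) M := by
  have hr : ∀ a b, ContDiffOn ℝ ∞ (fun x => (σ α x a b).re) M := fun a b =>
    Complex.reCLM.contDiff.comp_contDiffOn (h.smooth α a b)
  have hi : ∀ a b, ContDiffOn ℝ ∞ (fun x => (σ α x a b).im) M := fun a b =>
    Complex.imCLM.contDiff.comp_contDiffOn (h.smooth α a b)
  fin_cases j
  · exact ((hr 0 0).add (hr 1 1)).div_const 2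
  · exact hr 0 1
  · exact hi 0 1
  · exact ((hr 0 0).sub (hr 1 1)).div_const 2

/-- Raising the tensor index turns the coefficients ϕ^j into sgn_j e_j; all position dependence now
sits in the real frame e_j, so only real functions have to be differentiated. -/
theorem IsPauli.sigmaUp_eq (h : IsPauli M g σ) (hx : x ∈ M) (α : Fin 4) (a b : Fin 2) :
    sigmaUp g σ α x a b =
      ∑ j, ((sgn j : ℂ) * flatPauli j a b) * (dualFrame g (pauliCoframe σ) x j α : ℂ) := by
  simp only [sigmaUp, Matrix.sum_apply, Matrix.smul_apply, smul_eq_mul, h.eq_sum hx _ a b,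
    dualFrame, Finset.mul_sum]
  rw [Finset.sum_comm]
  refine Finset.sum_congr rfl fun j _ => ?_
  push_cast
  simp only [Finset.mul_sum]
  refine Finset.sum_congr rfl fun β _ => ?_
  have : (sgn j : ℂ) * (sgn j : ℂ) = 1 := by exact_mod_cast sgn_mul_self j
  linear_combination (-((g x)⁻¹ α β : ℂ) * (pauliCoframe σ j x β : ℂ) * flatPauli j a b) * this

theorem IsLorentzMetric.smoothFrameAt (hM : IsOpen M) (hg : IsLorentzMetric M g) {ϕ : Coframe}
    (hϕ : ∀ j α, ContDiffOn ℝ ∞ (fun x => ϕ j x α) M) (hc : IsCoframe M g ϕ) (hx : x ∈ M) :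
    SmoothFrameAt g ϕ x where
  frame := by filter_upwards [hM.mem_nhds hx] with y hy using hc.frameAt hg hy
  coframe j α := ((hϕ j α).contDiffAt (hM.mem_nhds hx)).differentiableAt (by simp)
  dual j α :=
    ((contDiffOn_dualFrame hg hϕ j α).contDiffAt (hM.mem_nhds hx)).differentiableAt (by simp)

theorem pd_sum_mul_ofReal {n : ℕ} {ι : Type*} [Fintype ι] (c : ι → ℂ) {f : ι → (Fin n → ℝ) → ℝ}
    {x : Fin n → ℝ} (hf : ∀ j, DifferentiableAt ℝ (f j) x) (α : Fin n) :
    pd α (fun z => ∑ j, c j * (f j z : ℂ)) x = ∑ j, c j * ((pd α (f j) x : ℝ) : ℂ) := by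
  have h1 : ∀ j, HasFDerivAt (fun z => c j * (f j z : ℂ))
      (c j • Complex.ofRealCLM.comp (fderiv ℝ (f j) x)) x := fun j =>
    (Complex.ofRealCLM.hasFDerivAt.comp x (hf j).hasFDerivAt).const_mul (c j)
  have h2 : HasFDerivAt (fun z => ∑ j, c j * (f j z : ℂ)) _ x :=
    HasFDerivAt.fun_sum fun j _ => h1 j
  rw [pd, h2.fderiv]
  simp [pd]

/-- The matrix product `s_k^{a ċ} s_{j b ċ} z^b`. -/
def pauliPair (k j : Fin 4) (z : Fin 2 → ℂ) (a : Fin 2) : ℂ :=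
  ∑ c, ∑ b, spinUp (flatPauli k) a c * flatPauli j b c * z b

/-- The spinor connection in terms of the Levi-Civita connection in the frame. -/
theorem IsPauli.spinNabla_eq (h : IsPauli M g σ) (hM : IsOpen M) (hg : IsLorentzMetric M g)
    (hx : x ∈ M) (ξ : SpinorField) (α : Fin 4) (a : Fin 2) :
    spinNabla g σ α ξ x a = pd α (fun z => ξ z a) x + (1 / 4) * ∑ k, ∑ j,
      ((sgn j * connCoeff g (pauliCoframe σ) x α k j : ℝ) : ℂ) * pauliPair k j (ξ x) a := by
  have hs := hg.smoothFrameAt hM h.contDiffOn_coframe h.isCoframe hx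
  have h1 : ∀ β b c, pd α (fun z => sigmaUp g σ β z b c) x = ∑ j, ((sgn j : ℂ) * flatPauli j b c) *
      ((pd α (fun z => dualFrame g (pauliCoframe σ) z j β) x : ℝ) : ℂ) := fun β b c => by
    have e : (fun z => sigmaUp g σ β z b c) =ᶠ[𝓝 x] fun z =>
        ∑ j, ((sgn j : ℂ) * flatPauli j b c) * (dualFrame g (pauliCoframe σ) z j β : ℂ) := by
      filter_upwards [hM.mem_nhds hx] with y hy using h.sigmaUp_eq hy β b c
    rw [pd_congr e, pd_sum_mul_ofReal _ fun j => hs.dual j β]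
  have h2 : ∀ β b c, pd α (fun z => sigmaUp g σ β z b c) x +
      ∑ γ, (christoffel g x β α γ : ℂ) * sigmaUp g σ γ x b c =
      ∑ j, ((sgn j : ℂ) * flatPauli j b c) *
        ((pd α (fun z => dualFrame g (pauliCoframe σ) z j β) x +
          ∑ γ, christoffel g x β α γ * dualFrame g (pauliCoframe σ) x j γ : ℝ) : ℂ) :=
    fun β b c => by
      simp only [h1, h.sigmaUp_eq hx, Finset.mul_sum]
      rw [Finset.sum_comm, ← Finset.sum_add_distrib]
      refine Finset.sum_congr rfl fun j _ => ?_
      push_cast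
      rw [mul_add, Finset.mul_sum]
      congr 1
      exact Finset.sum_congr rfl fun γ _ => by ring
  rw [spinNabla]
  congr 2
  simp only [h2, connCoeff, pauliPair]
  have h3 : ∀ β a c, spinUp (σ β x) a c =
      ∑ k, (pauliCoframe σ k x β : ℂ) * spinUp (flatPauli k) a c := fun β a c =>
    spinUp_sum _ _ (h.eq_sum hx β) a c
  set D : Fin 4 → Fin 4 → ℝ := fun j β => pd α (fun z => dualFrame g (pauliCoframe σ) z j β) x +
          ∑ γ, christoffel g x β α γ * dualFrame g (pauliCoframe σ) x j γ with hD
  have hR : ∀ f : Fin 2 → Fin 2 → Fin 4 → Fin 4 → ℂ,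
      ∑ c, ∑ b, ∑ j, ∑ k, f c b j k = ∑ k, ∑ j, ∑ c, ∑ b, f c b j k := fun f => by
    have : ∀ c b, ∑ j, ∑ k, f c b j k = ∑ k, ∑ j, f c b j k := fun c b => Finset.sum_comm
    simp only [Fin.sum_univ_two, Finset.sum_add_distrib, this]
  set t : Fin 4 → Fin 4 → Fin 4 → Fin 2 → Fin 2 → ℂ := fun β k j c b =>
    (sgn j : ℂ) * ((pauliCoframe σ k x β : ℂ) * (D j β : ℂ)) *
      (spinUp (flatPauli k) a c * flatPauli j b c * ξ x b) with ht
  calc _ = ∑ β, ∑ k, ∑ j, ∑ c, ∑ b, t β k j c b := by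
        refine Finset.sum_congr rfl fun β _ => ?_
        rw [← hR fun c b j k => t β k j c b]
        refine Finset.sum_congr rfl fun c _ => Finset.sum_congr rfl fun b _ => ?_
        rw [h3, Finset.sum_mul_sum, Finset.sum_comm, Finset.sum_mul]
        simp only [Finset.sum_mul]
        refine Finset.sum_congr rfl fun j _ => Finset.sum_congr rfl fun k _ => ?_
        simp only [ht, hD]
        ring
    _ = ∑ k, ∑ j, ∑ β, ∑ c, ∑ b, t β k j c b := by
        rw [Finset.sum_comm]
        exact Finset.sum_congr rfl fun k _ => Finset.sum_comm
    _ = _ := by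
        refine Finset.sum_congr rfl fun k _ => Finset.sum_congr rfl fun j _ => ?_
        have h5 : ((sgn j * ∑ β, pauliCoframe σ k x β * D j β : ℝ) : ℂ) =
            ∑ β, (sgn j : ℂ) * ((pauliCoframe σ k x β : ℂ) * (D j β : ℂ)) := by
          push_cast
          rw [Finset.mul_sum]
        refine Eq.trans ?_ (congrArg (· * _) h5).symm
        simp only [ht, Finset.mul_sum, Finset.sum_mul]
        rw [Finset.sum_comm]
        exact Finset.sum_congr rfl fun c _ => Finset.sum_comm

end Pauli

/-- The contribution of a metric torsion-free connection to the Dirac Lagrangian. -/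
theorem sum_conn_imPair {W : Fin 4 → Fin 4 → Fin 4 → ℝ} {C : Fin 4 → Fin 4 → Fin 4 → ℝ}
    (ha : ∀ i k j, sgn k * W i k j + sgn j * W i j k = 0)
    (ht : ∀ i k j, W i k j - W j k i = -C k i j) (hC : ∀ i j, C 3 i j = 0) (z : Fin 2 → ℂ) :
    ∑ i : Fin 3, sgn i.castSucc * ∑ k, ∑ j, sgn j * W i.castSucc k j *
      imPair i.castSucc z (pauliPair k j z) =
      -(spinNorm z * (C 0 1 2 - C 1 2 0 - C 2 0 1)) := by
  have s0 : sgn 0 = 1 := rfl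
  have s1 : sgn 1 = -1 := rfl
  have s2 : sgn 2 = -1 := rfl
  have s3 : sgn 3 = -1 := rfl
  have hd : ∀ i k, W i k k = 0 := fun i k => by
    have := ha i k k
    have h2 := sgn_mul_self k
    have h3 : sgn k ≠ 0 := fun h => by simp [h] at h2
    have h4 : sgn k * W i k k = 0 := by linarith
    exact (mul_eq_zero.1 h4).resolve_left h3
  have a10 : ∀ i, W i 1 0 = W i 0 1 := fun i => by have := ha i 0 1; rw [s0, s1] at this; linarith
  have a20 : ∀ i, W i 2 0 = W i 0 2 := fun i => by have := ha i 0 2; rw [s0, s2] at this; linarith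
  have a30 : ∀ i, W i 3 0 = W i 0 3 := fun i => by have := ha i 0 3; rw [s0, s3] at this; linarith
  have a21 : ∀ i, W i 2 1 = -W i 1 2 := fun i => by have := ha i 1 2; rw [s1, s2] at this; linarith
  have a31 : ∀ i, W i 3 1 = -W i 1 3 := fun i => by have := ha i 1 3; rw [s1, s3] at this; linarith
  have a32 : ∀ i, W i 3 2 = -W i 2 3 := fun i => by have := ha i 2 3; rw [s2, s3] at this; linarith
  have t1 := ht 1 0 2
  have t2 := ht 2 1 0
  have t3 := ht 0 2 1
  -- Since C^3 = 0, the connection coefficients towards the index 3 form a symmetric tensor in the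
  -- directions 0, 1, 2. Symmetric parts, trace included, contribute nothing to the imaginary part.
  have u1 := ht 0 3 1
  have u2 := ht 0 3 2
  have u3 := ht 1 3 2
  rw [hC] at u1 u2 u3
  rw [a10] at t2
  rw [a21, a20] at t3
  rw [a31, a30] at u1
  rw [a32, a30] at u2
  rw [a32, a31] at u3
  have c1 : C 0 1 2 = W 2 0 1 - W 1 0 2 := by linarith
  have c2 : C 1 2 0 = W 0 1 2 - W 2 0 1 := by linarith
  have c3 : C 2 0 1 = W 1 0 2 + W 0 1 2 := by linarith
  have v1 : W 1 0 3 = -W 0 1 3 := by linarith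
  have v2 : W 2 0 3 = -W 0 2 3 := by linarith
  have v3 : W 2 1 3 = W 1 2 3 := by linarith
  rw [c1, c2, c3]
  simp [Fin.sum_univ_three, Fin.sum_univ_four, s0, s1, s2, s3, hd, a10, a20, a30, a21, a31,
    a32, v1, v2, v3, imPair, pauliPair, flatPauli, spinUp, eps, spinNorm]
  ring

/-! ### The Dirac Lagrangian in terms of the twist -/

theorem imPair_add (i : Fin 4) (z w w' : Fin 2 → ℂ) :
    imPair i z (fun a => w a + w' a) = imPair i z w + imPair i z w' := by
  simp only [imPair, mul_add, Finset.sum_add_distrib, Complex.add_im]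

theorem imPair_sum {ι : Type*} [Fintype ι] (i : Fin 4) (z : Fin 2 → ℂ) (c : ι → ℝ)
    (w : ι → Fin 2 → ℂ) :
    imPair i z (fun a => ∑ k, (c k : ℂ) * w k a) = ∑ k, c k * imPair i z (w k) := by
  have e : ∑ a, ∑ b, star (z b) * flatPauli i a b * ∑ k, (c k : ℂ) * w k a =
      ∑ k, (c k : ℂ) * ∑ a, ∑ b, star (z b) * flatPauli i a b * w k a := by
    simp only [Finset.mul_sum]
    rw [Finset.sum_congr rfl fun _ _ => Finset.sum_comm, Finset.sum_comm]
    exact Finset.sum_congr rfl fun _ _ => Finset.sum_congr rfl fun _ _ =>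
      Finset.sum_congr rfl fun _ _ => by ring
  simp only [imPair, e, Complex.im_sum, Complex.im_ofReal_mul]

/-- For Hermitian S the second sum is the conjugate of the first, and (i/2)(q − q̄) = −Im q. -/
theorem re_kinetic {S : Matrix (Fin 2) (Fin 2) ℂ} (hS : S.IsHermitian) (z w : Fin 2 → ℂ) :
    (∑ a, ∑ b, (Complex.I / 2) * (star (z b) * S a b * w a - z a * S a b * star (w b))).re =
      -(∑ a, ∑ b, star (z b) * S a b * w a).im := by
  have e : ∑ a, ∑ b, z a * S a b * star (w b) = star (∑ a, ∑ b, star (z b) * S a b * w a) := by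
    simp only [star_sum, star_mul', star_star, hS.apply]
    rw [Finset.sum_comm]
  simp only [← Finset.mul_sum, Finset.sum_sub_distrib, e]
  simp
  ring

/-- The real part of `z^a s_{a ḃ} z̄^ḃ`. -/
theorem re_flatPauli (z : Fin 2 → ℂ) (j : Fin 3) :
    (∑ a, ∑ b, z a * flatPauli j.castSucc a b * star (z b)).re = spinMat z 0 j.castSucc := by
  fin_cases j <;> simp [flatPauli, spinMat] <;> ring

variable {U : Set (Fin 3 → ℝ)} {ε m : ℝ} {g : MetricField} {A : CovField 4} {σ : PauliField}
  {ξ : SpinorField} {x : Fin 4 → ℝ}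

/-- As σ_3 = diag(1,−1), the component ϕ^j_3 is 1 for j = 3 and 0 otherwise; hence g_{α3} = −ϕ^3_α,
and the block form of g determines ϕ^3. -/
theorem IsSpecialBackground.pauliCoframe_three (hbg : IsSpecialBackground U g A σ)
    (hx : x ∈ cyl U) : pauliCoframe σ 3 x = Pi.single 3 1 := by
  funext α
  have h1 := hbg.pauli.isCoframe x hx α 3
  rw [hbg.metric_three hx, Fin.sum_univ_four] at h1
  simp [sgn, pauliCoframe, pauliCoord, hbg.pauli_third x hx] at h1
  simp only [pauliCoframe, pauliCoord]
  simp
  linarith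

theorem IsSpecialBackground.smoothFrameAt_pauli (hU : IsOpen U)
    (hbg : IsSpecialBackground U g A σ) (hx : x ∈ cyl U) : SmoothFrameAt g (pauliCoframe σ) x :=
  hbg.metric.smoothFrameAt (isOpen_cyl hU) hbg.pauli.contDiffOn_coframe hbg.pauli.isCoframe hx

theorem IsSpecialBackground.structCoeff_pauli_three (hU : IsOpen U)
    (hbg : IsSpecialBackground U g A σ) (hx : x ∈ cyl U) (i j : Fin 4) :
    structCoeff g (pauliCoframe σ) x 3 i j = 0 := by
  have e : ∀ β, (fun z => pauliCoframe σ 3 z β) =ᶠ[𝓝 x]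
      fun _ => (Pi.single 3 1 : Fin 4 → ℝ) β := fun β => by
    filter_upwards [(isOpen_cyl hU).mem_nhds hx] with y hy
    rw [hbg.pauliCoframe_three hy]
  simp [structCoeff, frame2, dform, pd_congr (e _), pd_const]

theorem IsSpecialBackground.dualFrame_pauli_castSucc (hbg : IsSpecialBackground U g A σ)
    (hx : x ∈ cyl U) (j : Fin 3) : dualFrame g (pauliCoframe σ) x j.castSucc 3 = 0 := by
  have h3 : (3 : Fin 4) ≠ j.castSucc := (Fin.castSucc_lt_last j).ne'
  rw [IsSpecialBackground.dualFrame_last (hbg.pauli.isCoframe.frameAt hbg.metric hx)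
    (hbg.pauliCoframe_three hx), if_neg h3]

theorem IsSpecialBackground.dualFrame_pauli_three (hbg : IsSpecialBackground U g A σ)
    (hx : x ∈ cyl U) (α : Fin 3) : dualFrame g (pauliCoframe σ) x 3 α.castSucc = 0 := by
  have h3 : α.castSucc ≠ (3 : Fin 4) := (Fin.castSucc_lt_last α).ne
  rw [hbg.dualFrame_three hx (hbg.pauliCoframe_three hx), Pi.single_eq_of_ne h3]

/-- The vector e_3 has no components along the first three coordinates, so σ_3 does not occur in σ^α
for these α. -/
theorem IsSpecialBackground.sum_sigmaUp (hbg : IsSpecialBackground U g A σ) (hx : x ∈ cyl U)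
    (c : Fin 2 → Fin 2 → ℂ) (α : Fin 3) : ∑ a, ∑ b, sigmaUp g σ α.castSucc x a b * c a b =
      ∑ j : Fin 3, ((sgn j.castSucc * dualFrame g (pauliCoframe σ) x j.castSucc α.castSucc : ℝ) : ℂ) *
        ∑ a, ∑ b, flatPauli j.castSucc a b * c a b := by
  have h3 : dualFrame g (pauliCoframe σ) x (Fin.last 3) α.castSucc = 0 :=
    hbg.dualFrame_pauli_three hx α
  simp only [hbg.pauli.sigmaUp_eq hx]
  simp only [Fin.sum_univ_castSucc (n := 3), h3, Complex.ofReal_zero, mul_zero, add_zero]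
  simp only [Finset.mul_sum, Finset.sum_mul]
  rw [Finset.sum_congr rfl fun _ _ => Finset.sum_comm, Finset.sum_comm]
  refine Finset.sum_congr rfl fun _ _ => Finset.sum_congr rfl fun _ _ =>
      Finset.sum_congr rfl fun _ _ => ?_
  push_cast
  ring

theorem IsSpecialBackground.im_kinetic (hbg : IsSpecialBackground U g A σ) (hx : x ∈ cyl U)
    (w : Fin 2 → ℂ) (α : Fin 3) :
    (∑ a, ∑ b, star (ξ x b) * sigmaUp g σ α.castSucc x a b * w a).im =
      ∑ j : Fin 3, sgn j.castSucc * dualFrame g (pauliCoframe σ) x j.castSucc α.castSucc *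
        imPair j.castSucc (ξ x) w := by
  have h := hbg.sum_sigmaUp hx (fun a b => star (ξ x b) * w a) α
  have e : ∀ S : Matrix (Fin 2) (Fin 2) ℂ, ∑ a, ∑ b, star (ξ x b) * S a b * w a =
      ∑ a, ∑ b, S a b * (star (ξ x b) * w a) := fun S =>
    Finset.sum_congr rfl fun _ _ => Finset.sum_congr rfl fun _ _ => by ring
  rw [e, h, Complex.im_sum]
  refine Finset.sum_congr rfl fun j _ => ?_
  rw [Complex.im_ofReal_mul, imPair, e]

theorem IsSpecialBackground.re_current (hbg : IsSpecialBackground U g A σ) (hx : x ∈ cyl U)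
    (α : Fin 3) : (∑ a, ∑ b, ξ x a * sigmaUp g σ α.castSucc x a b * star (ξ x b)).re =
      ∑ j : Fin 3, sgn j.castSucc * dualFrame g (pauliCoframe σ) x j.castSucc α.castSucc *
        spinMat (ξ x) 0 j.castSucc := by
  have h := hbg.sum_sigmaUp hx (fun a b => ξ x a * star (ξ x b)) α
  have e : ∀ S : Matrix (Fin 2) (Fin 2) ℂ, ∑ a, ∑ b, ξ x a * S a b * star (ξ x b) =
      ∑ a, ∑ b, S a b * (ξ x a * star (ξ x b)) := fun S =>
    Finset.sum_congr rfl fun _ _ => Finset.sum_congr rfl fun _ _ => by ring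
  rw [e, h, Complex.re_sum]
  refine Finset.sum_congr rfl fun j _ => ?_
  rw [Complex.re_ofReal_mul, ← e, re_flatPauli]

/-- In frame components the kinetic term splits into derivatives along e_0, e_1, e_2 and a
connection part, which `sum_conn_imPair` reduces to the twist of ϕ without potential. Summing over
three coordinates loses nothing, as these frame vectors have no 3-component. -/
theorem IsSpecialBackground.sum_im_kinetic (hU : IsOpen U) (hbg : IsSpecialBackground U g A σ)
    (hx : x ∈ cyl U) :
    ∑ α : Fin 3, (∑ a, ∑ b, star (ξ x b) * sigmaUp g σ α.castSucc x a b *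
      spinNabla g σ α.castSucc ξ x a).im =
    imPair 0 (ξ x) (spinDeriv g (pauliCoframe σ) 0 ξ x) -
      imPair 1 (ξ x) (spinDeriv g (pauliCoframe σ) 1 ξ x) -
      imPair 2 (ξ x) (spinDeriv g (pauliCoframe σ) 2 ξ x) -
      spinNorm (ξ x) / 4 * (structCoeff g (pauliCoframe σ) x 0 1 2 -
        structCoeff g (pauliCoframe σ) x 1 2 0 - structCoeff g (pauliCoframe σ) x 2 0 1) := by
  have hs := hbg.smoothFrameAt_pauli hU hx
  have hconn := sum_conn_imPair hs.frameConn_antisymm hs.torsion_free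
    (hbg.structCoeff_pauli_three hU hx) (ξ x)
  set ϕ := pauliCoframe σ with hϕ
  have hN : ∀ α j, imPair j (ξ x) (spinNabla g σ α ξ x) =
      imPair j (ξ x) (fun a => pd α (fun z => ξ z a) x) +
        ∑ k, ∑ l, 1 / 4 * (sgn l * connCoeff g ϕ x α k l) *
          imPair j (ξ x) (pauliPair k l (ξ x)) := fun α j => by
    have e : spinNabla g σ α ξ x = fun a => pd α (fun z => ξ z a) x +
        ∑ p : Fin 4 × Fin 4, ((1 / 4 * (sgn p.2 * connCoeff g ϕ x α p.1 p.2) : ℝ) : ℂ) *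
          pauliPair p.1 p.2 (ξ x) a := by
      funext a
      rw [hbg.pauli.spinNabla_eq (isOpen_cyl hU) hbg.metric hx, Fintype.sum_prod_type,
        Finset.mul_sum]
      simp only [Finset.mul_sum]
      congr 1
      refine Finset.sum_congr rfl fun _ _ => Finset.sum_congr rfl fun _ _ => ?_
      push_cast
      ring
    rw [e, imPair_add, imPair_sum, Fintype.sum_prod_type]
  have hlast : ∀ (j : Fin 3) (f : Fin 4 → ℝ),
      ∑ α : Fin 3, dualFrame g ϕ x j.castSucc α.castSucc * f α.castSucc =
        ∑ α, dualFrame g ϕ x j.castSucc α * f α := fun j f => by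
    have : dualFrame g ϕ x j.castSucc (Fin.last 3) = 0 := hbg.dualFrame_pauli_castSucc hx j
    rw [Fin.sum_univ_castSucc (n := 3), this, zero_mul, add_zero]
  have hD : ∀ j, ∑ α, dualFrame g ϕ x j α * imPair j (ξ x) (spinNabla g σ α ξ x) =
      imPair j (ξ x) (spinDeriv g ϕ j ξ x) + 1 / 4 * ∑ k, ∑ l, sgn l * frameConn g ϕ x j k l *
        imPair j (ξ x) (pauliPair k l (ξ x)) := fun j => by
    have e1 := imPair_sum j (ξ x) (dualFrame g ϕ x j) (fun α a => pd α (fun z => ξ z a) x)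
    have e2 : imPair j (ξ x) (spinDeriv g ϕ j ξ x) = ∑ α, dualFrame g ϕ x j α *
      imPair j (ξ x) (fun a => pd α (fun z => ξ z a) x) := e1
    rw [e2]
    simp only [hN, mul_add, Finset.sum_add_distrib, frameConn]
    congr 1
    simp only [Finset.mul_sum, Finset.sum_mul]
    rw [Finset.sum_comm]
    refine Finset.sum_congr rfl fun k _ => ?_
    rw [Finset.sum_comm]
    exact Finset.sum_congr rfl fun l _ => Finset.sum_congr rfl fun α _ => by ring
  have h1 : ∑ α : Fin 3, (∑ a, ∑ b, star (ξ x b) * sigmaUp g σ α.castSucc x a b *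
      spinNabla g σ α.castSucc ξ x a).im = ∑ j : Fin 3, sgn j.castSucc *
        (imPair j.castSucc (ξ x) (spinDeriv g ϕ j.castSucc ξ x) + 1 / 4 * ∑ k, ∑ l,
          sgn l * frameConn g ϕ x j.castSucc k l *
            imPair j.castSucc (ξ x) (pauliPair k l (ξ x))) := by
    simp only [hbg.im_kinetic hx]
    rw [Finset.sum_comm]
    refine Finset.sum_congr rfl fun j _ => ?_
    rw [← hD, ← hlast, Finset.mul_sum]
    exact Finset.sum_congr rfl fun α _ => by rw [mul_assoc]
  rw [h1]
  simp only [mul_add, Finset.sum_add_distrib, mul_left_comm _ (1 / 4 : ℝ), ← Finset.mul_sum]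
  rw [hconn, Fin.sum_univ_three]
  simp [sgn]
  ring

theorem IsSpecialBackground.sum_re_current (hbg : IsSpecialBackground U g A σ) (hx : x ∈ cyl U) :
    ∑ α : Fin 3, A x α.castSucc *
      (∑ a, ∑ b, ξ x a * sigmaUp g σ α.castSucc x a b * star (ξ x b)).re =
    ∑ p, sgn p * spinMat (ξ x) 0 p * framePot g A (pauliCoframe σ) x p := by
  have h3 : spinMat (ξ x) 0 (Fin.last 3) = 0 := rfl
  rw [Fin.sum_univ_castSucc (n := 3), h3, mul_zero, zero_mul, add_zero]
  simp only [hbg.re_current hx, Finset.mul_sum, framePot]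
  rw [Finset.sum_comm]
  refine Finset.sum_congr rfl fun j _ => ?_
  have : A x (Fin.last 3) = 0 := hbg.potential_third x hx
  rw [Fin.sum_univ_castSucc (n := 3), this, zero_mul, mul_zero, add_zero]
  exact Finset.sum_congr rfl fun α _ => by ring

/-- The Dirac Lagrangian of a spinor field in terms of the twist of its coframe. -/
theorem IsSpecialBackground.diracLagrangian_eq (hU : IsOpen U) (hbg : IsSpecialBackground U g A σ)
    (hx : x ∈ cyl U) (hξ : DifferentiableAt ℝ ξ x) (hz : spinNorm (ξ x) ≠ 0) :
    diracLagrangian ε m g A σ ξ x = spinNorm (ξ x) * Real.sqrt |(g x).det| *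
      (twist g A (spinFrame (pauliCoframe σ) ξ) x / 4 - ε * m) := by
  have hH : ∀ α : Fin 4, (sigmaUp g σ α x).IsHermitian := fun α => by
    refine Matrix.IsHermitian.ext fun a b => ?_
    simp only [sigmaUp, Matrix.sum_apply, Matrix.smul_apply, smul_eq_mul, star_sum, star_mul',
      (hbg.pauli.hermitian _ x hx).apply]
    simp
  have hmass : (∑ a, ∑ b, ξ x a * σ 3 x a b * star (ξ x b)).re = spinNorm (ξ x) := by
    simp [hbg.pauli_third x hx, spinNorm]
    ring
  have e : (∑ α : Fin 3, ∑ a, ∑ b,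
      ((Complex.I / 2) *
          (star (ξ x b) * sigmaUp g σ α.castSucc x a b * spinNabla g σ α.castSucc ξ x a
            - ξ x a * sigmaUp g σ α.castSucc x a b * star (spinNabla g σ α.castSucc ξ x b))
        + (A x α.castSucc : ℂ) * (ξ x a * sigmaUp g σ α.castSucc x a b * star (ξ x b)))
    - (ε : ℂ) * (m : ℂ) * ∑ a, ∑ b, ξ x a * σ 3 x a b * star (ξ x b)).re =
    -(∑ α : Fin 3, (∑ a, ∑ b, star (ξ x b) * sigmaUp g σ α.castSucc x a b *
      spinNabla g σ α.castSucc ξ x a).im) + ∑ α : Fin 3, A x α.castSucc *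
      (∑ a, ∑ b, ξ x a * sigmaUp g σ α.castSucc x a b * star (ξ x b)).re -
      ε * m * spinNorm (ξ x) := by
    rw [Complex.sub_re, ← Complex.ofReal_mul, Complex.re_ofReal_mul, hmass, Complex.re_sum]
    congr 1
    rw [← Finset.sum_neg_distrib, ← Finset.sum_add_distrib]
    refine Finset.sum_congr rfl fun α _ => ?_
    rw [← re_kinetic (hH _), ← Complex.re_ofReal_mul, ← Complex.add_re]
    simp only [Finset.mul_sum, Finset.sum_add_distrib]
  rw [diracLagrangian, e, hbg.sum_im_kinetic hU hx, hbg.sum_re_current hx,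
    twist_spinFrame (hbg.smoothFrameAt_pauli hU hx) hξ hz]
  field_simp
  ring

/-! ### States corresponding to spinor fields -/

variable {U : Set (Fin 3 → ℝ)} {ε m : ℝ} {g : MetricField} {A : CovField 4} {σ : PauliField}
  {ξ : SpinorField} {ϑ : Coframe} {ρ : (Fin 4 → ℝ) → ℝ} {Ξ : ℝ → SpinorField} {x : Fin 4 → ℝ}

/-- With η_ḃ = ξ^a σ_{3aḃ} the scalar is automatically real, so the condition on s reduces to
positivity of the norm. -/
theorem scalar_specialEta (hbg : IsSpecialBackground U g A σ) (hx : x ∈ cyl U) :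
    scalar ξ (specialEta σ ξ) x = (spinNorm (ξ x) : ℂ) := by
  refine Complex.ext ?_ ?_ <;>
    simp [scalar, specialEta, hbg.pauli_third x hx, spinNorm] <;> ring

theorem Corresponds.spinNorm_pos (hc : Corresponds (cyl U) g σ ξ (specialEta σ ξ) ϑ ρ)
    (hbg : IsSpecialBackground U g A σ) (hx : x ∈ cyl U) : 0 < spinNorm (ξ x) := by
  have h := hc.re_scalar x hx
  rwa [scalar_specialEta hbg hx, Complex.ofReal_re] at h

theorem Corresponds.norm_scalar (hc : Corresponds (cyl U) g σ ξ (specialEta σ ξ) ϑ ρ)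
    (hbg : IsSpecialBackground U g A σ) (hx : x ∈ cyl U) :
    ‖scalar ξ (specialEta σ ξ) x‖ = spinNorm (ξ x) := by
  rw [scalar_specialEta hbg hx, Complex.norm_real, Real.norm_of_nonneg (hc.spinNorm_pos hbg hx).le]

theorem Corresponds.density_eq (hc : Corresponds (cyl U) g σ ξ (specialEta σ ξ) ϑ ρ)
    (hbg : IsSpecialBackground U g A σ) (hx : x ∈ cyl U) :
    ρ x = spinNorm (ξ x) * Real.sqrt |(g x).det| := by
  rw [hc.density x hx, hc.norm_scalar hbg hx]

/-- Expanding σ_α in the flat basis turns the bilinear formulas for ϑ^0 ± ϑ^3 and ϑ^1 + iϑ^2 into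
real quadratic forms in ξ times ϕ^k_α; their coefficients are the entries of `spinMat`. -/
theorem Corresponds.coframe_eq (hc : Corresponds (cyl U) g σ ξ (specialEta σ ξ) ϑ ρ)
    (hbg : IsSpecialBackground U g A σ)
    (hs : IsSpecialState U g ϑ ρ) (hx : x ∈ cyl U) (j : Fin 4) :
    ϑ j x = spinFrame (pauliCoframe σ) ξ j x := by
  have hn := (hc.spinNorm_pos hbg hx).ne'
  have hσ : ∀ α a b, σ α x a b = ∑ j, (pauliCoframe σ j x α : ℂ) * flatPauli j a b :=
    fun α a b => hbg.pauli.eq_sum hx α a b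
  -- From η_ḃ = (ξ^0, −ξ^1), raising the index gives (−ξ^1, −ξ^0).
  have e0 : etaUp (specialEta σ ξ) x 0 = -ξ x 1 := by
    simp [etaUp, eps, specialEta, hbg.pauli_third x hx]
  have e1 : etaUp (specialEta σ ξ) x 1 = -ξ x 0 := by
    simp [etaUp, eps, specialEta, hbg.pauli_third x hx]
  have h3 := hbg.pauliCoframe_three hx
  have hϑ3 := hs.third x hx
  funext α
  have hp := congrArg Complex.re (hc.plus x hx α)
  have hm := congrArg Complex.re (hc.minus x hx α)
  have hr := congrArg Complex.re (hc.cross x hx α)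
  have hi := congrArg Complex.im (hc.cross x hx α)
  rw [hc.norm_scalar hbg hx] at hp hm hr hi
  have hne : (-((spinNorm (ξ x))⁻¹ : ℝ) : ℂ) = ((-(spinNorm (ξ x))⁻¹ : ℝ) : ℂ) := by push_cast; rfl
  rw [hne] at hr hi
  rw [Complex.ofReal_re, Complex.re_ofReal_mul] at hp hm
  rw [Complex.re_ofReal_mul] at hr
  rw [Complex.im_ofReal_mul] at hi
  simp only [hσ, Fin.sum_univ_two, Fin.sum_univ_four, e0, e1] at hp hm hr hi
  simp [flatPauli] at hp hm hr hi
  simp only [spinFrame, mulFrame, spinRot, Fin.sum_univ_four]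
  fin_cases j
  · simp [spinMat]
    field_simp
    field_simp at hp hm
    linarith
  · simp [spinMat]
    rw [hr]
    field_simp
    ring
  · simp [spinMat]
    rw [hi]
    field_simp
    ring
  · have : spinMat (ξ x) 3 3 = spinNorm (ξ x) := by simp [spinMat, spinNorm]
    simp [spinMat, h3, hϑ3]
    rw [← spinNorm, div_self hn, one_mul]

/-! ### Families of spinor fields -/

/-- Parameters and points where a family of spinor fields has positive norm. -/
def spinDomain (U : Set (Fin 3 → ℝ)) (Ξ : ℝ → SpinorField) : Set (ℝ × (Fin 4 → ℝ)) :=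
  (Set.univ ×ˢ cyl U) ∩ {p | 0 < spinNorm (Ξ p.1 p.2)}

theorem contDiffOn_spinNorm_family (hΞ : ∀ a, ContDiffOn ℝ ∞ (fun p : ℝ × (Fin 4 → ℝ) => Ξ p.1 p.2 a) (Set.univ ×ˢ cyl U)) :
    ContDiffOn ℝ ∞ (fun p : ℝ × (Fin 4 → ℝ) => spinNorm (Ξ p.1 p.2)) (Set.univ ×ˢ cyl U) :=
  contDiff_spinNorm.comp_contDiffOn (f := fun p : ℝ × (Fin 4 → ℝ) => Ξ p.1 p.2)
    (contDiffOn_pi.2 hΞ)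

theorem isOpen_spinDomain (hU : IsOpen U)
    (hΞ : ∀ a, ContDiffOn ℝ ∞ (fun p : ℝ × (Fin 4 → ℝ) => Ξ p.1 p.2 a) (Set.univ ×ˢ cyl U)) : IsOpen (spinDomain U Ξ) :=
  (contDiffOn_spinNorm_family hΞ).continuousOn.isOpen_inter_preimage
    (isOpen_univ.prod (isOpen_cyl hU)) isOpen_Ioi

theorem contDiffOn_spinFrame_family (hbg : IsSpecialBackground U g A σ)
    (hΞ : ∀ a, ContDiffOn ℝ ∞ (fun p : ℝ × (Fin 4 → ℝ) => Ξ p.1 p.2 a) (Set.univ ×ˢ cyl U)) (j α : Fin 4) : ContDiffOn ℝ ∞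
    (fun p : ℝ × (Fin 4 → ℝ) => spinFrame (pauliCoframe σ) (Ξ p.1) j p.2 α) (spinDomain U Ξ) := by
  have h1 : ContDiffOn ℝ ∞ (fun p : ℝ × (Fin 4 → ℝ) => Ξ p.1 p.2) (spinDomain U Ξ) :=
    (contDiffOn_pi.2 hΞ).mono Set.inter_subset_left
  have h2 : ∀ k, ContDiffOn ℝ ∞ (fun p : ℝ × (Fin 4 → ℝ) => spinRot (Ξ p.1 p.2) j k)
      (spinDomain U Ξ) := fun k p hp =>
    ContDiffAt.comp_contDiffWithinAt (g := fun z => spinRot z j k)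
      (f := fun p : ℝ × (Fin 4 → ℝ) => Ξ p.1 p.2) p (contDiffAt_spinRot (ne_of_gt hp.2) j k) (h1 p hp)
  have h3 : (fun p : ℝ × (Fin 4 → ℝ) => spinFrame (pauliCoframe σ) (Ξ p.1) j p.2 α) =
      fun p => ∑ k, spinRot (Ξ p.1 p.2) j k * pauliCoframe σ k p.2 α := rfl
  rw [h3]
  exact ContDiffOn.sum fun k _ => (h2 k).mul
    ((contDiffOn_comp_snd (hbg.pauli.contDiffOn_coframe k α)).mono Set.inter_subset_left)

theorem frameAt_spinFrame (hbg : IsSpecialBackground U g A σ) (hx : x ∈ cyl U)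
    (hz : spinNorm (ξ x) ≠ 0) : FrameAt g (spinFrame (pauliCoframe σ) ξ) x :=
  frameAt_mulFrame (hbg.pauli.isCoframe.frameAt hbg.metric hx) (spinRot_lorentz hz)

theorem mem_spinDomain (hbg : IsSpecialBackground U g A σ)
    (hc : Corresponds (cyl U) g σ ξ (specialEta σ ξ) ϑ ρ) (h0 : ∀ x ∈ cyl U, Ξ 0 x = ξ x)
    (hx : x ∈ cyl U) : ((0 : ℝ), x) ∈ spinDomain U Ξ := by
  refine ⟨Set.mk_mem_prod (Set.mem_univ _) hx, ?_⟩
  change 0 < spinNorm (Ξ 0 x)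
  rw [h0 x hx]
  exact hc.spinNorm_pos hbg hx

/-- Positivity of the norm is an open condition that holds at t = 0, so any spinor variation yields
coframes for small t, locally near each point. Variations of ξ thereby become variations of ϑ. -/
theorem isFamilyAt_spinFrame (hU : IsOpen U)
    (hbg : IsSpecialBackground U g A σ)
    (hΞ : ∀ a, ContDiffOn ℝ ∞ (fun p : ℝ × (Fin 4 → ℝ) => Ξ p.1 p.2 a) (Set.univ ×ˢ cyl U)) (hs : IsSpecialState U g ϑ ρ)
    (hc : Corresponds (cyl U) g σ ξ (specialEta σ ξ) ϑ ρ) (h0 : ∀ x ∈ cyl U, Ξ 0 x = ξ x)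
    (hx : x ∈ cyl U) : IsFamilyAt g ϑ (fun t => spinFrame (pauliCoframe σ) (Ξ t)) x := by
  refine isFamilyAt_of_local (isOpen_cyl hU) hbg.metric hs.smooth_coframe
    (isOpen_spinDomain hU hΞ) (contDiffOn_spinFrame_family hbg hΞ)
    (fun p hp => frameAt_spinFrame hbg hp.1.2 (ne_of_gt hp.2)) (fun y hy j => ?_) hx
    (mem_spinDomain hbg hc h0 hx)
  rw [hc.coframe_eq hbg hs hy]
  funext α
  simp only [spinFrame, mulFrame, h0 y hy]

theorem contDiffOn_sqrt_det {M : Set (Fin 4 → ℝ)} (hg : IsLorentzMetric M g) :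
    ContDiffOn ℝ ∞ (fun x => Real.sqrt |(g x).det|) M := by
  intro x hx
  have hd := hg.det_ne hx
  have h1 : ContDiffWithinAt ℝ ∞ (fun x => |(g x).det|) M x :=
    ContDiffAt.comp_contDiffWithinAt (g := fun r : ℝ => |r|) (f := fun x => (g x).det) x
      (contDiffAt_abs hd) (contDiffOn_det hg.smooth x hx)
  exact h1.sqrt (abs_ne_zero.2 hd)

/-- The Dirac Lagrangian of a family, on `spinDomain`. -/
theorem diracLagrangian_family_eq (hU : IsOpen U) (hbg : IsSpecialBackground U g A σ)
    (hΞ : ∀ a, ContDiffOn ℝ ∞ (fun p : ℝ × (Fin 4 → ℝ) => Ξ p.1 p.2 a) (Set.univ ×ˢ cyl U))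
    {t : ℝ} (hx : (t, x) ∈ spinDomain U Ξ) :
    diracLagrangian ε m g A σ (Ξ t) x = spinNorm (Ξ t x) * Real.sqrt |(g x).det| *
      (twist g A (spinFrame (pauliCoframe σ) (Ξ t)) x / 4 - ε * m) := by
  refine hbg.diracLagrangian_eq hU hx.1.2 (differentiableAt_pi.2 fun a => ?_) (ne_of_gt hx.2)
  have h : ContDiffAt ℝ ∞ (fun p : ℝ × (Fin 4 → ℝ) => Ξ p.1 p.2 a) (t, x) :=
    (hΞ a).contDiffAt ((isOpen_univ.prod (isOpen_cyl hU)).mem_nhds hx.1)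
  have h2 : ContDiffAt ℝ ∞ (fun y : Fin 4 → ℝ => ((t, y) : ℝ × (Fin 4 → ℝ))) x :=
    contDiffAt_const.prodMk contDiffAt_id
  exact (ContDiffAt.comp x (g := fun p : ℝ × (Fin 4 → ℝ) => Ξ p.1 p.2 a) h h2).differentiableAt
    (by simp)

theorem contDiffOn_diracLagrangian_family (hU : IsOpen U)
    (hbg : IsSpecialBackground U g A σ)
    (hΞ : ∀ a, ContDiffOn ℝ ∞ (fun p : ℝ × (Fin 4 → ℝ) => Ξ p.1 p.2 a) (Set.univ ×ˢ cyl U)) : ContDiffOn ℝ ∞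
    (fun p : ℝ × (Fin 4 → ℝ) => diracLagrangian ε m g A σ (Ξ p.1) p.2) (spinDomain U Ξ) := by
  refine ContDiffOn.congr ?_ fun p hp => diracLagrangian_family_eq hU hbg hΞ hp
  refine (((contDiffOn_spinNorm_family hΞ).mono Set.inter_subset_left).mul
    ((contDiffOn_comp_snd (contDiffOn_sqrt_det hbg.metric)).mono Set.inter_subset_left)).mul
    (ContDiffOn.sub (ContDiffOn.div_const ?_ 4) contDiffOn_const)
  exact contDiffOn_twist_family (Θ := fun t => spinFrame (pauliCoframe σ) (Ξ t))
    (isOpen_spinDomain hU hΞ) (fun p hp => hp.1.2) hbg.metric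
    hbg.potential_smooth (contDiffOn_spinFrame_family hbg hΞ)

/-- The pointwise first variation of the Dirac Lagrangian. -/
theorem hasDerivAt_diracLagrangian (hU : IsOpen U) (hbg : IsSpecialBackground U g A σ)
    (hΞ : ∀ a, ContDiffOn ℝ ∞ (fun p : ℝ × (Fin 4 → ℝ) => Ξ p.1 p.2 a) (Set.univ ×ˢ cyl U))
    (hs : IsSpecialState U g ϑ ρ) (hc : Corresponds (cyl U) g σ ξ (specialEta σ ξ) ϑ ρ)
    (h0 : ∀ x ∈ cyl U, Ξ 0 x = ξ x) (hx : x ∈ cyl U) :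
    HasDerivAt (fun t => diracLagrangian ε m g A σ (Ξ t) x)
      (velocity (fun p : ℝ × (Fin 4 → ℝ) => spinNorm (Ξ p.1 p.2)) x * Real.sqrt |(g x).det| *
        (twist g A ϑ x / 4 - ε * m) + rotDensity g A ϑ ρ
          (rotParam g ϑ fun t => spinFrame (pauliCoframe σ) (Ξ t)) x / 4) 0 := by
  have hf := isFamilyAt_spinFrame hU hbg hΞ hs hc h0 hx
  have hρ := (hs.pos x hx).ne'
  have h1 := hf.hasDerivAt_twist_rotDensity (A := A) (hbg.sideTwist_eq_zero hU hs hx) hρ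
  have h2 : HasDerivAt (fun t => spinNorm (Ξ t x)) _ 0 := hasDerivAt_velocity
    (f := fun p : ℝ × (Fin 4 → ℝ) => spinNorm (Ξ p.1 p.2))
    (((contDiffOn_spinNorm_family hΞ).contDiffAt ((isOpen_univ.prod (isOpen_cyl hU)).mem_nhds
      (Set.mk_mem_prod (Set.mem_univ _) hx))).differentiableAt (by simp))
  have hS := mem_spinDomain hbg hc h0 hx
  have hev : (fun t => diracLagrangian ε m g A σ (Ξ t) x) =ᶠ[𝓝 0] fun t =>
      spinNorm (Ξ t x) * Real.sqrt |(g x).det| *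
        (twist g A (spinFrame (pauliCoframe σ) (Ξ t)) x / 4 - ε * m) := by
    have hcont : Tendsto (fun t : ℝ => (t, x)) (𝓝 0) (𝓝 (0, x)) :=
      tendsto_id.prodMk_nhds tendsto_const_nhds
    filter_upwards [hcont.eventually ((isOpen_spinDomain hU hΞ).mem_nhds hS)] with t ht
    exact diracLagrangian_family_eq hU hbg hΞ ht
  refine HasDerivAt.congr_of_eventuallyEq ?_ hev
  refine ((h2.mul_const _).fun_mul ((h1.div_const 4).sub_const (ε * m))).congr_deriv ?_
  have ht : twist g A (spinFrame (pauliCoframe σ) (Ξ 0)) x = twist g A ϑ x := by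
    have e : ∀ i k l, structCoeff g (spinFrame (pauliCoframe σ) (Ξ 0)) x i k l =
        structCoeff g ϑ x i k l := fun i k l => by
      simp only [structCoeff, frame2, hf.dform_start, hf.dualFrame_start]
    simp only [twist, e, framePot, hf.dualFrame_start]
  rw [ht, h0 x hx, ← hc.density_eq hbg hx]
  field_simp

/-! ### The Dirac equation and the Euler–Lagrange equations -/

variable {U K : Set (Fin 3 → ℝ)} {ε m : ℝ} {g : MetricField} {A : CovField 4} {σ : PauliField}
  {ξ : SpinorField} {ϑ : Coframe} {ρ : (Fin 4 → ℝ) → ℝ} {Ξ : ℝ → SpinorField} {x : Fin 4 → ℝ}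

theorem hasDerivAt_setIntegral_col {S : Set (ℝ × (Fin 4 → ℝ))} (hS : IsOpen S)
    {F : ℝ × (Fin 4 → ℝ) → ℝ} (hF : ContDiffOn ℝ ∞ F S) (hK : IsCompact K)
    (hKS : ∀ u ∈ K, ((0 : ℝ), (col u 0 : Fin 4 → ℝ)) ∈ S) {F' : (Fin 4 → ℝ) → ℝ}
    (hF' : ∀ u ∈ K, HasDerivAt (fun t => F (t, col u 0)) (F' (col u 0)) 0) :
    HasDerivAt (fun t => ∫ u in K, F (t, col u 0)) (∫ u in K, F' (col u 0)) 0 := by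
  have hcol : ContDiff ℝ ∞ fun p : ℝ × (Fin 3 → ℝ) => (col p.2 0 : Fin 4 → ℝ) :=
    (contDiff_col (n := 3) 0).comp contDiff_snd
  have hpair : ContDiff ℝ ∞ fun p : ℝ × (Fin 3 → ℝ) => (p.1, (col p.2 0 : Fin 4 → ℝ)) :=
    contDiff_fst.prodMk hcol
  have h1 : ContDiffOn ℝ ∞ (fun p : ℝ × (Fin 3 → ℝ) => F (p.1, col p.2 0))
      ((fun p : ℝ × (Fin 3 → ℝ) => (p.1, (col p.2 0 : Fin 4 → ℝ))) ⁻¹' S) :=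
    hF.comp hpair.contDiffOn fun _ hp => hp
  exact hasDerivAt_setIntegral (hS.preimage hpair.continuous) h1 hK
    (fun u hu => Set.mem_preimage.2 (hKS u hu)) (F' := fun u => F' (col u 0)) hF'

/-- The velocity at `0` of the Dirac Lagrangian along a family of spinor fields. -/
def diracVelocity (ε m : ℝ) (g : MetricField) (A : CovField 4) (σ : PauliField) (ϑ : Coframe)
    (ρ : (Fin 4 → ℝ) → ℝ) (Ξ : ℝ → SpinorField) (x : Fin 4 → ℝ) : ℝ :=
  velocity (fun p : ℝ × (Fin 4 → ℝ) => spinNorm (Ξ p.1 p.2)) x * Real.sqrt |(g x).det| *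
    (twist g A ϑ x / 4 - ε * m) +
    rotDensity g A ϑ ρ (rotParam g ϑ fun t => spinFrame (pauliCoframe σ) (Ξ t)) x / 4

/-- The first variation of the Dirac action. -/
theorem hasDerivAt_diracAction (hU : IsOpen U) (hbg : IsSpecialBackground U g A σ)
    (hs : IsSpecialState U g ϑ ρ) (hc : Corresponds (cyl U) g σ ξ (specialEta σ ξ) ϑ ρ)
    (hK : IsCompact K) (hKU : K ⊆ U) (hΞ : IsSpinorVariation U K ξ Ξ) :
    HasDerivAt (fun t => ∫ u in K, diracLagrangian ε m g A σ (Ξ t) (col u 0))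
      (∫ u in K, diracVelocity ε m g A σ ϑ ρ Ξ (col u 0)) 0 := by
  have h1 : ∀ u ∈ K, HasDerivAt (fun t => diracLagrangian ε m g A σ (Ξ t) (col u 0))
      (diracVelocity ε m g A σ ϑ ρ Ξ (col u 0)) 0 := fun u hu =>
    hasDerivAt_diracLagrangian hU hbg hΞ.smooth hs hc hΞ.start (col_mem_cyl (hKU hu) 0)
  have h2 : ∀ u ∈ K, ((0 : ℝ), (col u 0 : Fin 4 → ℝ)) ∈ spinDomain U Ξ := fun u hu =>
    mem_spinDomain hbg hc hΞ.start (col_mem_cyl (hKU hu) 0)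
  exact hasDerivAt_setIntegral_col (isOpen_spinDomain hU hΞ.smooth)
    (F := fun p => diracLagrangian ε m g A σ (Ξ p.1) p.2)
    (contDiffOn_diracLagrangian_family hU hbg hΞ.smooth) hK h2 h1

/-- With T = 4εm the variation of the norm drops out, and the rest is a quarter of an integrated
divergence. The family of coframes is needed only near t = 0. -/
theorem EulerLagrange.isDiracSolution (hE : EulerLagrange U m g A ϑ ρ ε) (hU : IsOpen U)
    (hbg : IsSpecialBackground U g A σ) (hs : IsSpecialState U g ϑ ρ)
    (hc : Corresponds (cyl U) g σ ξ (specialEta σ ξ) ϑ ρ) : IsDiracSolution U ε m g A σ ξ := by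
  intro K hK hKU Ξ hΞ
  refine (hasDerivAt_diracAction hU hbg hs hc hK hKU hΞ).congr_deriv ?_
  have hf : ∀ x ∈ cyl U, IsFamilyAt g ϑ (fun t => spinFrame (pauliCoframe σ) (Ξ t)) x :=
    fun x hx => isFamilyAt_spinFrame hU hbg hΞ.smooth hs hc hΞ.start hx
  have h1 := hE.setIntegral_rotDensity_col hU hbg hs hK hKU
    (b := rotParam g ϑ fun t => spinFrame (pauliCoframe σ) (Ξ t))
    (contDiffOn_rotParam hbg.metric hs.smooth_coframe fun x hx j α => (hf x hx).smooth j α)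
    (fun k x hx => rotParam_eq_zero (fun t j => by
      rw [hc.coframe_eq hbg hs hx.1]
      funext α
      simp only [spinFrame, mulFrame, hΞ.support t x hx]) k)
  refine Eq.trans ?_ (by rw [h1, zero_div] :
    (∫ u in K, rotDensity g A ϑ ρ
      (rotParam g ϑ fun t => spinFrame (pauliCoframe σ) (Ξ t)) (col u 0)) / 4 = 0)
  rw [← integral_div]
  refine setIntegral_congr_fun hK.measurableSet fun u hu => ?_
  simp only [diracVelocity, hE.twist_eq _ (col_mem_cyl (hKU hu) 0)]
  ring

/-- The tangent vector at a spinor with given rates of scaling, rotation and boosts. -/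
def spinTangent (c : Fin 4 → ℝ) (z : Fin 2 → ℂ) : Fin 2 → ℂ := fun a =>
  ((c 0 : ℂ) - Complex.I * (c 1 : ℂ)) / 2 * z a +
    ((c 3 : ℂ) + Complex.I * (c 2 : ℂ)) / 2 * ![star (z 1), star (z 0)] a

/-- Only the scaling changes the norm: iz and the complex multiples of (z̄^1, z̄^0) are tangent to
its level sets. Where the norm is nonzero, z and (z̄^1, z̄^0) are independent over ℂ, so all
variations of the spinor are covered. -/
theorem spinNormPolar_tangent (c : Fin 4 → ℝ) (z : Fin 2 → ℂ) :
    spinNormPolar z (spinTangent c z) = c 0 * spinNorm z := by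
  simp [spinNormPolar, spinNorm, spinTangent]
  ring

/-- The first three identities read off the generators of the coframe from the rates c. The last
three, orthogonality of the rows, are what `generator_spinFrame` needs to discard the derivative of
the norm. -/
theorem spinMat_tangent (c : Fin 4 → ℝ) (z : Fin 2 → ℂ) :
    (∑ p, sgn p * spinMat z 2 p * spinMatPolar z (spinTangent c z) 1 p = -c 1 * spinNorm z ^ 2) ∧
    (∑ p, sgn p * spinMat z 2 p * spinMatPolar z (spinTangent c z) 0 p = -c 2 * spinNorm z ^ 2) ∧
    (∑ p, sgn p * spinMat z 1 p * spinMatPolar z (spinTangent c z) 0 p = -c 3 * spinNorm z ^ 2) ∧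
    (∑ p, sgn p * spinMat z 2 p * spinMat z 1 p = 0) ∧
    (∑ p, sgn p * spinMat z 2 p * spinMat z 0 p = 0) ∧
    (∑ p, sgn p * spinMat z 1 p * spinMat z 0 p = 0) := by
  refine ⟨?_, ?_, ?_, ?_, ?_, ?_⟩ <;>
  · simp [Fin.sum_univ_four, sgn, spinMatPolar, spinMat, spinTangent, spinNorm]
    ring

theorem hasDerivAt_spinLine (z w : Fin 2 → ℂ) :
    HasDerivAt (fun t : ℝ => fun a => z a + (t : ℂ) * w a) w 0 := by
  refine hasDerivAt_pi.2 fun a => ?_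
  have h1 : HasDerivAt (fun t : ℝ => (t : ℂ)) 1 0 := Complex.ofRealCLM.hasDerivAt
  simpa using (h1.mul_const (w a)).const_add (z a)

/-- The infinitesimal Lorentz transformation of the coframe when the spinor field moves. -/
theorem generator_spinFrame (hbg : IsSpecialBackground U g A σ) (hs : IsSpecialState U g ϑ ρ)
    (hc : Corresponds (cyl U) g σ ξ (specialEta σ ξ) ϑ ρ) (hx : x ∈ cyl U) {w : Fin 2 → ℂ}
    (h : HasDerivAt (fun t => Ξ t x) w 0) (h0 : Ξ 0 x = ξ x) {j k : Fin 4}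
    (hjk : ∑ p, sgn p * spinMat (ξ x) k p * spinMat (ξ x) j p = 0) :
    generator g ϑ (fun t => spinFrame (pauliCoframe σ) (Ξ t)) j k x =
      sgn k * (∑ p, sgn p * spinMat (ξ x) k p * spinMatPolar (ξ x) w j p) /
        spinNorm (ξ x) ^ 2 := by
  have hn := (hc.spinNorm_pos hbg hx).ne'
  have hf := hbg.pauli.isCoframe.frameAt hbg.metric hx
  have hn0 : spinNorm (Ξ 0 x) ≠ 0 := by rw [h0]; exact hn
  have hv : ∀ α, coframeVelocity (fun t => spinFrame (pauliCoframe σ) (Ξ t)) j x α =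
      ∑ p, spinRotDeriv (ξ x) w j p * pauliCoframe σ p x α := fun α => by
    have h1 : HasDerivAt (fun t => ∑ p, spinRot (Ξ t x) j p * pauliCoframe σ p x α) _ 0 :=
      HasDerivAt.fun_sum fun p _ => (hasDerivAt_spinRot h hn0 j p).mul_const _
    rw [h0] at h1
    exact h1.deriv
  have hd : ∀ α, dualFrame g ϑ x k α =
      ∑ p, sgn k * (sgn p * spinRot (ξ x) k p) * dualFrame g (pauliCoframe σ) x p α := fun α => by
    have e : dualFrame g ϑ x k α = dualFrame g (spinFrame (pauliCoframe σ) ξ) x k α := by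
      simp only [dualFrame, hc.coframe_eq hbg hs hx]
    rw [e, spinFrame, dualFrame_mulFrame]
  have e1 : generator g ϑ (fun t => spinFrame (pauliCoframe σ) (Ξ t)) j k x =
      ∑ p, ∑ q, spinRotDeriv (ξ x) w j p * (sgn k * (sgn q * spinRot (ξ x) k q)) *
        ∑ α, pauliCoframe σ p x α * dualFrame g (pauliCoframe σ) x q α := by
    simp only [generator, hv, hd, Finset.sum_mul_sum]
    simp only [Finset.mul_sum]
    rw [Finset.sum_comm]
    refine Finset.sum_congr rfl fun p _ => ?_
    rw [Finset.sum_comm]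
    exact Finset.sum_congr rfl fun q _ => Finset.sum_congr rfl fun α _ => by ring
  have e2 : ∑ p, spinRotDeriv (ξ x) w j p * (sgn k * (sgn p * spinRot (ξ x) k p)) =
      sgn k * (∑ p, sgn p * spinMat (ξ x) k p * spinMatPolar (ξ x) w j p) / spinNorm (ξ x) ^ 2 -
      sgn k * (∑ p, sgn p * spinMat (ξ x) k p * spinMat (ξ x) j p) *
        (spinNormPolar (ξ x) w / spinNorm (ξ x) ^ 3) := by
    simp only [Finset.mul_sum, Finset.sum_div, Finset.sum_mul]
    rw [← Finset.sum_sub_distrib]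
    refine Finset.sum_congr rfl fun p _ => ?_
    simp only [spinRot, spinRotDeriv]
    field_simp
  rw [e1]
  simp only [hf.dual, mul_ite, mul_one, mul_zero, Finset.sum_ite_eq, Finset.mem_univ, if_true]
  rw [e2, hjk]
  ring

theorem rotParam_spinTangent (hbg : IsSpecialBackground U g A σ) (hs : IsSpecialState U g ϑ ρ)
    (hc : Corresponds (cyl U) g σ ξ (specialEta σ ξ) ϑ ρ) (hx : x ∈ cyl U) {c : Fin 4 → ℝ}
    (h : HasDerivAt (fun t => Ξ t x) (spinTangent c (ξ x)) 0) (h0 : Ξ 0 x = ξ x) (k : Fin 3) :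
    rotParam g ϑ (fun t => spinFrame (pauliCoframe σ) (Ξ t)) k x = c k.succ := by
  have hn := (hc.spinNorm_pos hbg hx).ne'
  obtain ⟨a1, a2, a3, b1, b2, b3⟩ := spinMat_tangent c (ξ x)
  have s1 : sgn 1 = -1 := rfl
  have s2 : sgn 2 = -1 := rfl
  fin_cases k
  · change generator _ _ _ 1 2 x = c 1
    rw [generator_spinFrame hbg hs hc hx h h0 b1, a1, s2]
    field_simp
  · change generator _ _ _ 0 2 x = c 2
    rw [generator_spinFrame hbg hs hc hx h h0 b2, a2, s2]
    field_simp
  · change generator _ _ _ 0 1 x = c 3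
    rw [generator_spinFrame hbg hs hc hx h h0 b3, a3, s1]
    field_simp

/-- The spinor field moved along `spinTangent` with rates `b c`. -/
def spinLine (ξ : SpinorField) (b : (Fin 3 → ℝ) → ℝ) (c : Fin 4 → ℝ) (t : ℝ) : SpinorField :=
  fun x a => ξ x a + (t : ℂ) * spinTangent (fun i => b (base x) * c i) (ξ x) a

theorem isSpinorVariation_line (hξ : ∀ a, ContDiffOn ℝ ∞ (fun x => ξ x a) (cyl U))
    (hξ3 : IndepX3 (cyl U) ξ) {b : (Fin 3 → ℝ) → ℝ} (hb : ContDiff ℝ ∞ b) (c : Fin 4 → ℝ) :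
    IsSpinorVariation U (tsupport b) ξ (spinLine ξ b c) where
  smooth a := by
    have h1 : ∀ a, ContDiffOn ℝ ∞ (fun p : ℝ × (Fin 4 → ℝ) => ξ p.2 a) (Set.univ ×ˢ cyl U) :=
      fun a => (hξ a).comp contDiffOn_snd fun p hp => hp.2
    have h2 : ∀ a, ContDiffOn ℝ ∞ (fun p : ℝ × (Fin 4 → ℝ) => star (ξ p.2 a))
        (Set.univ ×ˢ cyl U) := fun a => Complex.conjCLE.contDiff.comp_contDiffOn (h1 a)
    have h3 : ∀ i, ContDiff ℝ ∞ fun p : ℝ × (Fin 4 → ℝ) => ((b (base p.2) * c i : ℝ) : ℂ) :=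
      fun i => Complex.ofRealCLM.contDiff.comp
        ((hb.comp (contDiff_base.comp contDiff_snd)).mul contDiff_const)
    have h4 : ContDiff ℝ ∞ fun p : ℝ × (Fin 4 → ℝ) => (p.1 : ℂ) :=
      Complex.ofRealCLM.contDiff.comp contDiff_fst
    have h5 : ContDiffOn ℝ ∞ (fun p : ℝ × (Fin 4 → ℝ) =>
        (![star (ξ p.2 1), star (ξ p.2 0)] : Fin 2 → ℂ) a) (Set.univ ×ˢ cyl U) := by
      fin_cases a
      · exact h2 1
      · exact h2 0
    exact (h1 a).add (h4.contDiffOn.mul ((((h3 0).sub (contDiff_const.mul (h3 1))).div_const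
      2).contDiffOn.mul (h1 a) |>.add ((((h3 3).add (contDiff_const.mul (h3 2))).div_const
      2).contDiffOn.mul h5)))
  indep t x hx y hy e := by
    funext a
    simp only [spinLine, hξ3 x hx y hy e, e]
  start x _ := by
    funext a
    simp [spinLine]
  support t x hx := by
    have : b (base x) = 0 := image_eq_zero_of_notMem_tsupport fun h => hx.2 h
    funext a
    simp [spinLine, this, spinTangent]

/-- Straight lines in the direction of `spinTangent` with rates b·c are admissible variations of ξ,
and along them norm and generators have velocities prescribed by c. All four equations are thus
contained in one formula. -/
theorem IsDiracSolution.weak (h : IsDiracSolution U ε m g A σ ξ) (hU : IsOpen U)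
    (hbg : IsSpecialBackground U g A σ) (hs : IsSpecialState U g ϑ ρ)
    (hξ : ∀ a, ContDiffOn ℝ ∞ (fun x => ξ x a) (cyl U)) (hξ3 : IndepX3 (cyl U) ξ)
    (hc : Corresponds (cyl U) g σ ξ (specialEta σ ξ) ϑ ρ) {b : (Fin 3 → ℝ) → ℝ}
    (hb : ContDiff ℝ ∞ b) (hcs : HasCompactSupport b) (hsub : tsupport b ⊆ U) (c : Fin 4 → ℝ) :
    ∫ u in tsupport b, (b u * c 0 * (ρ (col u 0) * (twist g A ϑ (col u 0) / 4 - ε * m)) +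
      rotDensity g A ϑ ρ (fun k x => b (base x) * c k.succ) (col u 0) / 4) = 0 := by
  have hv := isSpinorVariation_line hξ hξ3 hb c
  have h1 := (hasDerivAt_diracAction hU hbg hs hc hcs hsub hv).unique (h _ hcs hsub _ hv)
  refine Eq.trans (setIntegral_congr_fun hcs.measurableSet fun u hu => ?_) h1
  have hd : ∀ x, HasDerivAt (fun t => spinLine ξ b c t x)
      (spinTangent (fun i => b (base x) * c i) (ξ x)) 0 := fun x => hasDerivAt_spinLine _ _
  have hx := col_mem_cyl (hsub hu) 0
  have h2 : velocity (fun p : ℝ × (Fin 4 → ℝ) => spinNorm (spinLine ξ b c p.1 p.2)) (col u 0) =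
      b u * c 0 * spinNorm (ξ (col u 0)) := by
    have := (hasDerivAt_spinNorm (hd (col u 0))).deriv
    rw [hv.start _ hx, spinNormPolar_tangent, base_col] at this
    exact this
  have h3 : rotDensity g A ϑ ρ
      (rotParam g ϑ fun t => spinFrame (pauliCoframe σ) (spinLine ξ b c t)) (col u 0) =
      rotDensity g A ϑ ρ (fun k x => b (base x) * c k.succ) (col u 0) :=
    rotDensity_congr fun k => by
      filter_upwards [(isOpen_cyl hU).mem_nhds hx] with y hy
      exact rotParam_spinTangent hbg hs hc hy (hd y) (hv.start y hy) k
  simp only [diracVelocity, h2, h3, hc.density_eq hbg hx]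
  ring

theorem IsDiracSolution.eulerLagrange (h : IsDiracSolution U ε m g A σ ξ) (hU : IsOpen U)
    (hbg : IsSpecialBackground U g A σ) (hs : IsSpecialState U g ϑ ρ)
    (hξ : ∀ a, ContDiffOn ℝ ∞ (fun x => ξ x a) (cyl U)) (hξ3 : IndepX3 (cyl U) ξ)
    (hc : Corresponds (cyl U) g σ ξ (specialEta σ ξ) ϑ ρ) : EulerLagrange U m g A ϑ ρ ε where
  twist_eq := by
    have hsm : ContDiffOn ℝ ∞ (fun x => ρ x * (twist g A ϑ x / 4 - ε * m)) (cyl U) :=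
      hs.smooth_density.mul (((contDiffOn_twist_special hU hbg hs).div_const 4).sub
        contDiffOn_const)
    have hz := eq_zero_of_weak hU (contDiffOn_comp_col hsm 0) fun b hb hcs hsub => by
      -- Pure scaling of ξ.
      have h1 := h.weak hU hbg hs hξ hξ3 hc hb hcs hsub (Pi.single 0 1)
      refine Eq.trans (setIntegral_congr_fun hcs.measurableSet fun u _ => ?_) h1
      have e : (fun (k : Fin 3) (x : Fin 4 → ℝ) =>
          b (base x) * (Pi.single 0 1 : Fin 4 → ℝ) k.succ) = singleParam 0 fun _ => 0 := by
        funext k x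
        simp [singleParam]
      simp only [e, rotDensity_zero]
      simp
      ring
    intro x hx
    have h1 := hz (base x) hx
    rw [twist_indep hU hbg hs x hx _ (col_mem_cyl hx 0) (base_col _ _).symm]
    have h2 := (mul_eq_zero.1 h1).resolve_left (hs.pos _ (col_mem_cyl hx 0)).ne'
    linarith
  divergence k := by
    refine divergence_of_weak_col hU hbg hs k fun b hb hcs hsub => ?_
    -- The k-th Lorentz generator alone; the shift by one skips the scaling rate.
    have h1 := h.weak hU hbg hs hξ hξ3 hc hb hcs hsub (Pi.single k.succ 1)
    have e : (fun (k' : Fin 3) (x : Fin 4 → ℝ) =>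
        b (base x) * (Pi.single k.succ 1 : Fin 4 → ℝ) k'.succ) =
        singleParam k fun x => b (base x) := by
      funext k' x
      simp [singleParam, Pi.single_apply]
    have h0 : (Pi.single k.succ 1 : Fin 4 → ℝ) 0 = 0 := by simp
    simp only [e, h0, mul_zero, zero_mul, zero_add, integral_div] at h1
    linarith

theorem isDiracSolution_iff (hU : IsOpen U) (hbg : IsSpecialBackground U g A σ)
    (hs : IsSpecialState U g ϑ ρ) (hξ : ∀ a, ContDiffOn ℝ ∞ (fun x => ξ x a) (cyl U))
    (hξ3 : IndepX3 (cyl U) ξ) (hc : Corresponds (cyl U) g σ ξ (specialEta σ ξ) ϑ ρ) :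
    IsDiracSolution U ε m g A σ ξ ↔ EulerLagrange U m g A ϑ ρ ε :=
  ⟨fun h => h.eulerLagrange hU hbg hs hξ hξ3 hc, fun h => h.isDiracSolution hU hbg hs hc⟩

end Cosserat

end

/-- Each side of either equivalence is the disjunction of `EulerLagrange` with κ = 1 and κ = −1. -/
theorem mainTheorem1
    (U : Set (Fin 3 → ℝ)) (hU : IsOpen U) (hUc : IsPreconnected U)
    (m : ℝ) (hm : 0 < m)
    (g : Cosserat.MetricField) (A : Cosserat.CovField 4) (σ : Cosserat.PauliField)
    (hbg : Cosserat.IsSpecialBackground U g A σ)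
    (ϑ : Cosserat.Coframe) (ρ : (Fin 4 → ℝ) → ℝ)
    (hstate : Cosserat.IsSpecialState U g ϑ ρ)
    (ξ : Cosserat.SpinorField)
    (hξ : ∀ a, ContDiffOn ℝ ∞ (fun x => ξ x a) (Cosserat.cyl U))
    (hξ3 : Cosserat.IndepX3 (Cosserat.cyl U) ξ)
    (hcorr : Cosserat.Corresponds (Cosserat.cyl U) g σ ξ (Cosserat.specialEta σ ξ) ϑ ρ) :
    (Cosserat.IsSolution (Cosserat.cyl U) m g A ϑ ρ ↔
      (Cosserat.IsDiracSolution U 1 m g A σ ξ ∨ Cosserat.IsDiracSolution U (-1) m g A σ ξ)) ∧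
    (Cosserat.IsSpecialSolution U m g A ϑ ρ ↔
      (Cosserat.IsDiracSolution U 1 m g A σ ξ ∨ Cosserat.IsDiracSolution U (-1) m g A σ ξ)) := by
  rw [Cosserat.isDiracSolution_iff hU hbg hstate hξ hξ3 hcorr,
    Cosserat.isDiracSolution_iff hU hbg hstate hξ hξ3 hcorr]
  exact ⟨Cosserat.isSolution_iff hU hUc hbg hstate hm.ne',
    Cosserat.isSpecialSolution_iff hU hUc hbg hstate hm.ne'⟩
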